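/- Let $q\ge 2$ be an integer and let $(J_{ij})_{1\le i<j<\infty}$ be i.i.d. real random variables on a probability space $(\Omega,\mathcal F,\mathbb P)$ with $\mathbb E[J_{12}]=1$, $\mathbb V[J_{12}]\in(0,\infty)$, and such that $0$ is an interior point of $\{\lambda\in\mathbb R:\mathbb E[e^{\lambda J_{12}}]<\infty\}$. For $N\ge 2$ and $\sigma\in\mathcal S_N=\{1,\dots,q\}^N$ let $$H_N(\sigma)=-\frac1N\sum_{1\le i<j\le N}J_{ij}\mathbf 1_{\{\sigma_i=\sigma_j\}},\qquad \widetilde H_N(\sigma)=-\frac1N\sum_{1\le i<j\le N}\mathbf 1_{\{\sigma_i=\sigma_j\}}$$ be the Hamiltonians of the disordered Curie--Weiss--Potts (DCWP) and of the Curie--Weiss--Potts (CWP) model. For the DCWP model at inverse temperature $\beta$, let $\mu_N(\sigma)\propto e^{-\beta H_N(\sigma)}$ be the Gibbs measure, and consider the discrete-time Markov chain on $\mathcal S_N$ with transition probabilities $\pi_N(\sigma,\eta)=(Nq)^{-1}e^{-\beta[H_N(\eta)-H_N(\sigma)]_+}$ if $\sigma$ and $\eta$ differ in exactly one coordinate,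 $\pi_N(\sigma,\sigma)=1-\sum_{\eta\ne\sigma}\pi_N(\sigma,\eta)$, and $\pi_N(\sigma,\eta)=0$ otherwise. Let $\mathrm P^N_\nu,\mathrm E^N_\nu$ be its law and expectation for the initial distribution $\nu$, let $\tau^N_{\mathcal A}=\inf\{t>0:\Sigma^N_t\in\mathcal A\}$, and for non-empty disjoint $\mathcal A,\mathcal B\subset\mathcal S_N$ let $$\nu_{\mathcal A,\mathcal B}(\sigma)=\frac{\mu_N(\sigma)\,\mathrm P^N_\sigma[\tau^N_{\mathcal B}<\tau^N_{\mathcal A}]}{\sum_{\eta\in\mathcal A}\mu_N(\eta)\,\mathrm P^N_\eta[\tau^N_{\mathcal B}<\tau^N_{\mathcal A}]},\qquad \sigma\in\mathcal A,$$ be the last-exit biased distribution. A tilde denotes the same objects for the CWP model, that is, with $\widetilde H_N$ in place of $H_N$. Let $\mathcal P=\{x\in[0,1]^q:\sum_k x_k=1\}$, $\mathcal P_N=\mathcal P\cap\frac1N\mathbb N_0^q$, and $$\widetilde F_{\beta,q}(x)=-\tfrac12\|x\|_2^2+\tfrac1\beta\sum_{i=1}^q x_i\log x_i ,\qquad x\in\mathcal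 P .$$ Let $\boldsymbol m_0=(1/q,\dots,1/q)$, and for $1\le i\le q$ let $\boldsymbol m_i\in\mathcal P$ have $i$-th coordinate $(1+(q-1)s_*)/q$ and all other coordinates $(1-s_*)/q$, where $s_*$ is the largest solution of $\log(1+(q-1)s)-\log(1-s)=\beta s$. Let $\beta_1(q)$ be the infimum of the $\beta>0$ for which $\widetilde F_{\beta,q}$ has a local minimum on $\mathcal P$ other than $\boldsymbol m_0$, and $\beta_2(q)$ the infimum of the $\beta>0$ for which $\boldsymbol m_0$ is not a global minimum of $\widetilde F_{\beta,q}$ on $\mathcal P$. For each $N\geq 1$ and $i$ let $\boldsymbol m_{i,N}\in\mathcal P_N$ be a point of $\mathcal P_N$ closest to $\boldsymbol m_i$ in Euclidean distance, and let $\mathcal M_{i,N}$ be the set of the $\sigma\in\mathcal S_N$ whose vector of colour frequencies $\bigl(\frac1N\#\{j:\sigma_j=k\}\bigr)_{1\le k\le q}$ equals $\boldsymbol m_{i,N}$. Let $\beta>\beta_1(q)$ and let $\mathcal A_N,\mathcal B_N$ be given, for all $N$, by one of the following: (i) $\mathcal A_N=\bigcup_{i=1}^q\mathcal M_{i,N}$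 and $\mathcal B_N=\mathcal M_{0,N}$, if $\beta_1(q)<\beta\le\beta_2(q)$; (ii) $\mathcal A_N=\mathcal M_{0,N}$ and $\mathcal B_N=\bigcup_{i=1}^q\mathcal M_{i,N}$, if $\beta_2(q)<\beta<q$; (iii) $\mathcal A_N=\mathcal M_{k,N}$ and $\mathcal B_N=\bigcup_{1\le i\le q,\,i\ne k}\mathcal M_{i,N}$ for some fixed $k\in\{1,\dots,q\}$, if $\beta>\beta_2(q)$. Then there exist $c_1,\dots,c_6\in(0,\infty)$ and $N_0\in\mathbb N$ such that, for all $N\ge N_0$ and all $s\ge0$, $$\mathbb P\left[e^{-s-c_1}\le\frac{\mathrm E^N_{\nu_{\mathcal A_N,\mathcal B_N}}[\tau^N_{\mathcal B_N}]}{\widetilde{\mathrm E}^N_{\widetilde\nu_{\mathcal A_N,\mathcal B_N}}[\widetilde\tau^N_{\mathcal B_N}]}\le e^{s+c_2}\right]\ \ge\ 1-c_3e^{-c_4s^2}-c_5e^{-c_6N}.$$ -/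

import Mathlib

open MeasureTheory ProbabilityTheory Filter Topology
open scoped ENNReal

noncomputable section

namespace Potts

/-! ### Configurations, Hamiltonian, Gibbs measure -/

/-- Configurations of `N` spins with `q` colours. -/
abbrev Config (q N : ℕ) : Type := Fin N → Fin q

/-- The Hamiltonian `-(1/N) ∑_{i<j} g i j 1{σ i = σ j}` with couplings `g`
(only the entries `g i j` with `i < j < N` are used). -/
def hamiltonian {q N : ℕ} (g : ℕ → ℕ → ℝ) (σ : Config q N) : ℝ :=
  -(1 / (N : ℝ)) *
    ∑ p : Fin N × Fin N with p.1 < p.2, g p.1 p.2 * (if σ p.1 = σ p.2 then 1 else 0)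

/-- The couplings of the mean-field model: all equal to one. -/
def meanField : ℕ → ℕ → ℝ := fun _ _ => 1

def partitionFn (q N : ℕ) (β : ℝ) (g : ℕ → ℕ → ℝ) : ℝ :=
  ∑ σ : Config q N, Real.exp (-β * hamiltonian g σ)

def gibbs {q N : ℕ} (β : ℝ) (g : ℕ → ℕ → ℝ) (σ : Config q N) : ℝ :=
  Real.exp (-β * hamiltonian g σ) / partitionFn q N β g

/-! ### Metropolis dynamics -/

/-- Metropolis transition probability to a different configuration (zero on the diagonal). -/
def flipProb {q N : ℕ} (β : ℝ) (g : ℕ → ℕ → ℝ) (σ η : Config q N) : ℝ :=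
  if hammingDist σ η = 1 then
    ((N : ℝ) * q)⁻¹ * Real.exp (-β * max 0 (hamiltonian g η - hamiltonian g σ))
  else 0

/-- Glauber-Metropolis transition probabilities. -/
def transProb {q N : ℕ} (β : ℝ) (g : ℕ → ℕ → ℝ) (σ η : Config q N) : ℝ :=
  if σ = η then 1 - ∑ ξ ∈ Finset.univ.erase σ, flipProb β g σ ξ else flipProb β g σ η

lemma card_neighbours_le {q N : ℕ} (σ : Config q N) :
    (Finset.univ.filter fun η : Config q N => hammingDist σ η = 1).card ≤ N * q := by
  classical
  have hsub : (Finset.univ.filter fun η : Config q N => hammingDist σ η = 1) ⊆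
      (Finset.univ : Finset (Fin N × Fin q)).image fun p => Function.update σ p.1 p.2 := by
    intro η hη
    have h1 : (Finset.univ.filter fun i => σ i ≠ η i).card = 1 := by
      simpa [hammingDist] using hη
    obtain ⟨i, hi⟩ := Finset.card_eq_one.mp h1
    refine Finset.mem_image.mpr ⟨(i, η i), Finset.mem_univ _, ?_⟩
    funext j
    by_cases hj : j = i
    · subst hj; simp
    · have : j ∉ (Finset.univ.filter fun i => σ i ≠ η i) := by rw [hi]; simpa using hj
      simpa [Function.update_of_ne hj] using this
  calc _ ≤ _ := Finset.card_le_card hsub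
    _ ≤ _ := Finset.card_image_le
    _ = N * q := by simp

lemma flipProb_nonneg {q N : ℕ} (β : ℝ) (g : ℕ → ℕ → ℝ) (σ η : Config q N) :
    0 ≤ flipProb β g σ η := by
  unfold flipProb; split_ifs <;> positivity

lemma sum_flipProb_le_one {q N : ℕ} {β : ℝ} (hβ : 0 ≤ β) (g : ℕ → ℕ → ℝ) (σ : Config q N) :
    ∑ ξ ∈ Finset.univ.erase σ, flipProb β g σ ξ ≤ 1 := by
  classical
  calc ∑ ξ ∈ Finset.univ.erase σ, flipProb β g σ ξ
      ≤ ∑ ξ, flipProb β g σ ξ :=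
        Finset.sum_le_sum_of_subset_of_nonneg (Finset.subset_univ _)
          fun _ _ _ => flipProb_nonneg _ _ _ _
    _ ≤ ∑ ξ : Config q N, if hammingDist σ ξ = 1 then ((N : ℝ) * q)⁻¹ else 0 := by
        refine Finset.sum_le_sum fun ξ _ => ?_
        unfold flipProb
        split_ifs
        · refine mul_le_of_le_one_right (by positivity) (Real.exp_le_one_iff.mpr ?_)
          have := mul_nonneg hβ (le_max_left 0 (hamiltonian g ξ - hamiltonian g σ))
          linarith
        · exact le_rfl
    _ = ((Finset.univ.filter fun η : Config q N => hammingDist σ η = 1).card : ℝ) *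
          ((N : ℝ) * q)⁻¹ := by
        rw [← Finset.sum_filter, Finset.sum_const, nsmul_eq_mul]
    _ ≤ ((N : ℝ) * q) * ((N : ℝ) * q)⁻¹ := by
        refine mul_le_mul_of_nonneg_right ?_ (by positivity)
        exact_mod_cast card_neighbours_le σ
    _ ≤ 1 := mul_inv_le_one

lemma transProb_nonneg {q N : ℕ} {β : ℝ} (hβ : 0 ≤ β) (g : ℕ → ℕ → ℝ) (σ η : Config q N) :
    0 ≤ transProb β g σ η := by
  unfold transProb
  split_ifs
  · linarith [sum_flipProb_le_one hβ g σ]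
  · exact flipProb_nonneg _ _ _ _

lemma sum_transProb {q N : ℕ} (β : ℝ) (g : ℕ → ℕ → ℝ) (σ : Config q N) :
    ∑ η, transProb β g σ η = 1 := by
  classical
  rw [← Finset.add_sum_erase _ _ (Finset.mem_univ σ)]
  have : ∑ η ∈ Finset.univ.erase σ, transProb β g σ η =
      ∑ η ∈ Finset.univ.erase σ, flipProb β g σ η := by
    refine Finset.sum_congr rfl fun η hη => ?_
    have : σ ≠ η := fun h => (Finset.ne_of_mem_erase hη) h.symm
    simp [transProb, this]
  rw [this]
  simp [transProb]

/-- One step of the chain, as a probability distribution. The inverse temperature is taken in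
`NNReal`, so that the transition probabilities are nonnegative. -/
def stepPMF {q N : ℕ} (β : NNReal) (g : ℕ → ℕ → ℝ) (σ : Config q N) : PMF (Config q N) :=
  PMF.ofFintype (fun η => ENNReal.ofReal (transProb β g σ η)) (by
    rw [← ENNReal.ofReal_sum_of_nonneg fun η _ => transProb_nonneg β.coe_nonneg g σ η,
      sum_transProb, ENNReal.ofReal_one])

/-- One step of the chain, given the trajectory up to time `n`: it only depends on the state
at time `n`. -/
def stepKernel {q N : ℕ} (β : NNReal) (g : ℕ → ℕ → ℝ) (n : ℕ) :
    Kernel (Finset.Iic n → Config q N) (Config q N) :=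
  (Kernel.ofFunOfCountable fun σ : Config q N => (stepPMF β g σ).toMeasure).comap
    (fun ω => ω ⟨n, Finset.mem_Iic.mpr le_rfl⟩) (measurable_pi_apply _)

instance {q N : ℕ} (β : NNReal) (g : ℕ → ℕ → ℝ) (n : ℕ) :
    IsMarkovKernel (stepKernel (q := q) (N := N) β g n) where
  isProbabilityMeasure ω :=
    inferInstanceAs (IsProbabilityMeasure (stepPMF β g (ω ⟨n, _⟩)).toMeasure)

/-- The law on path space of the Metropolis chain with initial distribution `ν`. -/
def chainLaw {q N : ℕ} (β : NNReal) (g : ℕ → ℕ → ℝ) (ν : Measure (Config q N)) :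
    Measure (ℕ → Config q N) :=
  Kernel.trajMeasure (X := fun _ => Config q N) ν (stepKernel β g)

/-- First return time `inf {t > 0 : ω t ∈ A}`, equal to `⊤` if there is no such `t`. -/
def returnTime {S : Type*} (A : Set S) (ω : ℕ → S) : ℕ∞ :=
  ⨅ (t : ℕ) (_ : 0 < t ∧ ω t ∈ A), (t : ℕ∞)

/-- The weight `μ(σ) P_σ[τ_B < τ_A]`. -/
def escapeWeight {q N : ℕ} (β : NNReal) (g : ℕ → ℕ → ℝ) (A B : Set (Config q N))
    (σ : Config q N) : ℝ≥0∞ :=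
  ENNReal.ofReal (gibbs β g σ) *
    chainLaw β g (Measure.dirac σ) {ω | returnTime B ω < returnTime A ω}

open Classical in
/-- The last-exit biased distribution on `A` for the transition from `A` to `B`. -/
def lastExit {q N : ℕ} (β : NNReal) (g : ℕ → ℕ → ℝ) (A B : Set (Config q N)) :
    Measure (Config q N) :=
  ∑ σ with σ ∈ A,
    (escapeWeight β g A B σ / ∑ η with η ∈ A, escapeWeight β g A B η) • Measure.dirac σ

/-- Mean hitting time of `B` for the chain started from the last-exit biased distribution. -/
def meanHit {q N : ℕ} (β : NNReal) (g : ℕ → ℕ → ℝ) (A B : Set (Config q N)) : ℝ≥0∞ :=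
  ∫⁻ ω, (returnTime B ω : ℝ≥0∞) ∂(chainLaw β g (lastExit β g A B))

/-! ### Free energy landscape and metastable sets -/

/-- Limiting free energy of the mean-field model, considered on `stdSimplex ℝ (Fin q)`. -/
def freeEnergy {q : ℕ} (β : ℝ) (x : Fin q → ℝ) : ℝ :=
  -(1 / 2) * ∑ i, x i ^ 2 + (1 / β) * ∑ i, x i * Real.log (x i)

/-- The uniform point `(1/q, …, 1/q)`. -/
def uniformPt (q : ℕ) : Fin q → ℝ := fun _ => 1 / q

/-- The inverse temperature above which the free energy has local minima besides the uniform point. -/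
def beta1 (q : ℕ) : ℝ :=
  sInf {β : ℝ | 0 < β ∧ ∃ x ∈ stdSimplex ℝ (Fin q), x ≠ uniformPt q ∧
    IsLocalMinOn (freeEnergy β) (stdSimplex ℝ (Fin q)) x}

/-- The inverse temperature above which the uniform point is no longer a global minimum. -/
def beta2 (q : ℕ) : ℝ :=
  sInf {β : ℝ | 0 < β ∧ ¬ IsMinOn (freeEnergy β) (stdSimplex ℝ (Fin q)) (uniformPt q)}

/-- The largest solution of `log (1 + (q-1) s) - log (1 - s) = β s`. -/
def orderParam (q : ℕ) (β : ℝ) : ℝ :=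
  sSup {s : ℝ | 0 < 1 + ((q : ℝ) - 1) * s ∧ s < 1 ∧
    Real.log (1 + ((q : ℝ) - 1) * s) - Real.log (1 - s) = β * s}

/-- The points `m_0` (index `none`) and `m_i` (index `some i`). -/
def minPt (q : ℕ) (β : ℝ) : Option (Fin q) → Fin q → ℝ
  | none => uniformPt q
  | some i => fun k =>
      if k = i then (1 + ((q : ℝ) - 1) * orderParam q β) / q else (1 - orderParam q β) / q

/-- The lattice simplex `(1/N) ℕ^q ∩ stdSimplex`. -/
def latticeSimplex (q N : ℕ) : Set (Fin q → ℝ) :=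
  {x | x ∈ stdSimplex ℝ (Fin q) ∧ ∃ n : Fin q → ℕ, ∀ k, x k = n k / N}

/-- `y` is a point of the lattice simplex closest to `x` in Euclidean distance. -/
def IsClosestLatticePt {q : ℕ} (N : ℕ) (x y : Fin q → ℝ) : Prop :=
  y ∈ latticeSimplex q N ∧
    ∀ z ∈ latticeSimplex q N, ∑ k, (y k - x k) ^ 2 ≤ ∑ k, (z k - x k) ^ 2

/-- Empirical measure (colour frequencies) of a configuration. -/
def empirical {q N : ℕ} (σ : Config q N) : Fin q → ℝ :=
  fun k => (1 / (N : ℝ)) * ∑ i, if σ i = k then 1 else 0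

/-- Configurations whose empirical measure is `y`. -/
def level {q : ℕ} (N : ℕ) (y : Fin q → ℝ) : Set (Config q N) :=
  {σ | empirical σ = y}

/-- The admissible pairs `(A_N, B_N)`, where `m N i` is the lattice approximation of the `i`-th
minimum: the two kinds of metastable transitions, and tunnelling transitions from one of the
ordered states to the union of the others. -/
def IsRegime {q : ℕ} (β : ℝ) (m : ℕ → Option (Fin q) → Fin q → ℝ)
    (A B : (N : ℕ) → Set (Config q N)) : Prop :=
  (beta1 q < β ∧ β ≤ beta2 q ∧
    ∀ N, A N = (⋃ i : Fin q, level N (m N (some i))) ∧ B N = level N (m N none)) ∨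
  (beta2 q < β ∧ β < q ∧
    ∀ N, A N = level N (m N none) ∧ B N = ⋃ i : Fin q, level N (m N (some i))) ∨
  (beta2 q < β ∧ ∃ k : Fin q,
    ∀ N, A N = level N (m N (some k)) ∧
      B N = ⋃ (i : Fin q) (_ : i ≠ k), level N (m N (some i)))

/-! ### Disorder -/

/-- Assumption on the random couplings: the `J i j`, `i < j`, are i.i.d. with mean one, positive
variance, and exponential moments in a neighbourhood of zero. -/
structure IsDisorder {Ω : Type*} [MeasurableSpace Ω] (P : Measure Ω)
    (J : ℕ → ℕ → Ω → ℝ) : Prop where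
  measurable : ∀ i j, i < j → Measurable (J i j)
  indep : iIndepFun (fun (p : {p : ℕ × ℕ // p.1 < p.2}) => J p.1.1 p.1.2) P
  ident : ∀ i j, i < j → IdentDistrib (J i j) (J 0 1) P P
  mean : ∫ ω, J 0 1 ω ∂P = 1
  var_pos : 0 < variance (J 0 1) P
  exp_moment : 0 ∈ interior (integrableExpSet (J 0 1) P)

end Potts

end

/-! For a reversible chain started from the last-exit biased distribution, the mean hitting time of
`B` equals `∑ w h / cap(A, B)`, where `w` is the unnormalised Gibbs weight, `h` the equilibrium
potential and `cap` the capacity of the network of Metropolis conductances (`meanHit_eq`). It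
remains to compare numerator and denominator with their mean-field values, up to factors of order
one.

Numerator: a union bound over the `q ^ N` configurations shows that, outside an event of probability
`e^{-N}`, the Hamiltonian is within `d N` of the mean-field one
(`eventually_measureReal_hamiltonian_le`). On the good event the numerator is within a factor two of
the weight of a valley `V` that depends on the mean-field landscape only
(`IsWellPair.exists_valley`). No pointwise estimate of `h` is used. Walking between colour-count
levels without climbing more than `ε` in free energy yields a Poincaré inequality with constant
`e^{Nβε}` up to polynomial factors (`sum_weight_mul_sq_le`). Applied to dyadic truncations of `h`
(`IsEquilibrium.sum_mul_le`), it bounds the mass of `h` on the basin of `B`, and that of `1 - h` on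
the basin of `A`, by this constant times the capacity, which the barrier around `A` makes negligible
(`capacity_meanField_le`). Levels in neither basin lie too high to matter. The landscape enters
through the fact that the free energy has no local minima other than the points `minPt`
(`eq_minPt_of_isLocalMinOn`).

Fluctuations: `log cap` and `log w(V)` are functions of at most `N ^ 2` independent couplings with
Lipschitz constant `β / N` in each. Tensorising a one-variable Laplace bound gives Gaussian
fluctuations of order one, up to an error `e^{-cN²}` (`CoordLipschitz.measureReal_abs_ge_le`).

Centring: a logarithmic ratio is at most the ratio itself. The Dirichlet principle in one direction
and Cauchy-Schwarz in the other bound the ratio by an average of `exp(∓β (H - H̃))` against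
deterministic weights of total mass at most two (`exists_log_capacity_sub_le`,
`exists_log_sum_weight_sub_le`). These exponentials have bounded expectation, so the means of both
logarithms lie within a constant of the mean-field values (`abs_integral_sub_le`). -/

noncomputable section

namespace Potts

/-! ### Electrical networks on a finite set -/

section Network

variable {S : Type*} [Fintype S]

/-- The Dirichlet form of the network with conductances `c`. -/
def dirichlet (c : S → S → ℝ) (f g : S → ℝ) : ℝ :=
  (1 / 2) * ∑ x, ∑ y, c x y * ((f x - f y) * (g x - g y))

/-- Symmetric nonnegative conductances whose network is connected. -/
structure IsConductance (c : S → S → ℝ) : Prop where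
  symm : ∀ x y, c x y = c y x
  nonneg : ∀ x y, 0 ≤ c x y
  connected : ∀ f : S → ℝ, (∀ x y, 0 < c x y → f x = f y) → ∀ x y, f x = f y

/-- `h` solves the Dirichlet problem with boundary values one on `A` and zero on `B`. -/
structure IsEquilibrium (c : S → S → ℝ) (A B : Set S) (h : S → ℝ) : Prop where
  one : ∀ x ∈ A, h x = 1
  zero : ∀ x ∈ B, h x = 0
  harmonic : ∀ x, x ∉ A → x ∉ B → ∑ y, c x y * (h x - h y) = 0

lemma dirichlet_comm (c : S → S → ℝ) (f g : S → ℝ) : dirichlet c f g = dirichlet c g f := by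
  simp only [dirichlet, mul_comm]

lemma dirichlet_self_nonneg {c : S → S → ℝ} (hc : IsConductance c) (f : S → ℝ) :
    0 ≤ dirichlet c f f := by
  refine mul_nonneg (by norm_num) (Finset.sum_nonneg fun x _ => Finset.sum_nonneg fun y _ => ?_)
  exact mul_nonneg (hc.nonneg x y) (mul_self_nonneg _)

lemma dirichlet_eq_sum_mul {c : S → S → ℝ} (hc : IsConductance c) (f g : S → ℝ) :
    dirichlet c f g = ∑ x, f x * ∑ y, c x y * (g x - g y) := by
  have h1 : ∑ x, ∑ y, c x y * ((f x - f y) * (g x - g y)) =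
      ∑ x, ∑ y, c x y * (f x * (g x - g y)) - ∑ x, ∑ y, c x y * (f y * (g x - g y)) := by
    simp only [← Finset.sum_sub_distrib]
    exact Finset.sum_congr rfl fun x _ => Finset.sum_congr rfl fun y _ => by ring
  have h2 : ∑ x, ∑ y, c x y * (f y * (g x - g y)) =
      - ∑ x, ∑ y, c x y * (f x * (g x - g y)) := by
    rw [Finset.sum_comm, ← Finset.sum_neg_distrib]
    refine Finset.sum_congr rfl fun x _ => ?_
    rw [← Finset.sum_neg_distrib]
    exact Finset.sum_congr rfl fun y _ => by rw [hc.symm y x]; ring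
  have h3 : ∑ x, f x * ∑ y, c x y * (g x - g y) =
      ∑ x, ∑ y, c x y * (f x * (g x - g y)) := by
    refine Finset.sum_congr rfl fun x _ => ?_
    rw [Finset.mul_sum]
    exact Finset.sum_congr rfl fun y _ => by ring
  rw [dirichlet, h1, h2, h3]; ring

lemma eq_of_dirichlet_self_eq_zero {c : S → S → ℝ} (hc : IsConductance c) {f : S → ℝ}
    (hf : dirichlet c f f = 0) (x y : S) : f x = f y := by
  refine hc.connected f (fun x y hxy => ?_) x y
  have h0 : ∑ x, ∑ y, c x y * ((f x - f y) * (f x - f y)) = 0 := by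
    unfold dirichlet at hf; linarith
  have hnn : ∀ x y, 0 ≤ c x y * ((f x - f y) * (f x - f y)) := fun x y =>
    mul_nonneg (hc.nonneg x y) (mul_self_nonneg _)
  have h1 := (Finset.sum_eq_zero_iff_of_nonneg
    fun x _ => Finset.sum_nonneg fun y _ => hnn x y).mp h0 x (Finset.mem_univ _)
  have h2 := (Finset.sum_eq_zero_iff_of_nonneg fun y _ => hnn x y).mp h1 y (Finset.mem_univ _)
  have h3 := (mul_eq_zero.mp h2).resolve_left hxy.ne'
  linarith [mul_self_eq_zero.mp h3]

lemma dirichlet_sub_self {c : S → S → ℝ} (f g : S → ℝ) :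
    dirichlet c (f - g) (f - g) =
      dirichlet c f f - 2 * dirichlet c g f + dirichlet c g g := by
  simp only [dirichlet, Pi.sub_apply]
  have : ∀ x y, c x y * ((f x - g x - (f y - g y)) * (f x - g x - (f y - g y))) =
      c x y * ((f x - f y) * (f x - f y)) - 2 * (c x y * ((g x - g y) * (f x - f y))) +
        c x y * ((g x - g y) * (g x - g y)) := fun x y => by ring
  simp only [this, Finset.sum_add_distrib, Finset.sum_sub_distrib, ← Finset.mul_sum]
  ring

/-- The boundary value problem is a square linear system, so it suffices that zero data force the
zero solution. Such a solution has zero energy, hence is constant, and it vanishes at a point of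
`A`. -/
lemma exists_isEquilibrium {c : S → S → ℝ} (hc : IsConductance c) {A B : Set S}
    (hA : A.Nonempty) (hAB : Disjoint A B) : ∃ h, IsEquilibrium c A B h := by
  classical
  let T : (S → ℝ) →ₗ[ℝ] (S → ℝ) :=
    { toFun := fun f x => if x ∈ A ∪ B then f x else ∑ y, c x y * (f x - f y)
      map_add' := fun f g => by
        ext x
        simp only [Pi.add_apply]
        split_ifs
        · rfl
        · rw [← Finset.sum_add_distrib]
          exact Finset.sum_congr rfl fun y _ => by ring
      map_smul' := fun a f => by
        ext x
        simp only [Pi.smul_apply, smul_eq_mul, RingHom.id_apply]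
        split_ifs
        · rfl
        · rw [Finset.mul_sum]
          exact Finset.sum_congr rfl fun y _ => by ring }
  have hT : ∀ f x, T f x = if x ∈ A ∪ B then f x else ∑ y, c x y * (f x - f y) :=
    fun _ _ => rfl
  have hinj : Function.Injective T := by
    rw [injective_iff_map_eq_zero]
    intro f hf
    have hf' : ∀ x, T f x = 0 := fun x => by rw [hf]; rfl
    have h0 : ∀ x ∈ A ∪ B, f x = 0 := fun x hx => by
      have := hf' x
      rwa [hT, if_pos hx] at this
    have hD : dirichlet c f f = 0 := by
      rw [dirichlet_eq_sum_mul hc]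
      refine Finset.sum_eq_zero fun x _ => ?_
      by_cases hx : x ∈ A ∪ B
      · rw [h0 x hx, zero_mul]
      · have := hf' x
        rw [hT, if_neg hx] at this
        rw [this, mul_zero]
    obtain ⟨a, ha⟩ := hA
    ext x
    rw [eq_of_dirichlet_self_eq_zero hc hD x a, h0 a (Or.inl ha)]; rfl
  obtain ⟨h, hh⟩ := (LinearMap.injective_iff_surjective.mp hinj) (A.indicator 1)
  have hh' : ∀ x, T h x = A.indicator 1 x := fun x => by rw [hh]
  refine ⟨h, ?_, ?_, ?_⟩
  · intro x hx
    have := hh' x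
    rwa [hT, if_pos (Set.mem_union_left B hx), Set.indicator_of_mem hx] at this
  · intro x hx
    have := hh' x
    rwa [hT, if_pos (Set.mem_union_right A hx), Set.indicator_of_notMem (Set.disjoint_right.mp hAB hx)] at this
  · intro x hxA hxB
    have := hh' x
    rwa [hT, if_neg (by simp [hxA, hxB]), Set.indicator_of_notMem hxA] at this

open Classical in
/-- The equilibrium potential. -/
def equilibrium (c : S → S → ℝ) (A B : Set S) : S → ℝ :=
  if h : ∃ f, IsEquilibrium c A B f then h.choose else 0

/-- The capacity between `A` and `B`. -/
def capacity (c : S → S → ℝ) (A B : Set S) : ℝ :=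
  dirichlet c (equilibrium c A B) (equilibrium c A B)

lemma isEquilibrium_equilibrium {c : S → S → ℝ} (hc : IsConductance c) {A B : Set S}
    (hA : A.Nonempty) (hAB : Disjoint A B) : IsEquilibrium c A B (equilibrium c A B) := by
  have h := exists_isEquilibrium hc hA hAB
  rw [equilibrium, dif_pos h]
  exact h.choose_spec

/-- Green's formula for a function that is constant on both boundary parts. -/
lemma IsEquilibrium.dirichlet_eq {c : S → S → ℝ} (hc : IsConductance c) {A B : Set S}
    {h : S → ℝ} (hh : IsEquilibrium c A B h) {f : S → ℝ} {t : ℝ} (hfA : ∀ x ∈ A, f x = t)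
    (hfB : ∀ x ∈ B, f x = 0) : dirichlet c f h = t * dirichlet c h h := by
  rw [dirichlet_eq_sum_mul hc, dirichlet_eq_sum_mul hc, Finset.mul_sum]
  refine Finset.sum_congr rfl fun x _ => ?_
  by_cases hA : x ∈ A
  · rw [hfA x hA, hh.one x hA, one_mul]
  by_cases hB : x ∈ B
  · rw [hfB x hB, hh.zero x hB]; ring
  · rw [hh.harmonic x hA hB]; ring

/-- The Dirichlet principle. -/
lemma IsEquilibrium.dirichlet_le {c : S → S → ℝ} (hc : IsConductance c) {A B : Set S}
    {h : S → ℝ} (hh : IsEquilibrium c A B h) {f : S → ℝ} (hfA : ∀ x ∈ A, f x = 1)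
    (hfB : ∀ x ∈ B, f x = 0) : dirichlet c h h ≤ dirichlet c f f := by
  have h1 := dirichlet_self_nonneg hc (f - h)
  rw [dirichlet_sub_self, dirichlet_comm c h f, hh.dirichlet_eq hc hfA hfB] at h1
  linarith

lemma sub_mul_sub_le_of_clip (a b t s : ℝ) :
    (max t (min s a) - max t (min s b)) * (max t (min s a) - max t (min s b)) ≤
      (a - b) * (a - b) := by
  have : |max t (min s a) - max t (min s b)| ≤ |a - b| := by
    calc |max t (min s a) - max t (min s b)| ≤ |min s a - min s b| := by
          simpa using abs_max_sub_max_le_max t (min s a) t (min s b)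
      _ ≤ |a - b| := by simpa using abs_min_sub_min_le_max s a s b
  rw [← abs_mul_abs_self, ← abs_mul_abs_self (a - b)]
  exact mul_self_le_mul_self (abs_nonneg _) this

/-- Clipping to the unit interval keeps the boundary values and cannot raise the energy, so the
clipped function is a minimiser too. The difference then has zero energy and vanishes on `A`. -/
lemma IsEquilibrium.mem_unit {c : S → S → ℝ} (hc : IsConductance c) {A B : Set S}
    (hA : A.Nonempty) {h : S → ℝ} (hh : IsEquilibrium c A B h) (x : S) :
    0 ≤ h x ∧ h x ≤ 1 := by
  set f : S → ℝ := fun x => max 0 (min 1 (h x)) with hf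
  have hfA : ∀ x ∈ A, f x = 1 := fun x hx => by simp [hf, hh.one x hx]
  have hfB : ∀ x ∈ B, f x = 0 := fun x hx => by simp [hf, hh.zero x hx]
  have h1 : dirichlet c f f ≤ dirichlet c h h := by
    refine mul_le_mul_of_nonneg_left (Finset.sum_le_sum fun x _ =>
      Finset.sum_le_sum fun y _ => ?_) (by norm_num)
    exact mul_le_mul_of_nonneg_left (sub_mul_sub_le_of_clip _ _ _ _) (hc.nonneg x y)
  have h2 : dirichlet c (f - h) (f - h) = 0 := by
    refine le_antisymm ?_ (dirichlet_self_nonneg hc _)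
    rw [dirichlet_sub_self, dirichlet_comm c h f, hh.dirichlet_eq hc hfA hfB]
    linarith
  obtain ⟨a, ha⟩ := hA
  have h3 := eq_of_dirichlet_self_eq_zero hc h2 x a
  have h4 : h x = f x := by
    simp only [Pi.sub_apply, hfA a ha, hh.one a ha] at h3
    linarith
  rw [h4]
  exact ⟨le_max_left _ _, max_le zero_le_one (min_le_left _ _)⟩

lemma IsEquilibrium.dirichlet_pos {c : S → S → ℝ} (hc : IsConductance c) {A B : Set S}
    (hA : A.Nonempty) (hB : B.Nonempty) {h : S → ℝ} (hh : IsEquilibrium c A B h) :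
    0 < dirichlet c h h := by
  refine (dirichlet_self_nonneg hc h).lt_of_ne fun h0 => ?_
  obtain ⟨a, ha⟩ := hA
  obtain ⟨b, hb⟩ := hB
  have := eq_of_dirichlet_self_eq_zero hc h0.symm a b
  rw [hh.one a ha, hh.zero b hb] at this
  exact one_ne_zero this

lemma capacity_pos {c : S → S → ℝ} (hc : IsConductance c) {A B : Set S}
    (hA : A.Nonempty) (hB : B.Nonempty) (hAB : Disjoint A B) : 0 < capacity c A B :=
  (isEquilibrium_equilibrium hc hA hAB).dirichlet_pos hc hA hB

lemma IsEquilibrium.symm {c : S → S → ℝ} {A B : Set S} {h : S → ℝ}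
    (hh : IsEquilibrium c A B h) : IsEquilibrium c B A (fun x => 1 - h x) where
  one x hx := by simp [hh.zero x hx]
  zero x hx := by simp [hh.one x hx]
  harmonic x hB hA := by
    have h1 := hh.harmonic x hA hB
    rw [← neg_eq_zero, ← Finset.sum_neg_distrib, ← h1]
    exact Finset.sum_congr rfl fun y _ => by ring

lemma dirichlet_one_sub (c : S → S → ℝ) (h : S → ℝ) :
    dirichlet c (fun x => 1 - h x) (fun x => 1 - h x) = dirichlet c h h := by
  simp only [dirichlet]
  congr 1
  exact Finset.sum_congr rfl fun x _ => Finset.sum_congr rfl fun y _ => by ring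

/-- Green's formula evaluates the pairing of `h` with its truncation as `t` times the capacity, and
on each edge this pairing dominates the squared increment of the truncation. The factor `t` is what
makes all dyadic scales contribute equally later. -/
lemma IsEquilibrium.dirichlet_min_le {c : S → S → ℝ} (hc : IsConductance c) {A B : Set S}
    {h : S → ℝ} (hh : IsEquilibrium c A B h) {t : ℝ} (ht : 0 ≤ t) (ht1 : t ≤ 1) :
    dirichlet c (fun x => min (h x) t) (fun x => min (h x) t) ≤ t * dirichlet c h h := by
  rw [← hh.dirichlet_eq hc (f := fun x => min (h x) t) (t := t)
    (fun x hx => by simp [hh.one x hx, ht1]) (fun x hx => by simp [hh.zero x hx, ht])]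
  refine mul_le_mul_of_nonneg_left (Finset.sum_le_sum fun x _ =>
    Finset.sum_le_sum fun y _ => mul_le_mul_of_nonneg_left ?_ (hc.nonneg x y)) (by norm_num)
  rcases le_total (h x) t with h1 | h1 <;> rcases le_total (h y) t with h2 | h2 <;>
    simp only [h1, h2, min_eq_left, min_eq_right] <;> nlinarith

/-- A function between zero and one is dominated by its dyadic truncations. -/
lemma le_sum_dyadic {u : ℝ} (h1 : u ≤ 1) (n : ℕ) :
    u ≤ (1 / 2) ^ n + ∑ k ∈ Finset.range n,
      2 * (min u ((1 / 2) ^ (k + 1)) ^ 2 / (1 / 2) ^ (k + 1)) := by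
  induction n with
  | zero => simpa using h1
  | succ n ih =>
    rw [Finset.sum_range_succ]
    have hp : (0 : ℝ) < (1 / 2) ^ (n + 1) := by positivity
    have hnn : ∀ m : ℕ, 0 ≤ ∑ k ∈ Finset.range m,
        2 * (min u ((1 / 2) ^ (k + 1)) ^ 2 / (1 / 2) ^ (k + 1)) := fun m =>
      Finset.sum_nonneg fun k _ => by positivity
    rcases le_total u ((1 / 2) ^ (n + 1)) with h | h
    · have := hnn n
      have h' : 0 ≤ 2 * (min u ((1 / 2) ^ (n + 1)) ^ 2 / (1 / 2) ^ (n + 1)) := by positivity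
      linarith
    -- The new summand equals `(1/2)^n`, which makes up for shrinking the remainder.
    · rw [min_eq_right h, sq, mul_div_assoc, div_self hp.ne', mul_one]
      have : (1 / 2 : ℝ) ^ n = 2 * (1 / 2) ^ (n + 1) := by rw [pow_succ]; ring
      linarith

/-- A Poincaré inequality for functions vanishing on `B` bounds the mean of the equilibrium
potential linearly in the capacity, up to a logarithmic loss. -/
lemma IsEquilibrium.sum_mul_le {c : S → S → ℝ} (hc : IsConductance c) {A B : Set S}
    (hA : A.Nonempty) {h : S → ℝ} (hh : IsEquilibrium c A B h) {w : S → ℝ} (hw : ∀ x, 0 ≤ w x)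
    {V : Finset S} {K : ℝ}
    (hK : ∀ f : S → ℝ, (∀ x ∈ B, f x = 0) → ∑ x ∈ V, w x * f x ^ 2 ≤ K * dirichlet c f f)
    (hK0 : 0 ≤ K) (n : ℕ) :
    ∑ x ∈ V, w x * h x ≤ (1 / 2) ^ n * ∑ x ∈ V, w x + 2 * n * K * dirichlet c h h := by
  have hu := hh.mem_unit hc hA
  calc ∑ x ∈ V, w x * h x
      ≤ ∑ x ∈ V, w x * ((1 / 2) ^ n + ∑ k ∈ Finset.range n,
          2 * (min (h x) ((1 / 2) ^ (k + 1)) ^ 2 / (1 / 2) ^ (k + 1))) :=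
        Finset.sum_le_sum fun x _ =>
          mul_le_mul_of_nonneg_left (le_sum_dyadic (hu x).2 n) (hw x)
    _ = (1 / 2) ^ n * ∑ x ∈ V, w x + ∑ k ∈ Finset.range n,
          2 / (1 / 2) ^ (k + 1) * ∑ x ∈ V, w x * min (h x) ((1 / 2) ^ (k + 1)) ^ 2 := by
        simp only [mul_add, Finset.sum_add_distrib, Finset.mul_sum]
        rw [Finset.sum_comm]
        congr 1
        · exact Finset.sum_congr rfl fun x _ => by ring
        · exact Finset.sum_congr rfl fun x _ => Finset.sum_congr rfl fun k _ => by ring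
    _ ≤ (1 / 2) ^ n * ∑ x ∈ V, w x + ∑ k ∈ Finset.range n, 2 * K * dirichlet c h h := by
        refine add_le_add le_rfl (Finset.sum_le_sum fun k _ => ?_)
        have hp : (0 : ℝ) < (1 / 2) ^ (k + 1) := by positivity
        have hp1 : (1 / 2 : ℝ) ^ (k + 1) ≤ 1 := pow_le_one₀ (by norm_num) (by norm_num)
        -- The truncation at height `(1/2)^(k+1)` has energy at most that height times the capacity;
        -- dividing by the height leaves a bound independent of `k`.
        have h1 := hK (fun x => min (h x) ((1 / 2) ^ (k + 1)))
          (fun x hx => by simp [hh.zero x hx])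
        have h2 := hh.dirichlet_min_le hc hp.le hp1
        calc _ ≤ 2 / (1 / 2) ^ (k + 1) * (K * ((1 / 2) ^ (k + 1) * dirichlet c h h)) := by
              exact mul_le_mul_of_nonneg_left
                (h1.trans (mul_le_mul_of_nonneg_left h2 hK0)) (by positivity)
          _ = 2 * K * dirichlet c h h := by field_simp
    _ = _ := by simp; ring

/-- Comparison of capacities of two networks with a flow from the second one. -/
lemma capacity_sq_le {c c' : S → S → ℝ} (hc : IsConductance c) (hc' : IsConductance c')
    {A B : Set S} {h h' : S → ℝ} (hh : IsEquilibrium c A B h) (hh' : IsEquilibrium c' A B h')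
    {r : S → S → ℝ} (hr : ∀ x y, c' x y ^ 2 ≤ r x y * c x y) (hr0 : ∀ x y, 0 ≤ r x y) :
    dirichlet c' h' h' ^ 2 ≤ dirichlet c h h * dirichlet r h' h' := by
  -- Green's formula in the network `c'`, tested with the potential of `c`. The Cauchy-Schwarz
  -- inequality below then takes the place of Thomson's principle for the harmonic flow of `c'`.
  have h1 : dirichlet c' h h' = dirichlet c' h' h' := by
    rw [hh'.dirichlet_eq hc' hh.one hh.zero, one_mul]
  rw [← h1]
  simp only [dirichlet, ← Finset.sum_product']
  rw [mul_pow]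
  have key := Finset.sum_sq_le_sum_mul_sum_of_sq_le_mul (Finset.univ ×ˢ Finset.univ : Finset (S × S))
    (r := fun p => c' p.1 p.2 * ((h p.1 - h p.2) * (h' p.1 - h' p.2)))
    (f := fun p => c p.1 p.2 * ((h p.1 - h p.2) * (h p.1 - h p.2)))
    (g := fun p => r p.1 p.2 * ((h' p.1 - h' p.2) * (h' p.1 - h' p.2)))
    (fun p _ => mul_nonneg (hc.nonneg _ _) (mul_self_nonneg _))
    (fun p _ => mul_nonneg (hr0 _ _) (mul_self_nonneg _))
    (fun p _ => by
      have := mul_le_mul_of_nonneg_right (hr p.1 p.2)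
        (sq_nonneg ((h p.1 - h p.2) * (h' p.1 - h' p.2)))
      calc _ = c' p.1 p.2 ^ 2 * ((h p.1 - h p.2) * (h' p.1 - h' p.2)) ^ 2 := by ring
        _ ≤ _ := this
        _ = _ := by ring)
  calc _ ≤ (1 / 2 : ℝ) ^ 2 * _ := mul_le_mul_of_nonneg_left key (by norm_num)
    _ = _ := by ring

lemma dirichlet_mono {c c' : S → S → ℝ} {K : ℝ} (h : ∀ x y, c x y ≤ K * c' x y) (f : S → ℝ) :
    dirichlet c f f ≤ K * dirichlet c' f f := by
  have : ∑ x, ∑ y, c x y * ((f x - f y) * (f x - f y)) ≤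
      K * ∑ x, ∑ y, c' x y * ((f x - f y) * (f x - f y)) := by
    simp only [Finset.mul_sum]
    refine Finset.sum_le_sum fun x _ => Finset.sum_le_sum fun y _ => ?_
    rw [← mul_assoc K]
    exact mul_le_mul_of_nonneg_right (h x y) (mul_self_nonneg _)
  unfold dirichlet
  linarith

lemma capacity_mono {c c' : S → S → ℝ} (hc : IsConductance c) (hc' : IsConductance c')
    {A B : Set S} (hA : A.Nonempty) (hAB : Disjoint A B) {K : ℝ}
    (h : ∀ x y, c x y ≤ K * c' x y) : capacity c A B ≤ K * capacity c' A B := by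
  have h' := isEquilibrium_equilibrium hc' hA hAB
  exact ((isEquilibrium_equilibrium hc hA hAB).dirichlet_le hc h'.one h'.zero).trans
    (dirichlet_mono h _)

end Network

end Potts

end

noncomputable section

namespace Potts

/-! ### Killed chains on a finite set -/

section Killed

variable {S : Type*} [Fintype S]

open Classical in
/-- Distribution at time `n` of the chain with transition matrix `p` and initial distribution `ν`,
killed when it visits `D` at a positive time. -/
def killed (p : S → S → ℝ) (D : Set S) (ν : S → ℝ) : ℕ → S → ℝ
  | 0 => ν
  | n + 1 => fun y => if y ∈ D then 0 else ∑ x, killed p D ν n x * p x y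

variable {p : S → S → ℝ} {D : Set S} {ν : S → ℝ}

lemma killed_nonneg (hp : ∀ x y, 0 ≤ p x y) (hν : ∀ x, 0 ≤ ν x) (n : ℕ) (x : S) :
    0 ≤ killed p D ν n x := by
  induction n generalizing x with
  | zero => exact hν x
  | succ n ih =>
    simp only [killed]
    split_ifs
    · exact le_rfl
    · exact Finset.sum_nonneg fun y _ => mul_nonneg (ih y) (hp y x)

open Classical in
/-- The transition operator restricted to functions on the complement of `D`. -/
def killedOp (p : S → S → ℝ) (D : Set S) (f : S → ℝ) : S → ℝ :=
  fun x => ∑ y, p x y * if y ∈ D then 0 else f y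

/-- Duality: evolving the measure is traded for iterating an operator on functions, whose decay does
not involve the initial distribution. -/
lemma sum_killed_mul (f : S → ℝ) (n : ℕ) :
    ∑ x, killed p D ν n x * f x = ∑ x, ν x * ((killedOp p D)^[n] f) x := by
  induction n generalizing f with
  | zero => rfl
  | succ n ih =>
    rw [Function.iterate_succ_apply, ← ih]
    simp only [killed, killedOp, Finset.mul_sum]
    rw [Finset.sum_comm]
    refine Finset.sum_congr rfl fun x _ => ?_
    split_ifs
    · simp
    · rw [Finset.sum_mul]
      exact Finset.sum_congr rfl fun y _ => by ring

lemma killedOp_mono (hp : ∀ x y, 0 ≤ p x y) {f g : S → ℝ} (hfg : f ≤ g) :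
    killedOp p D f ≤ killedOp p D g := fun x =>
  Finset.sum_le_sum fun y _ => mul_le_mul_of_nonneg_left (by split_ifs; exacts [le_rfl, hfg y])
    (hp x y)

/-- The iterates of the constant one decrease, hence converge to a fixed point of the killed
operator. Set to zero on `D`, this limit is harmonic off `D`, so its energy is zero and
connectedness makes it vanish. No rate of decay is needed. -/
lemma tendsto_iterate_killedOp {c : S → S → ℝ} (hc : IsConductance c) {w : S → ℝ}
    (hp : ∀ x y, 0 ≤ p x y) (hp1 : ∀ x, ∑ y, p x y = 1)
    (hcp : ∀ x y, x ≠ y → w x * p x y = c x y) (hD : D.Nonempty) (x : S) :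
    Tendsto (fun n => ((killedOp p D)^[n] 1) x) atTop (𝓝 0) := by
  classical
  have h0 : ∀ n, (0 : S → ℝ) ≤ (killedOp p D)^[n] 1 := by
    intro n
    induction n with
    | zero => exact fun _ => zero_le_one
    | succ n ih =>
      rw [Function.iterate_succ_apply']
      intro y
      exact Finset.sum_nonneg fun z _ => mul_nonneg (hp y z) (by split_ifs; exacts [le_rfl, ih z])
  have h1 : ∀ n, (killedOp p D)^[n + 1] 1 ≤ (killedOp p D)^[n] 1 := by
    intro n
    induction n with
    | zero =>
      intro y
      simp only [zero_add, Function.iterate_one, Function.iterate_zero, id, killedOp,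
        Pi.one_apply]
      refine (Finset.sum_le_sum fun z _ => ?_).trans (hp1 y).le
      exact mul_le_of_le_one_right (hp y z) (by split_ifs; exacts [zero_le_one, le_rfl])
    | succ n ih =>
      rw [Function.iterate_succ_apply' _ (n + 1)]
      nth_rw 2 [Function.iterate_succ_apply']
      exact killedOp_mono hp ih
  have hlim : ∀ y, ∃ v, Tendsto (fun n => ((killedOp p D)^[n] 1) y) atTop (𝓝 v) := fun y =>
    ⟨_, tendsto_atTop_ciInf (antitone_nat_of_succ_le fun n => h1 n y)
      ⟨0, by rintro _ ⟨n, rfl⟩; exact h0 n y⟩⟩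
  choose v hv using hlim
  have hfix : ∀ y, v y = killedOp p D v y := by
    intro y
    refine tendsto_nhds_unique ((tendsto_add_atTop_iff_nat 1).mpr (hv y)) ?_
    simp only [Function.iterate_succ_apply']
    refine tendsto_finsetSum _ fun z _ => Tendsto.const_mul _ ?_
    split_ifs
    · exact tendsto_const_nhds
    · exact hv z
  set u : S → ℝ := fun y => if y ∈ D then 0 else v y with hu
  have hu0 : ∀ y ∈ D, u y = 0 := fun y hy => by simp [hu, hy]
  have hv' : ∀ y, v y = ∑ z, p y z * u z := hfix
  have hdir : dirichlet c u u = 0 := by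
    rw [dirichlet_eq_sum_mul hc]
    refine Finset.sum_eq_zero fun y _ => ?_
    by_cases hy : y ∈ D
    · rw [hu0 y hy, zero_mul]
    · have e1 : ∑ z, c y z * (u y - u z) = w y * ∑ z, p y z * (u y - u z) := by
        rw [Finset.mul_sum]
        refine Finset.sum_congr rfl fun z _ => ?_
        by_cases hyz : y = z
        · simp [hyz]
        · rw [← hcp y z hyz]; ring
      have e2 : ∑ z, p y z * (u y - u z) = 0 := by
        simp only [mul_sub, Finset.sum_sub_distrib, ← Finset.sum_mul, hp1, ← hv']
        simp [hu, hy]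
      rw [e1, e2]; ring
  obtain ⟨d, hd⟩ := hD
  have hu1 : ∀ y, u y = 0 := fun y => by
    rw [eq_of_dirichlet_self_eq_zero hc hdir y d, hu0 d hd]
  have : v x = 0 := by rw [hv' x]; simp [hu1]
  rw [← this]
  exact hv x

lemma tendsto_sum_killed {c : S → S → ℝ} (hc : IsConductance c) {w : S → ℝ}
    (hp : ∀ x y, 0 ≤ p x y) (hp1 : ∀ x, ∑ y, p x y = 1)
    (hcp : ∀ x y, x ≠ y → w x * p x y = c x y) (hD : D.Nonempty) :
    Tendsto (fun n => ∑ x, killed p D ν n x) atTop (𝓝 0) := by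
  have h : ∀ n, ∑ x, killed p D ν n x = ∑ x, ν x * ((killedOp p D)^[n] 1) x := fun n => by
    rw [← sum_killed_mul]; simp
  simp only [h]
  have := tendsto_finsetSum (Finset.univ : Finset S) fun x _ =>
    (tendsto_iterate_killedOp hc hp hp1 hcp hD x).const_mul (ν x)
  simpa using this

/-- The probability to reach `B` before returning to `A`, in terms of the equilibrium potential. -/
lemma hasSum_killed_hit {c : S → S → ℝ} (hc : IsConductance c) {w : S → ℝ}
    (hw : ∀ x, 0 < w x) (hp : ∀ x y, 0 ≤ p x y) (hp1 : ∀ x, ∑ y, p x y = 1)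
    (hcp : ∀ x y, x ≠ y → w x * p x y = c x y) {A B : Set S} (hA : A.Nonempty)
    (hν : ∀ x, 0 ≤ ν x) {h : S → ℝ} (hh : IsEquilibrium c A B h) [DecidablePred (· ∈ B)] :
    HasSum (fun n => ∑ y with y ∈ B, ∑ x, killed p (A ∪ B) ν n x * p x y)
      (∑ x, ν x * ∑ y, p x y * (1 - h y)) := by
  classical
  have hu := hh.mem_unit hc hA
  have hPk : ∀ x, x ∉ A → x ∉ B → ∑ y, p x y * (1 - h y) = 1 - h x := by
    intro x hxA hxB
    have e1 : ∑ z, c x z * (h x - h z) = w x * ∑ z, p x z * (h x - h z) := by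
      rw [Finset.mul_sum]
      refine Finset.sum_congr rfl fun z _ => ?_
      by_cases hxz : x = z
      · simp [hxz]
      · rw [← hcp x z hxz]; ring
    rw [hh.harmonic x hxA hxB] at e1
    have e2 := (mul_eq_zero.mp e1.symm).resolve_left (hw x).ne'
    simp only [mul_sub, Finset.sum_sub_distrib, ← Finset.sum_mul, hp1, mul_one, one_mul] at e2 ⊢
    linarith
  -- One step is taken before `1 - h` is evaluated, because return times count positive times only:
  -- off `A ∪ B` nothing changes, but on `A` the value `1 - h` itself would be zero.
  set k : S → ℝ := fun x => ∑ y, p x y * (1 - h y) with hk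
  have hk01 : ∀ x, 0 ≤ k x ∧ k x ≤ 1 := fun x => by
    refine ⟨Finset.sum_nonneg fun y _ => mul_nonneg (hp x y) (by linarith [hu y]), ?_⟩
    rw [← hp1 x]
    exact Finset.sum_le_sum fun y _ => mul_le_of_le_one_right (hp x y) (by linarith [hu y])
  have step : ∀ n, ∑ x, killed p (A ∪ B) ν n x * k x =
      ∑ y with y ∈ B, ∑ x, killed p (A ∪ B) ν n x * p x y +
        ∑ x, killed p (A ∪ B) ν (n + 1) x * k x := by
    intro n
    have e : ∑ x, killed p (A ∪ B) ν n x * k x =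
        ∑ y, (∑ x, killed p (A ∪ B) ν n x * p x y) * (1 - h y) := by
      simp only [hk, Finset.mul_sum, Finset.sum_mul]
      rw [Finset.sum_comm]
      exact Finset.sum_congr rfl fun x _ => Finset.sum_congr rfl fun y _ => by ring
    rw [e, Finset.sum_filter, ← Finset.sum_add_distrib]
    refine Finset.sum_congr rfl fun y _ => ?_
    by_cases hB : y ∈ B
    · simp [killed, hB, hh.zero y hB]
    by_cases hA : y ∈ A
    · simp [killed, hA, hB, hh.one y hA]
    · simp only [killed, Set.mem_union, hA, hB, or_self, if_false, zero_add]
      rw [show k y = 1 - h y from hPk y hA hB]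
  have tele : ∀ n, ∑ m ∈ Finset.range n,
      (∑ y with y ∈ B, ∑ x, killed p (A ∪ B) ν m x * p x y) =
        ∑ x, ν x * k x - ∑ x, killed p (A ∪ B) ν n x * k x := by
    intro n
    induction n with
    | zero => simp [killed]
    | succ n ih => rw [Finset.sum_range_succ, ih, step n]; ring
  have hnn := killed_nonneg (D := A ∪ B) hp hν
  rw [hasSum_iff_tendsto_nat_of_nonneg (fun n => Finset.sum_nonneg fun y _ =>
    Finset.sum_nonneg fun x _ => mul_nonneg (hnn n x) (hp x y))]
  simp only [tele]
  have hz : Tendsto (fun n => ∑ x, killed p (A ∪ B) ν n x * k x) atTop (𝓝 0) := by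
    refine squeeze_zero (fun n => Finset.sum_nonneg fun x _ => mul_nonneg (hnn n x) (hk01 x).1)
      (fun n => Finset.sum_le_sum fun x _ => mul_le_of_le_one_right (hnn n x) (hk01 x).2)
      (tendsto_sum_killed hc hp hp1 hcp (hA.mono Set.subset_union_left))
  simpa using (tendsto_const_nhds (x := ∑ x, ν x * k x)).sub hz

lemma killed_add (ν₁ ν₂ : S → ℝ) (n : ℕ) (x : S) :
    killed p D (fun y => ν₁ y + ν₂ y) n x = killed p D ν₁ n x + killed p D ν₂ n x := by
  induction n generalizing x with
  | zero => rfl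
  | succ n ih =>
    simp only [killed]
    split_ifs
    · simp
    · simp only [ih, add_mul, Finset.sum_add_distrib]

lemma killed_succ' (n : ℕ) (x : S) :
    killed p D (killed p D ν 1) n x = killed p D ν (n + 1) x := by
  induction n generalizing x with
  | zero => rfl
  | succ n ih =>
    rw [killed, killed.eq_2 p D ν (n + 1)]
    simp only [ih]

/-- If `g` is the expected occupation, `ν` its source, then the expected lifetime is the total
mass of `g`. -/
lemma hasSum_killed {c : S → S → ℝ} (hc : IsConductance c) {w : S → ℝ}
    (hp : ∀ x y, 0 ≤ p x y) (hp1 : ∀ x, ∑ y, p x y = 1)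
    (hcp : ∀ x y, x ≠ y → w x * p x y = c x y) (hD : D.Nonempty) (hν : ∀ x, 0 ≤ ν x)
    {g : S → ℝ} (hg : ∀ x, g x = ν x + killed p D g 1 x) :
    HasSum (fun n => ∑ x, killed p D ν n x) (∑ x, g x) := by
  have step : ∀ n x, killed p D g n x = killed p D ν n x + killed p D g (n + 1) x := by
    intro n x
    conv_lhs => rw [show g = fun y => ν y + killed p D g 1 y from funext hg]
    rw [killed_add, killed_succ']
  have tele : ∀ n, ∑ m ∈ Finset.range n, ∑ x, killed p D ν m x =
      ∑ x, g x - ∑ x, killed p D g n x := by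
    intro n
    induction n with
    | zero => simp [killed]
    | succ n ih =>
      rw [Finset.sum_range_succ, ih]
      have := Finset.sum_congr (rfl : (Finset.univ : Finset S) = _) fun x _ => step n x
      rw [Finset.sum_add_distrib] at this
      linarith
  rw [hasSum_iff_tendsto_nat_of_nonneg (fun n => Finset.sum_nonneg fun x _ =>
    killed_nonneg hp hν n x)]
  simp only [tele]
  simpa using (tendsto_const_nhds (x := ∑ x, g x)).sub
    (tendsto_sum_killed (ν := g) hc hp hp1 hcp hD)

end Killed

end Potts

end

noncomputable section

namespace Potts

/-! ### Path measure and mean hitting time -/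

section Chain

variable {q N : ℕ}

/-- Trajectories that avoid `D` at the times `1, …, n`. -/
def avoiding (D : Set (Config q N)) (n : ℕ) : Set (ℕ → Config q N) :=
  {ω | ∀ t, 0 < t → t ≤ n → ω t ∉ D}

lemma measurableSet_avoiding (D : Set (Config q N)) (n : ℕ) : MeasurableSet (avoiding D n) := by
  have : avoiding D n = ⋂ t, ⋂ (_ : 0 < t), ⋂ (_ : t ≤ n), {ω | ω t ∈ Dᶜ} := by
    ext; simp [avoiding]
  rw [this]
  refine MeasurableSet.iInter fun t => MeasurableSet.iInter fun _ => MeasurableSet.iInter fun _ => ?_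
  exact measurable_pi_apply t (Set.toFinite _).measurableSet

lemma chainLaw_zero (β : NNReal) (g : ℕ → ℕ → ℝ) (ν : Measure (Config q N))
    [IsProbabilityMeasure ν] (η : Config q N) :
    chainLaw β g ν {ω | ω 0 = η} = ν {η} := by
  set T : Set (Finset.Iic 0 → Config q N) := {x | x ⟨0, Finset.mem_Iic.mpr le_rfl⟩ = η} with hT
  have hTm : MeasurableSet T := (Set.toFinite _).measurableSet
  have hpre : {ω : ℕ → Config q N | ω 0 = η} =
      Preorder.frestrictLe (π := fun _ => Config q N) 0 ⁻¹' T := rfl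
  rw [hpre, ← Measure.map_apply (by fun_prop) hTm, chainLaw, Kernel.trajMeasure,
    Measure.map_comp _ _ (by fun_prop), Kernel.traj_map_frestrictLe, Kernel.partialTraj_self,
    Measure.id_comp, Measure.map_apply (MeasurableEquiv.measurable _) hTm]
  rfl

/-- The Markov property: avoiding `D` up to time `n` is an event of the trajectory up to `n`, and
the kernel looks only at the state at time `n`. -/
lemma chainLaw_step (β : NNReal) (g : ℕ → ℕ → ℝ) (ν : Measure (Config q N))
    [IsProbabilityMeasure ν] (D : Set (Config q N)) (n : ℕ) (η : Config q N) :
    chainLaw β g ν (avoiding D n ∩ {ω | ω (n + 1) = η}) =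
      ∑ ξ, chainLaw β g ν (avoiding D n ∩ {ω | ω n = ξ}) * ENNReal.ofReal (transProb β g ξ η) := by
  set T : Set (Finset.Iic n → Config q N) :=
    {x | ∀ t (ht : t ∈ Finset.Iic n), 0 < t → x ⟨t, ht⟩ ∉ D} with hT
  have hTm : MeasurableSet T := (Set.toFinite _).measurableSet
  have key := Kernel.map_frestrictLe_trajMeasure_compProd_eq_map_trajMeasure
    (X := fun _ => Config q N) (μ₀ := ν) (κ := stepKernel β g) (a := n)
  have hpre : Preorder.frestrictLe (π := fun _ => Config q N) n ⁻¹' T = avoiding D n := by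
    ext ω
    simp only [hT, Set.mem_preimage, Set.mem_ofPred_eq, avoiding, Preorder.frestrictLe_apply,
      Finset.mem_Iic]
    exact ⟨fun h t ht htn => h t htn ht, fun h t htn ht => h t ht htn⟩
  have h1 : _ = _ := DFunLike.congr_fun key (T ×ˢ {η})
  rw [Measure.map_apply (by fun_prop) (hTm.prod (measurableSet_singleton η)),
    Measure.compProd_apply_prod hTm (measurableSet_singleton η)] at h1
  have h2 : (fun x : ℕ → Config q N => (Preorder.frestrictLe (π := fun _ => Config q N) n x, x (n + 1))) ⁻¹' (T ×ˢ {η}) =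
      avoiding D n ∩ {ω | ω (n + 1) = η} := by
    rw [← hpre]; rfl
  rw [h2] at h1
  unfold chainLaw
  rw [← h1]
  have h3 : ∀ x : Finset.Iic n → Config q N, stepKernel β g n x {η} =
      ENNReal.ofReal (transProb β g (x ⟨n, Finset.mem_Iic.mpr le_rfl⟩) η) := by
    intro x
    change (stepPMF β g (x ⟨n, _⟩)).toMeasure {η} = _
    rw [PMF.toMeasure_apply_singleton _ _ (measurableSet_singleton η)]
    rfl
  simp only [h3]
  rw [← lintegral_map (f := fun ξ => ENNReal.ofReal (transProb β g ξ η))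
    (g := fun x : Finset.Iic n → Config q N => x ⟨n, Finset.mem_Iic.mpr le_rfl⟩)
    (measurable_of_finite _) (measurable_pi_apply _), lintegral_fintype]
  refine Finset.sum_congr rfl fun ξ _ => ?_
  rw [mul_comm]
  congr 1
  have hm : Measurable fun x : Finset.Iic n → Config q N => x ⟨n, Finset.mem_Iic.mpr le_rfl⟩ :=
    measurable_pi_apply _
  rw [Measure.map_apply hm (measurableSet_singleton ξ),
    Measure.restrict_apply (hm (measurableSet_singleton ξ)),
    Measure.map_apply (by fun_prop) ((Set.toFinite _).measurableSet), Set.inter_comm,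
    Set.preimage_inter, hpre]
  rfl

lemma chainLaw_avoiding {β : NNReal} {g : ℕ → ℕ → ℝ} {ν : Measure (Config q N)}
    [IsProbabilityMeasure ν] {ν₀ : Config q N → ℝ} (hν₀ : ∀ σ, 0 ≤ ν₀ σ)
    (hν : ∀ σ, ν {σ} = ENNReal.ofReal (ν₀ σ)) (D : Set (Config q N)) (n : ℕ) (η : Config q N) :
    chainLaw β g ν (avoiding D n ∩ {ω | ω n = η}) =
      ENNReal.ofReal (killed (transProb β g) D ν₀ n η) := by
  have hp := transProb_nonneg (q := q) (N := N) β.coe_nonneg g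
  induction n generalizing η with
  | zero =>
    have : avoiding D 0 ∩ {ω : ℕ → Config q N | ω 0 = η} = {ω | ω 0 = η} := by
      refine Set.inter_eq_right.mpr fun ω _ t ht ht0 => ?_
      omega
    rw [this, chainLaw_zero, hν]; rfl
  | succ n ih =>
    simp only [killed]
    split_ifs with hη
    · have : avoiding D (n + 1) ∩ {ω : ℕ → Config q N | ω (n + 1) = η} = ∅ := by
        ext ω
        simp only [Set.mem_inter_iff, Set.mem_empty_iff_false, iff_false, not_and]
        intro h1 h2
        exact h1 (n + 1) (by omega) le_rfl (by rw [h2]; exact hη)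
      rw [this]; simp
    · have : avoiding D (n + 1) ∩ {ω : ℕ → Config q N | ω (n + 1) = η} =
          avoiding D n ∩ {ω | ω (n + 1) = η} := by
        ext ω
        simp only [Set.mem_inter_iff, and_congr_left_iff]
        intro h2
        refine ⟨fun h t ht htn => h t ht (by omega), fun h t ht htn => ?_⟩
        rcases Nat.lt_or_ge n t with h3 | h3
        · obtain rfl : t = n + 1 := by omega
          rw [h2]; exact hη
        · exact h t ht h3
      rw [this, chainLaw_step, ENNReal.ofReal_sum_of_nonneg fun ξ _ =>
        mul_nonneg (killed_nonneg hp hν₀ n ξ) (hp ξ η)]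
      refine Finset.sum_congr rfl fun ξ _ => ?_
      rw [ih, ENNReal.ofReal_mul (killed_nonneg hp hν₀ n ξ)]

lemma lt_returnTime_iff {S : Type*} {A : Set S} {ω : ℕ → S} {n : ℕ} :
    (n : ℕ∞) < returnTime A ω ↔ ∀ t, 0 < t → t ≤ n → ω t ∉ A := by
  constructor
  · intro h t ht htn hA
    have : returnTime A ω ≤ t := iInf₂_le t ⟨ht, hA⟩
    exact absurd (h.trans_le this) (by simpa using htn)
  · intro h
    have : ((n + 1 : ℕ) : ℕ∞) ≤ returnTime A ω := by
      refine le_iInf₂ fun t ht => ?_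
      by_contra hlt
      have h1 : t ≤ n := by
        have : t < n + 1 := by exact_mod_cast not_le.mp hlt
        omega
      exact h t ht.1 h1 ht.2
    exact lt_of_lt_of_le (by exact_mod_cast Nat.lt_succ_self n) this

lemma ENat.toENNReal_eq_tsum (a : ℕ∞) :
    (a : ℝ≥0∞) = ∑' n : ℕ, if (n : ℕ∞) < a then 1 else 0 := by
  induction a using ENat.recTopCoe with
  | top =>
    simp only [ENat.natCast_lt_top, if_true, ENat.toENNReal_top]
    exact (ENNReal.tsum_const_eq_top_of_ne_zero one_ne_zero).symm
  | coe k =>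
    simp only [Nat.cast_lt, ENat.toENNReal_coe]
    rw [tsum_eq_sum (s := Finset.range k) (fun n hn => by
      simpa using hn)]
    rw [Finset.sum_congr rfl fun n hn => if_pos (Finset.mem_range.mp hn)]
    simp

/-- Tail-sum formula: the expectation is the sum over `n` of the probability of no visit at times
`1, …, n`, which is the mass of the killed chain at time `n`. -/
lemma lintegral_returnTime {β : NNReal} {g : ℕ → ℕ → ℝ} {ν : Measure (Config q N)}
    [IsProbabilityMeasure ν] {ν₀ : Config q N → ℝ} (hν₀ : ∀ σ, 0 ≤ ν₀ σ)
    (hν : ∀ σ, ν {σ} = ENNReal.ofReal (ν₀ σ)) (B : Set (Config q N)) :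
    ∫⁻ ω, (returnTime B ω : ℝ≥0∞) ∂(chainLaw β g ν) =
      ∑' n, ENNReal.ofReal (∑ η, killed (transProb β g) B ν₀ n η) := by
  have hp := transProb_nonneg (q := q) (N := N) β.coe_nonneg g
  have h1 : ∀ ω : ℕ → Config q N, (returnTime B ω : ℝ≥0∞) =
      ∑' n, (avoiding B n).indicator 1 ω := by
    intro ω
    rw [ENat.toENNReal_eq_tsum]
    refine tsum_congr fun n => ?_
    by_cases h : (n : ℕ∞) < returnTime B ω
    · rw [if_pos h, Set.indicator_of_mem (show ω ∈ avoiding B n from lt_returnTime_iff.mp h)]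
      rfl
    · rw [if_neg h, Set.indicator_of_notMem
        (fun h' : ω ∈ avoiding B n => h (lt_returnTime_iff.mpr h'))]
  simp only [h1]
  rw [lintegral_tsum fun n =>
    (measurable_one.indicator (measurableSet_avoiding B n)).aemeasurable]
  refine tsum_congr fun n => ?_
  rw [lintegral_indicator_one (measurableSet_avoiding B n),
    ENNReal.ofReal_sum_of_nonneg fun η _ => killed_nonneg hp hν₀ n η]
  simp only [← chainLaw_avoiding hν₀ hν]
  rw [← measure_biUnion_finset]
  · congr 1
    ext ω; simp
  · intro η _ ξ _ hηξ
    refine Set.disjoint_left.mpr fun ω h1 h2 => hηξ ?_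
    rw [← h1.2, ← h2.2]
  · intro η _
    have hm : Measurable fun ω : ℕ → Config q N => ω n := measurable_pi_apply n
    exact (measurableSet_avoiding B n).inter (hm (measurableSet_singleton η))

/-- Splits the event by the time `n + 1` of the first visit to `B`; at all earlier positive times
both sets are avoided, and disjointness rules out a visit to `A` at that very time. -/
lemma chainLaw_returnTime_lt {β : NNReal} {g : ℕ → ℕ → ℝ} {ν : Measure (Config q N)}
    [IsProbabilityMeasure ν] {ν₀ : Config q N → ℝ} (hν₀ : ∀ σ, 0 ≤ ν₀ σ)
    (hν : ∀ σ, ν {σ} = ENNReal.ofReal (ν₀ σ)) {A B : Set (Config q N)} (hAB : Disjoint A B)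
    [DecidablePred (· ∈ B)] :
    chainLaw β g ν {ω | returnTime B ω < returnTime A ω} =
      ∑' n, ENNReal.ofReal
        (∑ η with η ∈ B, ∑ ξ, killed (transProb β g) (A ∪ B) ν₀ n ξ * transProb β g ξ η) := by
  have hp := transProb_nonneg (q := q) (N := N) β.coe_nonneg g
  have hset : {ω : ℕ → Config q N | returnTime B ω < returnTime A ω} =
      ⋃ n, (avoiding (A ∪ B) n ∩ {ω | ω (n + 1) ∈ B}) := by
    ext ω
    simp only [Set.mem_ofPred_eq, Set.mem_iUnion, Set.mem_inter_iff]
    constructor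
    · intro h
      have hne : ∃ t, 0 < t ∧ ω t ∈ B := by
        by_contra hcon
        have : returnTime B ω = ⊤ := by
          simp only [returnTime, iInf_eq_top]
          exact fun t ht => absurd ⟨t, ht⟩ hcon
        rw [this] at h
        exact not_top_lt h
      classical
      obtain ⟨ht, htB⟩ := Nat.find_spec hne
      have hmin := fun m => Nat.find_min hne (m := m)
      set t := Nat.find hne
      have hle : returnTime B ω ≤ t := iInf₂_le t ⟨ht, htB⟩
      have hlt : ∀ s, 0 < s → s < t → ω s ∉ B := fun s hs hst hB => hmin s hst ⟨hs, hB⟩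
      have heq : (t : ℕ∞) ≤ returnTime B ω := by
        refine le_iInf₂ fun s hs => ?_
        by_contra hcon
        exact hlt s hs.1 (by exact_mod_cast not_le.mp hcon) hs.2
      have hA := lt_returnTime_iff.mp (heq.trans_lt h)
      refine ⟨t - 1, fun s hs hst => ?_, by rwa [Nat.sub_add_cancel ht]⟩
      rintro (h1 | h1)
      · exact hA s hs (by omega) h1
      · exact hlt s hs (by omega) h1
    · rintro ⟨n, hn, hB⟩
      have h1 : returnTime B ω ≤ (n + 1 : ℕ) := iInf₂_le (n + 1) ⟨by omega, hB⟩
      refine h1.trans_lt (lt_returnTime_iff.mpr fun t ht htn hA => ?_)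
      rcases Nat.lt_or_ge n t with h3 | h3
      · obtain rfl : t = n + 1 := by omega
        exact Set.disjoint_left.mp hAB hA hB
      · exact hn t ht h3 (Or.inl hA)
  have hm : ∀ n (T : Set (Config q N)), MeasurableSet
      (avoiding (A ∪ B) n ∩ {ω : ℕ → Config q N | ω (n + 1) ∈ T}) := fun n T =>
    (measurableSet_avoiding _ n).inter
      (measurable_pi_apply (n + 1) (Set.toFinite T).measurableSet)
  rw [hset, measure_iUnion]
  · refine tsum_congr fun n => ?_
    rw [ENNReal.ofReal_sum_of_nonneg fun η _ => Finset.sum_nonneg fun ξ _ =>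
      mul_nonneg (killed_nonneg hp hν₀ n ξ) (hp ξ η)]
    have : ∀ η, ENNReal.ofReal (∑ ξ, killed (transProb β g) (A ∪ B) ν₀ n ξ * transProb β g ξ η) =
        chainLaw β g ν (avoiding (A ∪ B) n ∩ {ω | ω (n + 1) ∈ ({η} : Set (Config q N))}) := by
      intro η
      rw [ENNReal.ofReal_sum_of_nonneg fun ξ _ =>
        mul_nonneg (killed_nonneg hp hν₀ n ξ) (hp ξ η)]
      simp only [Set.mem_singleton_iff]
      rw [chainLaw_step]
      refine Finset.sum_congr rfl fun ξ _ => ?_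
      rw [chainLaw_avoiding hν₀ hν, ENNReal.ofReal_mul (killed_nonneg hp hν₀ n ξ)]
    simp only [this]
    rw [← measure_biUnion_finset]
    · congr 1
      ext ω; simp
    · intro η _ ξ _ hηξ
      refine Set.disjoint_left.mpr fun ω h1 h2 => hηξ ?_
      rw [← h1.2, ← h2.2]
    · exact fun η _ => hm n {η}
  · intro n k hnk
    refine Set.disjoint_left.mpr fun ω h1 h2 => ?_
    rcases lt_or_gt_of_ne hnk with h | h
    · exact h2.1 (n + 1) (by omega) (by omega) (Or.inr h1.2)
    · exact h1.1 (k + 1) (by omega) (by omega) (Or.inr h2.2)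
  · exact fun n => hm n B

/-! ### Reversibility of the Metropolis dynamics and the hitting time formula -/

/-- Unnormalized Gibbs weight. -/
def weight (β : ℝ) (g : ℕ → ℕ → ℝ) (σ : Config q N) : ℝ :=
  Real.exp (-β * hamiltonian g σ)

/-- Conductances of the Metropolis dynamics, for the unnormalized Gibbs weight. -/
def conduct (β : ℝ) (g : ℕ → ℕ → ℝ) (σ η : Config q N) : ℝ :=
  if hammingDist σ η = 1 then
    ((N : ℝ) * q)⁻¹ * Real.exp (-β * max (hamiltonian g σ) (hamiltonian g η)) else 0

lemma weight_pos (β : ℝ) (g : ℕ → ℕ → ℝ) (σ : Config q N) : 0 < weight β g σ := Real.exp_pos _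

lemma weight_mul_transProb (β : ℝ) (g : ℕ → ℕ → ℝ) {σ η : Config q N} (h : σ ≠ η) :
    weight β g σ * transProb β g σ η = conduct β g σ η := by
  rw [transProb, if_neg h, flipProb, conduct, weight]
  split_ifs
  · rw [mul_left_comm, ← Real.exp_add]
    congr 2
    rcases le_total (hamiltonian g σ) (hamiltonian g η) with h' | h'
    · rw [max_eq_right h', max_eq_right (by linarith)]; ring
    · rw [max_eq_left h', max_eq_left (by linarith)]; ring
  · rw [mul_zero]

lemma eq_of_eq_of_hammingDist_eq_one {α : Type*} {f : Config q N → α}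
    (hf : ∀ σ η, hammingDist σ η = 1 → f σ = f η) (σ η : Config q N) : f σ = f η := by
  classical
  induction h : hammingDist σ η generalizing σ with
  | zero => rw [hammingDist_eq_zero.mp h]
  | succ n ih =>
    have hne : (Finset.univ.filter fun i => σ i ≠ η i).Nonempty := by
      rw [← Finset.card_pos]
      have : (Finset.univ.filter fun i => σ i ≠ η i).card = n + 1 := h
      omega
    obtain ⟨i, hi⟩ := hne
    have hi' : σ i ≠ η i := by simpa using hi
    have h1 : hammingDist σ (Function.update σ i (η i)) = 1 := by
      have : (Finset.univ.filter fun j => σ j ≠ Function.update σ i (η i) j) = {i} := by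
        ext j
        by_cases hj : j = i
        · subst hj; simp [hi']
        · simp [hj]
      rw [hammingDist, this, Finset.card_singleton]
    have h2 : hammingDist (Function.update σ i (η i)) η = n := by
      have : (Finset.univ.filter fun j => Function.update σ i (η i) j ≠ η j) =
          (Finset.univ.filter fun j => σ j ≠ η j).erase i := by
        ext j
        by_cases hj : j = i
        · subst hj; simp
        · simp [hj]
      rw [hammingDist, this, Finset.card_erase_of_mem hi]
      have : (Finset.univ.filter fun i => σ i ≠ η i).card = n + 1 := h
      omega
    rw [hf _ _ h1, ih _ h2]

lemma isConductance_conduct (β : ℝ) (g : ℕ → ℕ → ℝ) :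
    IsConductance (conduct (q := q) (N := N) β g) where
  symm σ η := by simp only [conduct, hammingDist_comm, max_comm]
  nonneg σ η := by unfold conduct; split_ifs <;> positivity
  connected f hf := eq_of_eq_of_hammingDist_eq_one fun σ η h => hf σ η <| by
    have hne : ∃ i, σ i ≠ η i := by
      by_contra! hcon
      rw [funext hcon, hammingDist_self] at h
      exact zero_ne_one h
    obtain ⟨i, _⟩ := hne
    have hN : 0 < N := i.pos
    have hq : 0 < q := (σ i).pos
    rw [conduct, if_pos h]
    positivity

/-- The mean hitting time started from the last-exit biased distribution in terms of the
equilibrium potential and the capacity. -/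
theorem meanHit_eq (β : NNReal) (g : ℕ → ℕ → ℝ) {A B : Set (Config q N)} (hA : A.Nonempty)
    (hB : B.Nonempty) (hAB : Disjoint A B) :
    meanHit β g A B = ENNReal.ofReal
      ((∑ σ, weight β g σ * equilibrium (conduct β g) A B σ) / capacity (conduct β g) A B) := by
  classical
  have hc := isConductance_conduct (q := q) (N := N) (β : ℝ) g
  have hh := isEquilibrium_equilibrium hc hA hAB
  set h := equilibrium (conduct (β : ℝ) g) A B with hh_def
  have hC : 0 < capacity (conduct (β : ℝ) g) A B := capacity_pos hc hA hB hAB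
  set C := capacity (conduct (β : ℝ) g) A B with hC_def
  have hu := hh.mem_unit hc hA
  have hp := transProb_nonneg (q := q) (N := N) β.coe_nonneg g
  have hp1 := sum_transProb (q := q) (N := N) (β : ℝ) g
  have hw := weight_pos (q := q) (N := N) (β : ℝ) g
  have hcp : ∀ σ η : Config q N, σ ≠ η → weight (β : ℝ) g σ * transProb β g σ η = conduct β g σ η :=
    fun σ η => weight_mul_transProb _ _
  set k : Config q N → ℝ := fun σ => ∑ η, transProb β g σ η * (1 - h η) with hk
  have hk0 : ∀ σ, 0 ≤ k σ := fun σ =>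
    Finset.sum_nonneg fun η _ => mul_nonneg (hp σ η) (by linarith [hu η])
  have hwP : ∀ σ, weight (β : ℝ) g σ * (h σ - (1 - k σ)) = ∑ η, conduct β g σ η * (h σ - h η) := by
    intro σ
    have e : 1 - k σ = ∑ η, transProb β g σ η * h η := by
      simp only [hk, mul_sub, mul_one, Finset.sum_sub_distrib, hp1]; ring
    have e' : h σ - (1 - k σ) = ∑ η, transProb β g σ η * (h σ - h η) := by
      simp only [e, mul_sub, Finset.sum_sub_distrib, ← Finset.sum_mul, hp1, one_mul]
    rw [e', Finset.mul_sum]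
    refine Finset.sum_congr rfl fun η _ => ?_
    by_cases hση : σ = η
    · simp [hση]
    · rw [← hcp σ η hση]; ring
  have hesc : ∀ σ, chainLaw β g (Measure.dirac σ) {ω | returnTime B ω < returnTime A ω} =
      ENNReal.ofReal (k σ) := by
    intro σ
    have hν₀ : ∀ η, (0 : ℝ) ≤ if η = σ then 1 else 0 := fun η => by split_ifs <;> norm_num
    rw [chainLaw_returnTime_lt hν₀ (fun η => ?_) hAB]
    · have := hasSum_killed_hit hc hw hp hp1 hcp hA hν₀ hh
      rw [← ENNReal.ofReal_tsum_of_nonneg _ this.summable, this.tsum_eq]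
      · simp [hk]
      · exact fun n => Finset.sum_nonneg fun η _ => Finset.sum_nonneg fun ξ _ =>
          mul_nonneg (killed_nonneg hp hν₀ n ξ) (hp ξ η)
    · rw [Measure.dirac_apply' _ (measurableSet_singleton η)]
      by_cases hησ : η = σ
      · simp [hησ]
      · simp [hησ, Ne.symm hησ]
  have hZ : 0 < partitionFn q N β g := by
    obtain ⟨a, _⟩ := hA
    exact Finset.sum_pos (fun σ _ => hw σ) ⟨a, Finset.mem_univ _⟩
  have hescW : ∀ σ, escapeWeight β g A B σ =
      ENNReal.ofReal (weight β g σ * k σ / partitionFn q N β g) := by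
    intro σ
    rw [escapeWeight, hesc, ← ENNReal.ofReal_mul (by
      unfold gibbs; positivity)]
    congr 1
    simp only [gibbs, weight]; ring
  -- In the summation-by-parts form of the energy only `A` contributes: `h` vanishes on `B` and is
  -- harmonic elsewhere. So the normaliser of the last-exit distribution is the capacity.
  have hCsum : ∑ σ with σ ∈ A, weight β g σ * k σ = C := by
    rw [hC_def, capacity, dirichlet_eq_sum_mul hc, Finset.sum_filter]
    refine Finset.sum_congr rfl fun σ _ => ?_
    split_ifs with hσ
    · rw [← hwP, ← hh_def, hh.one σ hσ]; ring
    · by_cases hσB : σ ∈ B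
      · rw [← hh_def, hh.zero σ hσB, zero_mul]
      · rw [← hh_def, hh.harmonic σ hσ hσB, mul_zero]
  have hescSum : ∑ σ with σ ∈ A, escapeWeight β g A B σ =
      ENNReal.ofReal (C / partitionFn q N β g) := by
    simp only [hescW]
    rw [← ENNReal.ofReal_sum_of_nonneg fun σ _ => by
      have := hw σ; have := hk0 σ; positivity, ← Finset.sum_div, hCsum]
  set ν₀ : Config q N → ℝ := fun σ => if σ ∈ A then weight β g σ * k σ / C else 0 with hν₀_def
  have hν₀ : ∀ σ, 0 ≤ ν₀ σ := fun σ => by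
    simp only [hν₀_def]
    have := hw σ; have := hk0 σ
    split_ifs <;> positivity
  have hlast : lastExit β g A B = ∑ σ with σ ∈ A, ENNReal.ofReal (ν₀ σ) • Measure.dirac σ := by
    unfold lastExit
    refine Finset.sum_congr (by congr) fun σ hσ => ?_
    have hσ' : σ ∈ A := by simpa using hσ
    have hs : ∑ η with η ∈ A, escapeWeight β g A B η =
      ENNReal.ofReal (C / partitionFn q N β g) := hescSum
    rw [hescW]
    congr 1
    convert (ENNReal.ofReal_div_of_pos (div_pos hC hZ)).symm using 2
    simp only [hν₀_def, if_pos hσ']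
    field_simp
  have hsing : ∀ σ, lastExit β g A B {σ} = ENNReal.ofReal (ν₀ σ) := by
    intro σ
    rw [hlast, Measure.finsetSum_apply, Finset.sum_filter]
    rw [Finset.sum_eq_single σ]
    · split_ifs with hσ
      · simp
      · simp [hν₀_def, hσ]
    · intro η _ hη
      split_ifs
      · simp [hη]
      · rfl
    · simp
  have hprob : IsProbabilityMeasure (lastExit β g A B) := by
    constructor
    rw [hlast, Measure.finsetSum_apply]
    simp only [Measure.smul_apply, measure_univ, smul_eq_mul, mul_one]
    rw [← ENNReal.ofReal_sum_of_nonneg fun σ _ => hν₀ σ]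
    have : ∑ σ with σ ∈ A, ν₀ σ = 1 := by
      rw [Finset.sum_congr rfl fun σ hσ => show ν₀ σ = weight β g σ * k σ / C by
        simp only [hν₀_def, if_pos (Finset.mem_filter.mp hσ).2], ← Finset.sum_div, hCsum,
        div_self hC.ne']
    rw [this, ENNReal.ofReal_one]
  rw [meanHit, lintegral_returnTime hν₀ hsing]
  -- By reversibility `w h / C` is the expected occupation before reaching `B`. Off `A ∪ B` the
  -- balance equation is harmonicity, on `B` both sides vanish, and on `A` the deficit `w k / C` is
  -- exactly the initial distribution.
  have hsum := hasSum_killed (D := B) (ν := ν₀) (g := fun σ => weight β g σ * h σ / C)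
    hc hp hp1 hcp hB hν₀ (fun σ => by
      simp only [killed, hν₀_def]
      by_cases hσB : σ ∈ B
      · rw [if_neg (Set.disjoint_right.mp hAB hσB), if_pos hσB, hh.zero σ hσB]; simp
      · rw [if_neg hσB]
        have e : ∑ ξ, weight β g ξ * h ξ / C * transProb β g ξ σ =
            weight β g σ * (1 - k σ) / C := by
          have e1 : 1 - k σ = ∑ η, transProb β g σ η * h η := by
            simp only [hk, mul_sub, mul_one, Finset.sum_sub_distrib, hp1]; ring
          rw [e1, Finset.mul_sum, Finset.sum_div]
          refine Finset.sum_congr rfl fun ξ _ => ?_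
          have : weight β g ξ * transProb β g ξ σ = weight β g σ * transProb β g σ ξ := by
            by_cases hξ : ξ = σ
            · rw [hξ]
            · rw [hcp ξ σ hξ, hcp σ ξ (Ne.symm hξ), hc.symm]
          calc _ = (weight β g ξ * transProb β g ξ σ) * h ξ / C := by ring
            _ = _ := by rw [this]; ring
        rw [e]
        have e2 := hwP σ
        split_ifs with hσA
        · rw [hh.one σ hσA]; ring
        · rw [hh.harmonic σ hσA hσB] at e2
          have := (mul_eq_zero.mp e2).resolve_left (hw σ).ne'
          rw [show h σ = 1 - k σ by linarith]; ring)
  rw [← ENNReal.ofReal_tsum_of_nonneg (fun n => Finset.sum_nonneg fun σ _ =>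
    killed_nonneg hp hν₀ n σ) hsum.summable, hsum.tsum_eq, ← Finset.sum_div]

end Chain

end Potts

end

noncomputable section

namespace Potts

/-! ### Free energy landscape -/

section Landscape

variable {q : ℕ} {β : ℝ}

/-- The contribution of one coordinate to `β` times the free energy. -/
def bulk (β t : ℝ) : ℝ := t * Real.log t - β / 2 * t ^ 2

lemma mul_freeEnergy (hβ : 0 < β) (x : Fin q → ℝ) :
    β * freeEnergy β x = ∑ i, bulk β (x i) := by
  simp only [freeEnergy, bulk, Finset.sum_sub_distrib, ← Finset.mul_sum]
  field_simp
  ring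

lemma freeEnergy_le_iff (hβ : 0 < β) (x y : Fin q → ℝ) :
    freeEnergy β x ≤ freeEnergy β y ↔ ∑ i, bulk β (x i) ≤ ∑ i, bulk β (y i) := by
  rw [← mul_freeEnergy hβ, ← mul_freeEnergy hβ, mul_le_mul_iff_right₀ hβ]

lemma continuous_bulk (β : ℝ) : Continuous (bulk β) := by
  unfold bulk
  exact Real.continuous_mul_log.sub (by fun_prop)

lemma continuous_freeEnergy (β : ℝ) : Continuous (freeEnergy (q := q) β) := by
  unfold freeEnergy
  have : ∀ i : Fin q, Continuous fun x : Fin q → ℝ => x i * Real.log (x i) := fun i =>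
    Real.continuous_mul_log.comp (continuous_apply i)
  fun_prop

lemma hasDerivAt_bulk {t : ℝ} (ht : t ≠ 0) :
    HasDerivAt (bulk β) (Real.log t + 1 - β * t) t := by
  unfold bulk
  have h1 := Real.hasDerivAt_mul_log ht
  have h2 : HasDerivAt (fun t : ℝ => β / 2 * t ^ 2) (β * t) t := by
    have := (hasDerivAt_pow 2 t).const_mul (β / 2)
    refine this.congr_deriv ?_
    simp; ring
  exact h1.sub h2

/-- Moving mass `t` from coordinate `j` to coordinate `i`. -/
def transfer (x : Fin q → ℝ) (i j : Fin q) (t : ℝ) : Fin q → ℝ :=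
  fun k => if k = i then x i + t else if k = j then x j - t else x k

lemma sum_transfer {i j : Fin q} (hij : i ≠ j) (x : Fin q → ℝ) (t : ℝ) (f : ℝ → ℝ) :
    ∑ k, f (transfer x i j t k) =
      ∑ k, f (x k) + (f (x i + t) - f (x i)) + (f (x j - t) - f (x j)) := by
  have h : ∀ k, f (transfer x i j t k) = f (x k) + (if k = i then f (x i + t) - f (x i) else 0) +
      (if k = j then f (x j - t) - f (x j) else 0) := by
    intro k
    unfold transfer
    by_cases h1 : k = i
    · have h2 : k ≠ j := by rw [h1]; exact hij
      rw [if_pos h1, if_pos h1, if_neg h2, h1]; ring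
    · rw [if_neg h1, if_neg h1]
      by_cases h2 : k = j
      · rw [if_pos h2, if_pos h2, h2]; ring
      · rw [if_neg h2, if_neg h2]; ring
  simp only [h, Finset.sum_add_distrib, Finset.sum_ite_eq', Finset.mem_univ, if_true]

lemma transfer_mem {x : Fin q → ℝ} (hx : x ∈ stdSimplex ℝ (Fin q)) {i j : Fin q} (hij : i ≠ j)
    {t : ℝ} (hi : 0 ≤ x i + t) (hj : 0 ≤ x j - t) :
    transfer x i j t ∈ stdSimplex ℝ (Fin q) := by
  refine ⟨fun k => ?_, ?_⟩
  · unfold transfer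
    split_ifs
    exacts [hi, hj, hx.1 k]
  · have := sum_transfer hij x t id
    simp only [id] at this
    rw [this, hx.2]; ring

lemma continuous_transfer (x : Fin q → ℝ) (i j : Fin q) : Continuous (transfer x i j) := by
  refine continuous_pi fun k => ?_
  unfold transfer
  split_ifs <;> fun_prop

lemma transfer_zero (x : Fin q → ℝ) (i j : Fin q) : transfer x i j 0 = x := by
  ext k
  unfold transfer
  split_ifs with h1 h2
  · rw [h1, add_zero]
  · rw [h2, sub_zero]
  · rfl

lemma eventually_transfer_of_isLocalMinOn {x : Fin q → ℝ}
    (hx : x ∈ stdSimplex ℝ (Fin q)) (hβ : 0 < β)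
    (hmin : IsLocalMinOn (freeEnergy β) (stdSimplex ℝ (Fin q)) x) {i j : Fin q} (hij : i ≠ j) :
    ∀ᶠ t in 𝓝 (0 : ℝ), 0 ≤ x i + t → 0 ≤ x j - t →
      bulk β (x i) + bulk β (x j) ≤ bulk β (x i + t) + bulk β (x j - t) := by
  have h1 : Tendsto (transfer x i j) (𝓝 0) (𝓝 x) := by
    have := (continuous_transfer x i j).tendsto 0
    rwa [transfer_zero] at this
  have h2 := eventually_nhdsWithin_iff.mp hmin
  filter_upwards [h1.eventually h2] with t ht hi hj
  have h3 := ht (transfer_mem hx hij hi hj)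
  rw [freeEnergy_le_iff hβ, sum_transfer hij] at h3
  linarith

/-- At an empty colour the entropy has slope `-∞`: moving a little mass there from an occupied
colour changes the energy by a negative multiple of the amount moved, so the point is no local
minimum. -/
lemma pos_of_isLocalMinOn {x : Fin q → ℝ}
    (hx : x ∈ stdSimplex ℝ (Fin q)) (hβ : 0 < β)
    (hmin : IsLocalMinOn (freeEnergy β) (stdSimplex ℝ (Fin q)) x) (i : Fin q) : 0 < x i := by
  refine (hx.1 i).lt_of_ne fun hi => ?_
  obtain ⟨j, hj⟩ : ∃ j, 0 < x j := by
    by_contra! hcon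
    have := Finset.sum_nonpos fun k (_ : k ∈ Finset.univ) => hcon k
    rw [hx.2] at this
    linarith
  have hij : i ≠ j := fun h => by rw [← h] at hj; exact hj.ne hi
  have h1 : ∀ᶠ t in 𝓝[>] (0 : ℝ), bulk β (x j) ≤ bulk β t + bulk β (x j - t) := by
    have h2 : ∀ᶠ t in 𝓝 (0 : ℝ), t < x j := eventually_lt_nhds hj
    filter_upwards [nhdsWithin_le_nhds (eventually_transfer_of_isLocalMinOn hx hβ hmin hij),
      nhdsWithin_le_nhds h2, self_mem_nhdsWithin] with t ht htj htp
    have := ht (by rw [← hi]; simpa using (le_of_lt htp : (0:ℝ) ≤ t)) (by linarith)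
    rw [← hi, zero_add] at this
    simpa [bulk] using this
  have hslope : Tendsto (fun t => t⁻¹ * (bulk β (x j - t) - bulk β (x j))) (𝓝[>] 0)
      (𝓝 (-(Real.log (x j) + 1 - β * x j))) := by
    have hd : HasDerivAt (fun t => bulk β (x j - t)) (-(Real.log (x j) + 1 - β * x j)) 0 := by
      have := (hasDerivAt_bulk (β := β) (t := x j - 0) (by simpa using hj.ne')).comp (0 : ℝ)
        ((hasDerivAt_id (0 : ℝ)).const_sub (x j))
      simp only [sub_zero, mul_neg, mul_one] at this
      exact this
    have := hd.tendsto_slope_zero_right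
    simpa using this
  have hlog : Tendsto (fun t : ℝ => Real.log t - β / 2 * t +
      t⁻¹ * (bulk β (x j - t) - bulk β (x j))) (𝓝[>] 0) atBot := by
    refine Filter.Tendsto.atBot_add (C := -(Real.log (x j) + 1 - β * x j)) ?_ hslope
    have h3 : Tendsto (fun t : ℝ => -(β / 2 * t)) (𝓝[>] 0) (𝓝 (-(β / 2 * 0))) :=
      Tendsto.mono_left (Continuous.tendsto (by fun_prop) 0) nhdsWithin_le_nhds
    exact Filter.Tendsto.atBot_add Real.tendsto_log_nhdsGT_zero h3
  obtain ⟨t, ht1, ht2, ht3⟩ := (h1.and ((hlog.eventually_lt_atBot 0).and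
    self_mem_nhdsWithin)).exists
  have ht : 0 < t := ht3
  have h4 := mul_neg_of_pos_of_neg ht ht2
  rw [mul_add, ← mul_assoc, mul_inv_cancel₀ ht.ne', one_mul] at h4
  simp only [bulk] at ht1 h4
  nlinarith

/-- The Lagrange condition, obtained by differentiating along the transfer of mass between two
colours. -/
lemma log_sub_eq_of_isLocalMinOn {x : Fin q → ℝ}
    (hx : x ∈ stdSimplex ℝ (Fin q)) (hβ : 0 < β)
    (hmin : IsLocalMinOn (freeEnergy β) (stdSimplex ℝ (Fin q)) x) (i j : Fin q) :
    Real.log (x i) - β * x i = Real.log (x j) - β * x j := by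
  by_cases hij : i = j
  · rw [hij]
  have hi := pos_of_isLocalMinOn hx hβ hmin i
  have hj := pos_of_isLocalMinOn hx hβ hmin j
  have hloc : IsLocalMin (fun t => bulk β (x i + t) + bulk β (x j - t)) 0 := by
    have h1 : ∀ᶠ t in 𝓝 (0 : ℝ), t < x j := eventually_lt_nhds hj
    have h2 : ∀ᶠ t in 𝓝 (0 : ℝ), -x i < t := eventually_gt_nhds (by linarith)
    filter_upwards [eventually_transfer_of_isLocalMinOn hx hβ hmin hij, h1, h2] with t ht h1 h2
    simpa using ht (by linarith) (by linarith)
  have hd : HasDerivAt (fun t => bulk β (x i + t) + bulk β (x j - t))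
      ((Real.log (x i) + 1 - β * x i) + -(Real.log (x j) + 1 - β * x j)) 0 := by
    have h1 := (hasDerivAt_bulk (β := β) (t := x i + 0) (by simpa using hi.ne')).comp (0 : ℝ)
        ((hasDerivAt_id (0 : ℝ)).const_add (x i))
    have h2 := (hasDerivAt_bulk (β := β) (t := x j - 0) (by simpa using hj.ne')).comp (0 : ℝ)
        ((hasDerivAt_id (0 : ℝ)).const_sub (x j))
    simp only [add_zero, sub_zero, mul_one, mul_neg] at h1 h2
    exact h1.add h2
  have := hloc.hasDerivAt_eq_zero hd
  linarith

lemma strictConcaveOn_bulk (hβ : 0 < β) : StrictConcaveOn ℝ (Set.Ici (1 / β)) (bulk β) := by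
  have hb : 0 < 1 / β := by positivity
  refine StrictAntiOn.strictConcaveOn_of_deriv (convex_Ici _)
    (continuous_bulk β).continuousOn ?_
  rw [interior_Ici]
  intro s hs t ht hst
  have hs0 : 0 < s := hb.trans hs
  have ht0 : 0 < t := hb.trans ht
  rw [(hasDerivAt_bulk hs0.ne').deriv, (hasDerivAt_bulk ht0.ne').deriv]
  have h1 : Real.log t - Real.log s ≤ t / s - 1 := by
    rw [← Real.log_div ht0.ne' hs0.ne']
    exact Real.log_le_sub_one_of_pos (by positivity)
  have h2 : t / s - 1 < β * (t - s) := by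
    rw [div_sub_one hs0.ne', div_lt_iff₀ hs0]
    have : 1 < β * s := by
      rw [Set.mem_Ioi, div_lt_iff₀ hβ] at hs; linarith
    nlinarith
  linarith

/-- Above `1 / β` the one-coordinate energy is strictly concave, so if two equal coordinates were
that large, splitting them apart would lower the free energy. -/
lemma eq_of_one_div_lt_of_isLocalMinOn {x : Fin q → ℝ}
    (hx : x ∈ stdSimplex ℝ (Fin q)) (hβ : 0 < β)
    (hmin : IsLocalMinOn (freeEnergy β) (stdSimplex ℝ (Fin q)) x) {i j : Fin q}
    (hi : 1 / β < x i) (hxij : x i = x j) : i = j := by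
  by_contra hij
  have h1 : ∀ᶠ t in 𝓝[>] (0 : ℝ), t < x i - 1 / β :=
    nhdsWithin_le_nhds (eventually_lt_nhds (by linarith))
  have h0 : ∀ᶠ t in 𝓝[>] (0 : ℝ), _ :=
    nhdsWithin_le_nhds (eventually_transfer_of_isLocalMinOn hx hβ hmin hij)
  obtain ⟨t, ht1, ht2, ht3⟩ := (h0.and (h1.and self_mem_nhdsWithin)).exists
  have ht : 0 < t := ht3
  have hb : 0 < 1 / β := by positivity
  have h2 := ht1 (by linarith) (by rw [← hxij]; linarith)
  rw [← hxij] at h2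
  obtain ⟨_, hconc⟩ := strictConcaveOn_bulk hβ
  have h3 := hconc
    (show x i + t ∈ Set.Ici (1 / β) by rw [Set.mem_Ici]; linarith)
    (show x i - t ∈ Set.Ici (1 / β) by rw [Set.mem_Ici]; linarith) (by intro h; linarith)
    (show (0 : ℝ) < 1 / 2 by norm_num) (show (0 : ℝ) < 1 / 2 by norm_num) (by norm_num)
  simp only [smul_eq_mul] at h3
  rw [show 1 / 2 * (x i + t) + 1 / 2 * (x i - t) = x i by ring] at h3
  linarith

/-- With its companion below: the critical function rises up to `1 / β` and falls beyond, so a local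
minimum takes at most one value on each side. -/
lemma log_sub_mul_lt {s t : ℝ} (hs : 0 < s) (hst : s < t) (ht : t ≤ 1 / β) (hβ : 0 < β) :
    Real.log s - β * s < Real.log t - β * t := by
  have ht0 : 0 < t := hs.trans hst
  have h1 : Real.log s - Real.log t < s / t - 1 := by
    rw [← Real.log_div hs.ne' ht0.ne']
    refine Real.log_lt_sub_one_of_pos (by positivity) fun h => ?_
    rw [div_eq_one_iff_eq ht0.ne'] at h
    linarith
  have h2 : s / t - 1 ≤ β * (s - t) := by
    rw [div_sub_one ht0.ne', div_le_iff₀ ht0]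
    rw [le_div_iff₀ hβ] at ht
    nlinarith
  linarith

lemma log_sub_mul_lt' {s t : ℝ} (hs : 1 / β ≤ s) (hst : s < t) (hβ : 0 < β) :
    Real.log t - β * t < Real.log s - β * s := by
  have hs0 : 0 < s := (by positivity : 0 < 1 / β).trans_le hs
  have ht0 : 0 < t := hs0.trans hst
  have h1 : Real.log t - Real.log s < t / s - 1 := by
    rw [← Real.log_div ht0.ne' hs0.ne']
    refine Real.log_lt_sub_one_of_pos (by positivity) fun h => ?_
    rw [div_eq_one_iff_eq hs0.ne'] at h
    linarith
  have h2 : t / s - 1 ≤ β * (t - s) := by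
    rw [div_sub_one hs0.ne', div_le_iff₀ hs0]
    rw [div_le_iff₀ hβ] at hs
    nlinarith
  linarith

/-- The point with order parameter `s` in direction `i`. -/
def orderedPt (q : ℕ) (s : ℝ) (i : Fin q) : Fin q → ℝ :=
  fun k => if k = i then (1 + ((q : ℝ) - 1) * s) / q else (1 - s) / q

/-- The function whose largest zero is the order parameter. -/
def gap (q : ℕ) (β s : ℝ) : ℝ :=
  Real.log (1 + ((q : ℝ) - 1) * s) - Real.log (1 - s) - β * s

/-- All coordinates up to `1 / β` agree, and at most one coordinate exceeds `1 / β`. With none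
exceeding it the point is uniform; otherwise the large coordinate fixes the direction, and the
critical equation becomes the vanishing of `gap`. -/
lemma eq_uniformPt_or_of_isLocalMinOn (hq : 2 ≤ q) {x : Fin q → ℝ}
    (hx : x ∈ stdSimplex ℝ (Fin q)) (hβ : 0 < β)
    (hmin : IsLocalMinOn (freeEnergy β) (stdSimplex ℝ (Fin q)) x) :
    x = uniformPt q ∨ ∃ i s, 0 < s ∧ s < 1 ∧ gap q β s = 0 ∧ x = orderedPt q s i := by
  have hpos := pos_of_isLocalMinOn hx hβ hmin
  have hcrit := log_sub_eq_of_isLocalMinOn hx hβ hmin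
  have hq0 : (0 : ℝ) < q := by positivity
  have hlow : ∀ j k, x j ≤ 1 / β → x k ≤ 1 / β → x j = x k := by
    intro j k hj hk
    rcases lt_trichotomy (x j) (x k) with h | h | h
    · exact absurd (hcrit j k) (log_sub_mul_lt (hpos j) h hk hβ).ne
    · exact h
    · exact absurd (hcrit k j) (log_sub_mul_lt (hpos k) h hj hβ).ne
  by_cases hall : ∀ j, x j ≤ 1 / β
  · left
    ext j
    have h1 : ∑ k, x k = ∑ _k : Fin q, x j :=
      Finset.sum_congr rfl fun k _ => hlow k j (hall k) (hall j)
    rw [hx.2] at h1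
    simp only [Finset.sum_const, Finset.card_univ, Fintype.card_fin, nsmul_eq_mul] at h1
    rw [uniformPt, eq_div_iff hq0.ne']; linarith
  · right
    push Not at hall
    obtain ⟨i, hi⟩ := hall
    have hrest : ∀ j, j ≠ i → x j ≤ 1 / β := by
      intro j hji
      by_contra! hj
      rcases lt_trichotomy (x i) (x j) with h | h | h
      · exact absurd (hcrit i j) (log_sub_mul_lt' hi.le h hβ).ne'
      · exact hji (eq_of_one_div_lt_of_isLocalMinOn hx hβ hmin hi h).symm
      · exact absurd (hcrit j i) (log_sub_mul_lt' hj.le h hβ).ne'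
    obtain ⟨j, hj⟩ : ∃ j : Fin q, j ≠ i := by
      have : Nontrivial (Fin q) := Fin.nontrivial_iff_two_le.mpr hq
      exact exists_ne i
    have hb : ∀ k, k ≠ i → x k = x j := fun k hk => hlow k j (hrest k hk) (hrest j hj)
    have hsum : x i + ((q : ℝ) - 1) * x j = 1 := by
      refine Eq.trans ?_ hx.2
      rw [← Finset.add_sum_erase _ _ (Finset.mem_univ i)]
      rw [Finset.sum_congr rfl fun k hk => hb k (Finset.ne_of_mem_erase hk)]
      simp only [Finset.sum_const, Finset.card_erase_of_mem (Finset.mem_univ i),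
        Finset.card_univ, Fintype.card_fin, nsmul_eq_mul]
      rw [Nat.cast_sub (by omega), Nat.cast_one]
    have hja := hrest j hj
    have ha : x i = (1 + ((q : ℝ) - 1) * (x i - x j)) / q := by
      rw [eq_div_iff hq0.ne']; linarith
    have hbj : x j = (1 - (x i - x j)) / q := by
      rw [eq_div_iff hq0.ne']; linarith
    have hpj := hpos j
    have hpi := hpos i
    have hqj : 1 - (x i - x j) = q * x j := by rw [hbj]; field_simp; linarith
    have hqi : 1 + ((q : ℝ) - 1) * (x i - x j) = q * x i := by linarith
    refine ⟨i, x i - x j, by linarith, ?_, ?_, ?_⟩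
    · have : 0 < (q : ℝ) * x j := by positivity
      linarith
    · rw [gap, hqj, hqi, Real.log_mul hq0.ne' hpi.ne', Real.log_mul hq0.ne' hpj.ne']
      linarith [hcrit i j]
    · ext k
      unfold orderedPt
      split_ifs with hk
      · rw [hk]; exact ha
      · rw [hb k hk]; exact hbj

end Landscape

end Potts

end

noncomputable section

namespace Potts

/-! ### The order parameter and second-order conditions at the ordered points -/

section OrderParameter

variable {q : ℕ} {β : ℝ}

lemma one_add_mul_pos (hq : 2 ≤ q) {s : ℝ} (hs : 0 ≤ s) : 0 < 1 + ((q : ℝ) - 1) * s := by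
  have : (2 : ℝ) ≤ q := by exact_mod_cast hq
  nlinarith

lemma hasDerivAt_gap (hq : 2 ≤ q) {s : ℝ} (hs : 0 ≤ s) (hs1 : s < 1) :
    HasDerivAt (gap q β) (q / ((1 + ((q : ℝ) - 1) * s) * (1 - s)) - β) s := by
  have h1 := one_add_mul_pos hq hs
  have h2 : 0 < 1 - s := by linarith
  unfold gap
  have e1 : HasDerivAt (fun s : ℝ => 1 + ((q : ℝ) - 1) * s) ((q : ℝ) - 1) s := by
    simpa using ((hasDerivAt_id s).const_mul ((q : ℝ) - 1)).const_add 1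
  have e2 : HasDerivAt (fun s : ℝ => 1 - s) (-1) s := by
    simpa using (hasDerivAt_id s).const_sub 1
  have e3 : HasDerivAt (fun s : ℝ => β * s) β s := by
    simpa using (hasDerivAt_id s).const_mul β
  refine (((e1.log h1.ne').sub (e2.log h2.ne')).sub e3).congr_deriv ?_
  field_simp
  ring

lemma continuousOn_gap (hq : 2 ≤ q) {s t : ℝ} (hs : 0 ≤ s) (ht : t < 1) :
    ContinuousOn (gap q β) (Set.Icc s t) := fun _ hu =>
  (hasDerivAt_gap hq (hs.trans hu.1) (hu.2.trans_lt ht)).continuousAt.continuousWithinAt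

lemma gap_zero : gap q β 0 = 0 := by simp [gap]

lemma sum_orderedPt (s : ℝ) (i : Fin q) (f : ℝ → ℝ) :
    ∑ k, f (orderedPt q s i k) =
      f ((1 + ((q : ℝ) - 1) * s) / q) + ((q : ℝ) - 1) * f ((1 - s) / q) := by
  have hq : 0 < q := i.pos
  rw [← Finset.add_sum_erase _ _ (Finset.mem_univ i),
    Finset.sum_congr rfl fun k hk => show f (orderedPt q s i k) = f ((1 - s) / q) by
      rw [orderedPt, if_neg (Finset.ne_of_mem_erase hk)]]
  simp only [orderedPt, if_true, Finset.sum_const, Finset.card_erase_of_mem (Finset.mem_univ i),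
    Finset.card_univ, Fintype.card_fin, nsmul_eq_mul]
  rw [Nat.cast_sub (by omega), Nat.cast_one]

lemma orderedPt_mem (hq : 2 ≤ q) {s : ℝ} (hs : 0 ≤ s) (hs1 : s ≤ 1) (i : Fin q) :
    orderedPt q s i ∈ stdSimplex ℝ (Fin q) := by
  have hq0 : (0 : ℝ) < q := by positivity
  refine ⟨fun k => ?_, ?_⟩
  · unfold orderedPt
    have := one_add_mul_pos hq hs
    split_ifs
    · positivity
    · exact div_nonneg (by linarith) hq0.le
  · have := sum_orderedPt s i id
    simp only [id] at this
    rw [this]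
    field_simp
    ring

lemma hasDerivAt_sum_bulk_orderedPt (hq : 2 ≤ q) {s : ℝ} (hs : 0 ≤ s) (hs1 : s < 1) (i : Fin q) :
    HasDerivAt (fun s => ∑ k, bulk β (orderedPt q s i k)) (((q : ℝ) - 1) / q * gap q β s) s := by
  have hq0 : (0 : ℝ) < q := by positivity
  have h1 := one_add_mul_pos hq hs
  have h2 : 0 < 1 - s := by linarith
  simp only [sum_orderedPt]
  have e1 : HasDerivAt (fun s : ℝ => (1 + ((q : ℝ) - 1) * s) / q) (((q : ℝ) - 1) / q) s := by
    simpa using (((hasDerivAt_id s).const_mul ((q : ℝ) - 1)).const_add 1).div_const (q : ℝ)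
  have e2 : HasDerivAt (fun s : ℝ => (1 - s) / q) (-1 / q) s := by
    simpa using ((hasDerivAt_id s).const_sub 1).div_const (q : ℝ)
  have e3 := (hasDerivAt_bulk (β := β) (div_pos h1 hq0).ne').comp s e1
  have e4 := ((hasDerivAt_bulk (β := β) (div_pos h2 hq0).ne').comp s e2).const_mul ((q : ℝ) - 1)
  refine (e3.add e4).congr_deriv ?_
  rw [Real.log_div h1.ne' hq0.ne', Real.log_div h2.ne' hq0.ne', gap]
  field_simp
  ring

lemma continuous_orderedPt (i : Fin q) : Continuous fun s => orderedPt q s i := by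
  refine continuous_pi fun k => ?_
  unfold orderedPt
  split_ifs <;> fun_prop

/-- A zero of `gap` beyond `s` would give, by Rolle, critical points of `gap` on both sides of `s`.
Since `gap` decreases between them it is negative just after `s`; but `gap` is, up to a positive
factor, the derivative of the energy along the ordered line, so `s` could not be a local minimum. -/
lemma lt_of_isLocalMinOn_orderedPt (hq : 2 ≤ q) (hβ : 0 < β) {s : ℝ} (hs : 0 < s) (hs1 : s < 1)
    (hgap : gap q β s = 0) {i : Fin q}
    (hmin : IsLocalMinOn (freeEnergy β) (stdSimplex ℝ (Fin q)) (orderedPt q s i)) {t : ℝ}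
    (ht1 : t < 1) (ht : gap q β t = 0) : t ≤ s := by
  by_contra! hst
  have hq2 : (2 : ℝ) ≤ q := by exact_mod_cast hq
  obtain ⟨p, hp, hp'⟩ := exists_deriv_eq_zero hs (continuousOn_gap (β := β) hq le_rfl hs1)
    (by rw [gap_zero, hgap])
  obtain ⟨r, hr, hr'⟩ := exists_deriv_eq_zero hst (continuousOn_gap (β := β) hq hs.le ht1)
    (by rw [hgap, ht])
  have hr1 : r < 1 := hr.2.trans ht1
  have hp1 : p < 1 := hp.2.trans hs1
  have hr0 : 0 < r := hs.trans hr.1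
  rw [(hasDerivAt_gap hq hp.1.le hp1).deriv, sub_eq_zero,
    div_eq_iff (mul_pos (one_add_mul_pos hq hp.1.le) (by linarith)).ne'] at hp'
  rw [(hasDerivAt_gap hq hr0.le hr1).deriv, sub_eq_zero,
    div_eq_iff (mul_pos (one_add_mul_pos hq hr0.le) (by linarith)).ne'] at hr'
  have hneg : ∀ u ∈ Set.Ioo p r, deriv (gap q β) u < 0 := by
    intro u hu
    have hu0 : 0 < u := hp.1.trans hu.1
    have hu1 : u < 1 := hu.2.trans hr1
    rw [(hasDerivAt_gap hq hu0.le hu1).deriv, sub_neg,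
      div_lt_iff₀ (mul_pos (one_add_mul_pos hq hu0.le) (by linarith))]
    have hpr : p < r := hu.1.trans hu.2
    -- Both critical points are roots of the same quadratic, and this is the sum of its roots; it
    -- yields the factorisation `e2`, hence the sign of the derivative between them.
    have e : ((q : ℝ) - 1) * (p + r) = (q : ℝ) - 2 := by
      have : β * ((p - r) * (((q : ℝ) - 2) - ((q : ℝ) - 1) * (p + r))) = 0 := by linarith
      rcases mul_eq_zero.mp this with h | h
      · linarith
      · rcases mul_eq_zero.mp h with h | h <;> linarith
    have e2 : (1 + ((q : ℝ) - 1) * u) * (1 - u) = (1 + ((q : ℝ) - 1) * p) * (1 - p) +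
        ((q : ℝ) - 1) * ((u - p) * (r - u)) := by
      have : (q : ℝ) - 2 = ((q : ℝ) - 1) * (p + r) := e.symm
      linear_combination (u - p) * this
    rw [e2, mul_add, ← hp']
    have : 0 < β * (((q : ℝ) - 1) * ((u - p) * (r - u))) := by
      have h1 := sub_pos.mpr hu.1
      have h2 := sub_pos.mpr hu.2
      have h3 : 0 < (q : ℝ) - 1 := by linarith
      positivity
    linarith
  have hanti : StrictAntiOn (gap q β) (Set.Icc p r) := by
    refine strictAntiOn_of_deriv_neg (convex_Icc _ _) (continuousOn_gap hq hp.1.le hr1) ?_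
    rw [interior_Icc]; exact hneg
  have hanti2 : StrictAntiOn (fun s => ∑ k, bulk β (orderedPt q s i k)) (Set.Icc s r) := by
    refine strictAntiOn_of_deriv_neg (convex_Icc _ _) (fun u hu => ?_) ?_
    · exact (hasDerivAt_sum_bulk_orderedPt hq (hs.le.trans hu.1)
        (hu.2.trans_lt hr1) i).continuousAt.continuousWithinAt
    · rw [interior_Icc]
      intro u hu
      rw [(hasDerivAt_sum_bulk_orderedPt hq (hs.le.trans hu.1.le) (hu.2.trans hr1) i).deriv]
      refine mul_neg_of_pos_of_neg (div_pos (by linarith) (by linarith)) ?_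
      rw [← hgap]
      exact hanti ⟨hp.2.le, hr.1.le⟩ ⟨(hp.2.trans hu.1).le, hu.2.le⟩ hu.1
  have h1 := ((continuous_orderedPt i).tendsto s).eventually (eventually_nhdsWithin_iff.mp hmin)
  have h2 : ∀ᶠ u in 𝓝[>] s, u < r := nhdsWithin_le_nhds (eventually_lt_nhds hr.1)
  have h1' : ∀ᶠ u in 𝓝[>] s, _ := nhdsWithin_le_nhds h1
  obtain ⟨u, hu1, hu2, hu3⟩ := (h1'.and (h2.and self_mem_nhdsWithin)).exists
  have hu4 : s < u := hu3
  have h3 := hu1 (orderedPt_mem hq (hs.trans hu4).le (hu2.trans hr1).le i)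
  rw [freeEnergy_le_iff hβ] at h3
  have h4 := hanti2 ⟨le_rfl, hr.1.le⟩ ⟨hu4.le, hu2.le⟩ hu4
  exact absurd h3 (not_le.mpr h4)

lemma orderParam_eq_of_isLocalMinOn (hq : 2 ≤ q) (hβ : 0 < β) {s : ℝ} (hs : 0 < s) (hs1 : s < 1)
    (hgap : gap q β s = 0) {i : Fin q}
    (hmin : IsLocalMinOn (freeEnergy β) (stdSimplex ℝ (Fin q)) (orderedPt q s i)) :
    orderParam q β = s := by
  refine IsGreatest.csSup_eq ⟨⟨one_add_mul_pos hq hs.le, hs1, by unfold gap at hgap; linarith⟩, ?_⟩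
  rintro t ⟨_, ht1, ht⟩
  exact lt_of_isLocalMinOn_orderedPt hq hβ hs hs1 hgap hmin ht1 (by unfold gap; linarith)

/-- The local minima of the free energy. -/
theorem eq_minPt_of_isLocalMinOn (hq : 2 ≤ q) (hβ : 0 < β) {x : Fin q → ℝ}
    (hx : x ∈ stdSimplex ℝ (Fin q))
    (hmin : IsLocalMinOn (freeEnergy β) (stdSimplex ℝ (Fin q)) x) :
    x = uniformPt q ∨ (0 < orderParam q β ∧ orderParam q β < 1 ∧ gap q β (orderParam q β) = 0 ∧
      ∃ i, x = minPt q β (some i)) := by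
  rcases eq_uniformPt_or_of_isLocalMinOn hq hx hβ hmin with h | ⟨i, s, hs, hs1, hgap, rfl⟩
  · exact Or.inl h
  · have h := orderParam_eq_of_isLocalMinOn hq hβ hs hs1 hgap hmin
    right
    rw [h]
    exact ⟨hs, hs1, hgap, i, by rw [← h]; rfl⟩

/-- A second-order Taylor lower bound with curvature `c` strictly below the true one: after
subtraction of the quadratic, `a` is a critical point with positive second derivative. -/
lemma isLocalMin_bulk_sub {a c l : ℝ} (ha : 0 < a) (hl : Real.log a + 1 - β * a = l)
    (hc : c < 1 / a - β) :
    ∀ᶠ t in 𝓝 a, bulk β a + l * (t - a) + c / 2 * (t - a) ^ 2 ≤ bulk β t := by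
  set k : ℝ → ℝ := fun t => bulk β t - (l * (t - a) + c / 2 * (t - a) ^ 2) with hk
  have hd : ∀ t, 0 < t → HasDerivAt k (Real.log t + 1 - β * t - (l + c * (t - a))) t := by
    intro t ht
    have e1 : HasDerivAt (fun t => l * (t - a) + c / 2 * (t - a) ^ 2) (l + c * (t - a)) t := by
      have e := (hasDerivAt_id t).sub_const a
      refine ((e.const_mul l).add ((e.pow 2).const_mul (c / 2))).congr_deriv ?_
      simp; ring
    exact (hasDerivAt_bulk ht.ne').sub e1
  have hev : deriv k =ᶠ[𝓝 a] fun t => Real.log t + 1 - β * t - (l + c * (t - a)) := by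
    filter_upwards [eventually_gt_nhds ha] with t ht using (hd t ht).deriv
  have hd2 : HasDerivAt (fun t => Real.log t + 1 - β * t - (l + c * (t - a)))
      (a⁻¹ - β - c) a := by
    have e1 := (Real.hasDerivAt_log ha.ne').add_const 1
    have e2 := (hasDerivAt_id a).const_mul β
    have e3 := (((hasDerivAt_id a).sub_const a).const_mul c).const_add l
    refine ((e1.sub e2).sub e3).congr_deriv ?_
    simp
  have hloc : IsLocalMin k a := by
    refine isLocalMin_of_deriv_deriv_pos ?_ ?_ (hd a ha).continuousAt
    · rw [hev.deriv_eq, hd2.deriv]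
      rw [one_div] at hc; linarith
    · rw [(hd a ha).deriv, hl]; ring
  filter_upwards [hloc] with t ht
  simp only [hk] at ht
  have : bulk β a - (l * (a - a) + c / 2 * (a - a) ^ 2) = bulk β a := by ring
  linarith

/-- Second order criterion for local minima of the free energy. -/
lemma isLocalMinOn_of_quadratic (hβ : 0 < β) {x : Fin q → ℝ} (hx : ∑ i, x i = 1)
    (hpos : ∀ i, 0 < x i) {l : ℝ} (hl : ∀ i, Real.log (x i) + 1 - β * x i = l) (c : Fin q → ℝ)
    (hc : ∀ i, c i < 1 / x i - β)
    (hquad : ∀ v : Fin q → ℝ, ∑ i, v i = 0 → 0 ≤ ∑ i, c i * v i ^ 2) :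
    IsLocalMinOn (freeEnergy β) (stdSimplex ℝ (Fin q)) x := by
  have h : ∀ i, ∀ᶠ y : Fin q → ℝ in 𝓝 x,
      bulk β (x i) + l * (y i - x i) + c i / 2 * (y i - x i) ^ 2 ≤ bulk β (y i) := fun i =>
    ((continuous_apply i).tendsto x).eventually (isLocalMin_bulk_sub (hpos i) (hl i) (hc i))
  refine eventually_nhdsWithin_iff.mpr ?_
  filter_upwards [eventually_all.mpr h] with y hy hyS
  rw [freeEnergy_le_iff hβ]
  have h1 := Finset.sum_le_sum fun i (_ : i ∈ Finset.univ) => hy i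
  have h2 := hquad (fun i => y i - x i) (by rw [Finset.sum_sub_distrib, hyS.2, hx, sub_self])
  have h3 : ∑ i, (bulk β (x i) + l * (y i - x i) + c i / 2 * (y i - x i) ^ 2) =
      ∑ i, bulk β (x i) + l * (∑ i, y i - ∑ i, x i) + (1 / 2) * ∑ i, c i * (y i - x i) ^ 2 := by
    rw [Finset.sum_add_distrib, Finset.sum_add_distrib, ← Finset.mul_sum, Finset.mul_sum (a := 1 / 2),
      Finset.sum_sub_distrib]
    congr 1
    exact Finset.sum_congr rfl fun i _ => by ring
  rw [h3, hyS.2, hx] at h1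
  linarith

lemma isLocalMinOn_uniformPt (hq : 2 ≤ q) (hβ : 0 < β) (hβq : β < q) :
    IsLocalMinOn (freeEnergy β) (stdSimplex ℝ (Fin q)) (uniformPt q) := by
  have hq0 : (0 : ℝ) < q := by positivity
  refine isLocalMinOn_of_quadratic hβ ?_ (fun _ => ?_) (l := Real.log (1 / q) + 1 - β * (1 / q))
    (fun _ => rfl) (fun _ => 0) (fun _ => ?_) (fun v _ => by simp)
  · simp [uniformPt, hq0.ne']
  · unfold uniformPt; positivity
  · unfold uniformPt; rw [one_div_one_div]; linarith

lemma isLocalMinOn_orderedPt (hq : 2 ≤ q) (hβ : 0 < β) {z : ℝ} (hz : 0 < z) (hz1 : z < 1)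
    (hgap : gap q β z = 0) (hstab : β * ((1 + ((q : ℝ) - 1) * z) * (1 - z)) < q) (i : Fin q) :
    IsLocalMinOn (freeEnergy β) (stdSimplex ℝ (Fin q)) (orderedPt q z i) := by
  have hq2 : (2 : ℝ) ≤ q := by exact_mod_cast hq
  have hq0 : (0 : ℝ) < q := by linarith
  have h1 := one_add_mul_pos hq hz.le
  have h2 : 0 < 1 - z := by linarith
  set a := (1 + ((q : ℝ) - 1) * z) / q with ha
  set b := (1 - z) / q with hb
  have ha0 : 0 < a := div_pos h1 hq0
  have hb0 : 0 < b := div_pos h2 hq0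
  have hab : a + ((q : ℝ) - 1) * b = 1 := by rw [ha, hb]; field_simp; ring
  have hstab' : β * q * (a * b) < 1 := by
    have : β * q * (a * b) = β * ((1 + ((q : ℝ) - 1) * z) * (1 - z)) / q := by
      rw [ha, hb]; field_simp
    rw [this, div_lt_one hq0]; exact hstab
  have hqa : 1 < q * a := by
    have : (q : ℝ) * a = 1 + ((q : ℝ) - 1) * z := by rw [ha]; field_simp
    rw [this]; nlinarith
  have hβb : 0 < 1 / b - β := by
    rw [sub_pos, lt_div_iff₀ hb0]
    have : β * b < β * b * (q * a) := lt_mul_of_one_lt_right (by positivity) hqa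
    nlinarith
  -- The curvature in the large coordinate may be negative. For variations of total mass zero,
  -- Cauchy-Schwarz bounds the square of that coordinate by `q - 1` times the sum of the other
  -- squares; the sign of the form then rests on `Δ`, which the stability condition makes positive.
  set Δ := (1 / a - β) * (q - 1) + (1 / b - β) with hΔ_def
  have hΔ : 0 < Δ := by
    have : Δ = (1 - β * q * (a * b)) / (a * b) := by
      rw [hΔ_def]; field_simp; linear_combination hab
    rw [this]
    exact div_pos (by linarith) (by positivity)
  -- A loss of curvature small enough to keep the form nonnegative; it makes the inequalities
  -- required of the curvatures strict.
  set θ := min ((1 / b - β) / 2) (Δ / (2 * q)) with hθ_def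
  have hθ : 0 < θ := lt_min (by linarith) (by positivity)
  have hθ1 : θ ≤ (1 / b - β) / 2 := min_le_left _ _
  have hθ2 : q * θ ≤ Δ := by
    have : θ ≤ Δ / (2 * q) := min_le_right _ _
    rw [le_div_iff₀ (by positivity)] at this
    nlinarith
  refine isLocalMinOn_of_quadratic hβ (orderedPt_mem hq hz.le hz1.le i).2 (fun k => ?_)
    (l := Real.log a + 1 - β * a) (fun k => ?_)
    (fun k => if k = i then 1 / a - β - θ else 1 / b - β - θ) (fun k => ?_) (fun v hv => ?_)
  · unfold orderedPt; split_ifs; exacts [ha0, hb0]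
  · unfold orderedPt
    split_ifs
    · rfl
    · rw [ha, Real.log_div h1.ne' hq0.ne', Real.log_div h2.ne' hq0.ne']
      have : β * ((1 + ((q : ℝ) - 1) * z) / q) = β * ((1 - z) / q) + β * z := by field_simp; ring
      rw [this]
      unfold gap at hgap
      linarith
  · unfold orderedPt
    split_ifs
    · rw [← ha]; linarith
    · rw [← hb]; linarith
  · rw [← Finset.add_sum_erase _ _ (Finset.mem_univ i), if_pos rfl,
      Finset.sum_congr rfl fun k hk => show _ = (1 / b - β - θ) * v k ^ 2 by
        rw [if_neg (Finset.ne_of_mem_erase hk)], ← Finset.mul_sum]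
    have hcs := sq_sum_le_card_mul_sum_sq (s := Finset.univ.erase i) (f := v)
    have hsum : ∑ k ∈ Finset.univ.erase i, v k = - v i := by
      rw [← Finset.add_sum_erase _ _ (Finset.mem_univ i)] at hv; linarith
    rw [hsum, Finset.card_erase_of_mem (Finset.mem_univ i), Finset.card_univ, Fintype.card_fin,
      Nat.cast_sub (by omega), Nat.cast_one, neg_sq] at hcs
    set T := ∑ k ∈ Finset.univ.erase i, v k ^ 2
    have hcb : 0 ≤ 1 / b - β - θ := by linarith
    have h3 : (1 / b - β - θ) * v i ^ 2 ≤ (1 / b - β - θ) * (((q : ℝ) - 1) * T) :=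
      mul_le_mul_of_nonneg_left hcs hcb
    have h4 : 0 ≤ ((1 / a - β - θ) * (q - 1) + (1 / b - β - θ)) * v i ^ 2 := by
      refine mul_nonneg ?_ (sq_nonneg _)
      have : (1 / a - β - θ) * (q - 1) + (1 / b - β - θ) = Δ - q * θ := by rw [hΔ_def]; ring
      rw [this]; linarith
    have h5 : 0 ≤ ((q : ℝ) - 1) * ((1 / a - β - θ) * v i ^ 2 + (1 / b - β - θ) * T) := by
      linarith
    exact nonneg_of_mul_nonneg_right h5 (by linarith)

/-- Raising the inverse temperature makes `gap` negative at `s`, while it is positive near one; so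
it crosses zero upwards at some `z`. The mean value theorem on both sides of `s`, with concavity of
`(1 + (q-1)u)(1-u)`, makes the crossing strictly transversal, which is the stability condition. -/
lemma exists_gap_eq_zero (hq : 2 ≤ q) {β' s : ℝ} (hβ' : 0 < β') (hββ' : β' < β) (hs : 0 < s)
    (hs1 : s < 1) (hgap : gap q β' s = 0) :
    ∃ z, 0 < z ∧ z < 1 ∧ gap q β z = 0 ∧ β * ((1 + ((q : ℝ) - 1) * z) * (1 - z)) < q := by
  have hq2 : (2 : ℝ) ≤ q := by exact_mod_cast hq
  have hβ : 0 < β := hβ'.trans hββ'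
  have hneg : gap q β s < 0 := by
    have : gap q β s = gap q β' s - (β - β') * s := by unfold gap; ring
    rw [this, hgap]
    nlinarith
  -- From here on `-log (1 - u)` is at least `β + 1`, which beats the linear term `β u`.
  set r := 1 - Real.exp (-β - 1) with hr
  have hexp := Real.exp_pos (-β - 1)
  have hr1 : r < 1 := by linarith
  have hexp1 : Real.exp (-β - 1) < 1 := by
    have h := Real.exp_lt_exp.mpr (by linarith : -β - 1 < 0)
    rwa [Real.exp_zero] at h
  have hr0 : 0 < r := by linarith
  have hpos : ∀ u, r ≤ u → u < 1 → 0 < gap q β u := by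
    intro u hu hu1
    have h1 : 0 ≤ Real.log (1 + ((q : ℝ) - 1) * u) := Real.log_nonneg (by nlinarith)
    have h2 : Real.log (1 - u) ≤ -β - 1 := by
      rw [← Real.log_exp (-β - 1)]
      exact Real.log_le_log (by linarith) (by linarith)
    unfold gap
    nlinarith
  have hsr : s < r := by
    by_contra! h
    linarith [hpos s h hs1]
  obtain ⟨z, hz, hz0⟩ := intermediate_value_Ioo hsr.le (continuousOn_gap (β := β) hq hs.le hr1)
    ⟨hneg, hpos r le_rfl hr1⟩
  have hz1 : z < 1 := hz.2.trans hr1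
  have hz' : 0 < z := hs.trans hz.1
  refine ⟨z, hz', hz1, hz0, ?_⟩
  obtain ⟨p, hp, hp'⟩ := exists_deriv_eq_slope (gap q β) hs
    (continuousOn_gap (β := β) hq le_rfl hs1)
    (fun u hu => (hasDerivAt_gap hq hu.1.le
      (hu.2.trans hs1)).differentiableAt.differentiableWithinAt)
  obtain ⟨t, ht, ht'⟩ := exists_deriv_eq_slope (gap q β) hz.1
    (continuousOn_gap (β := β) hq hs.le hz1)
    (fun u hu => (hasDerivAt_gap hq (hs.trans hu.1).le
      (hu.2.trans hz1)).differentiableAt.differentiableWithinAt)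
  have ht0 : 0 < t := hs.trans ht.1
  have ht1 : t < 1 := ht.2.trans hz1
  have hp1 : p < 1 := hp.2.trans hs1
  rw [(hasDerivAt_gap hq hp.1.le hp1).deriv, gap_zero] at hp'
  rw [(hasDerivAt_gap hq ht0.le ht1).deriv, hz0] at ht'
  have e1 : (q : ℝ) / ((1 + ((q : ℝ) - 1) * p) * (1 - p)) - β < 0 := by
    rw [hp']; exact div_neg_of_neg_of_pos (by linarith) (by linarith)
  have e2 : 0 < (q : ℝ) / ((1 + ((q : ℝ) - 1) * t) * (1 - t)) - β := by
    rw [ht']; exact div_pos (by linarith) (by linarith [ht.1, ht.2])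
  rw [sub_neg, div_lt_iff₀ (mul_pos (one_add_mul_pos hq hp.1.le) (by linarith))] at e1
  rw [sub_pos, lt_div_iff₀ (mul_pos (one_add_mul_pos hq ht0.le) (by linarith))] at e2
  have hpt : p < t := hp.2.trans ht.1
  -- Concavity of the quadratic at `p < t < z`: it exceeds `q / β` at `p` and is below at `t`, hence
  -- also below at `z`.
  have hconc : (t - p) * ((1 + ((q : ℝ) - 1) * z) * (1 - z)) ≤
      (z - p) * ((1 + ((q : ℝ) - 1) * t) * (1 - t)) -
        (z - t) * ((1 + ((q : ℝ) - 1) * p) * (1 - p)) := by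
    have : 0 ≤ ((q : ℝ) - 1) * ((t - p) * (z - p) * (z - t)) := by
      have h1 : 0 ≤ (q : ℝ) - 1 := by linarith
      have h2 : 0 ≤ t - p := by linarith
      have h3 : 0 ≤ z - p := by linarith [ht.2]
      have h4 : 0 ≤ z - t := by linarith [ht.2]
      positivity
    nlinarith
  have h3 : 0 < z - t := by linarith [ht.2]
  have h4 : 0 < t - p := by linarith
  have h5 := mul_le_mul_of_nonneg_left hconc hβ.le
  have h6 := mul_lt_mul_of_pos_left e1 h3
  have h7 := mul_lt_mul_of_pos_left e2 (by linarith : 0 < z - p)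
  refine lt_of_mul_lt_mul_left (a := t - p) ?_ h4.le
  linarith

end OrderParameter

end Potts

end

noncomputable section

namespace Potts

/-! ### The three regimes as pairs of wells -/

section Wells

variable {q : ℕ} {β : ℝ}

/-- The part of the structure of the free energy landscape that is used for transitions from the
minima with index in `IA` to the minima with index in `IB`. -/
structure IsWellPair (q : ℕ) (β : ℝ) (IA IB : Set (Option (Fin q))) : Prop where
  mem : ∀ i, minPt q β i ∈ stdSimplex ℝ (Fin q)
  eq_minPt : ∀ x ∈ stdSimplex ℝ (Fin q),
    IsLocalMinOn (freeEnergy β) (stdSimplex ℝ (Fin q)) x → ∃ i, x = minPt q β i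
  isLocalMinOn : ∀ i ∈ IA, IsLocalMinOn (freeEnergy β) (stdSimplex ℝ (Fin q)) (minPt q β i)
  same : ∀ i ∈ IA, ∀ j ∈ IA, freeEnergy β (minPt q β i) = freeEnergy β (minPt q β j)
  ne : ∀ i ∈ IA, ∀ j ∈ IB, minPt q β i ≠ minPt q β j
  deeper : ∀ i ∈ IA, ∀ j, j ∉ IA → j ∉ IB →
    freeEnergy β (minPt q β i) < freeEnergy β (minPt q β j)
  nonempty_left : IA.Nonempty
  nonempty_right : IB.Nonempty

lemma uniformPt_mem (hq : 2 ≤ q) : uniformPt q ∈ stdSimplex ℝ (Fin q) := by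
  have hq0 : (0 : ℝ) < q := by positivity
  refine ⟨fun _ => by unfold uniformPt; positivity, ?_⟩
  simp [uniformPt, hq0.ne']

lemma minPt_mem (hq : 2 ≤ q) (h0 : 0 < orderParam q β) (h1 : orderParam q β < 1)
    (i : Option (Fin q)) : minPt q β i ∈ stdSimplex ℝ (Fin q) := by
  cases i with
  | none => exact uniformPt_mem hq
  | some i => exact orderedPt_mem hq h0.le h1.le i

lemma minPt_some_apply_self (i : Fin q) :
    minPt q β (some i) i = (1 + ((q : ℝ) - 1) * orderParam q β) / q := by simp [minPt]

lemma minPt_some_apply_of_ne {i k : Fin q} (h : k ≠ i) :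
    minPt q β (some i) k = (1 - orderParam q β) / q := by simp [minPt, h]

lemma minPt_injective (hq : 2 ≤ q) (h0 : 0 < orderParam q β) :
    Function.Injective (minPt q β) := by
  have hq2 : (2 : ℝ) ≤ q := by exact_mod_cast hq
  have hq0 : (0 : ℝ) < q := by linarith
  have key : ∀ i : Fin q, minPt q β none ≠ minPt q β (some i) := by
    intro i h
    have h1 := congrFun h i
    rw [minPt_some_apply_self] at h1
    simp only [minPt, uniformPt] at h1
    rw [div_left_inj' hq0.ne'] at h1
    nlinarith
  rintro (_ | i) (_ | j) h
  · rfl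
  · exact absurd h (key j)
  · exact absurd h.symm (key i)
  · by_contra hij
    have hij' : i ≠ j := fun h' => hij (by rw [h'])
    have h1 := congrFun h i
    rw [minPt_some_apply_self, minPt_some_apply_of_ne hij', div_left_inj' hq0.ne'] at h1
    nlinarith

lemma freeEnergy_minPt_some (hβ : 0 < β) (i j : Fin q) :
    freeEnergy β (minPt q β (some i)) = freeEnergy β (minPt q β (some j)) := by
  have h : ∀ k : Fin q, ∑ l, bulk β (minPt q β (some k) l) =
      bulk β ((1 + ((q : ℝ) - 1) * orderParam q β) / q) +
        ((q : ℝ) - 1) * bulk β ((1 - orderParam q β) / q) := fun k =>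
    sum_orderedPt (orderParam q β) k (bulk β)
  exact le_antisymm ((freeEnergy_le_iff hβ _ _).mpr (by rw [h i, h j]))
    ((freeEnergy_le_iff hβ _ _).mpr (by rw [h i, h j]))

lemma exists_eq_minPt (hq : 2 ≤ q) (hβ : 0 < β) {x : Fin q → ℝ}
    (hx : x ∈ stdSimplex ℝ (Fin q))
    (hmin : IsLocalMinOn (freeEnergy β) (stdSimplex ℝ (Fin q)) x) : ∃ i, x = minPt q β i := by
  rcases eq_minPt_of_isLocalMinOn hq hβ hx hmin with h | ⟨_, _, _, i, h⟩
  · exact ⟨none, h⟩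
  · exact ⟨some i, h⟩

/-- Below a global minimum different from the uniform point all ordered points are global minima. -/
lemma ordered_of_not_isMinOn (hq : 2 ≤ q) (hβ : 0 < β)
    (h : ¬ IsMinOn (freeEnergy β) (stdSimplex ℝ (Fin q)) (uniformPt q)) :
    0 < orderParam q β ∧ orderParam q β < 1 ∧ gap q β (orderParam q β) = 0 ∧
      ∀ i, IsMinOn (freeEnergy β) (stdSimplex ℝ (Fin q)) (minPt q β (some i)) ∧
        freeEnergy β (minPt q β (some i)) < freeEnergy β (minPt q β none) := by
  obtain ⟨x, hx, hmin⟩ := (isCompact_stdSimplex ℝ (Fin q)).exists_isMinOn ⟨_, uniformPt_mem hq⟩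
    (continuous_freeEnergy β).continuousOn
  rcases eq_minPt_of_isLocalMinOn hq hβ hx hmin.localize with h1 | ⟨h0, h1, h2, i, hi⟩
  · rw [h1] at hmin
    exact absurd hmin h
  · refine ⟨h0, h1, h2, fun j => ?_⟩
    rw [hi] at hmin
    have hmin' : IsMinOn (freeEnergy β) (stdSimplex ℝ (Fin q)) (minPt q β (some j)) := by
      intro y hy
      rw [Set.mem_ofPred_eq, freeEnergy_minPt_some hβ j i]
      exact hmin hy
    refine ⟨hmin', ?_⟩
    by_contra! hcon
    exact h fun y hy => hcon.trans (hmin' hy)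

lemma sum_sq_uniformPt_le (hq : 2 ≤ q) {x : Fin q → ℝ} (hx : x ∈ stdSimplex ℝ (Fin q)) :
    ∑ i, uniformPt q i ^ 2 ≤ ∑ i, x i ^ 2 := by
  have hq0 : (0 : ℝ) < q := by positivity
  have h := sq_sum_le_card_mul_sum_sq (s := (Finset.univ : Finset (Fin q))) (f := x)
  rw [hx.2, Finset.card_univ, Fintype.card_fin] at h
  have : ∑ i, uniformPt q i ^ 2 = 1 / q := by
    simp [uniformPt]; field_simp
  rw [this, div_le_iff₀ hq0]
  linarith

lemma sum_bulk_eq (β β' : ℝ) (x : Fin q → ℝ) :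
    ∑ i, bulk β (x i) = ∑ i, bulk β' (x i) - (β - β') / 2 * ∑ i, x i ^ 2 := by
  simp only [bulk, Finset.sum_sub_distrib, ← Finset.mul_sum]
  ring

/-- Raising `β` subtracts a multiple of the sum of squares, which is smallest at the uniform point;
a competitor that beats the uniform point keeps doing so. -/
lemma not_isMinOn_uniformPt_of_lt (hq : 2 ≤ q) {β' : ℝ} (hβ' : 0 < β') (hββ' : β' < β)
    (h : ¬ IsMinOn (freeEnergy β') (stdSimplex ℝ (Fin q)) (uniformPt q)) :
    ¬ IsMinOn (freeEnergy β) (stdSimplex ℝ (Fin q)) (uniformPt q) := by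
  intro hmin
  refine h fun x hx => ?_
  have h1 := (freeEnergy_le_iff (hβ'.trans hββ') _ _).mp (hmin hx)
  have h2 := sum_sq_uniformPt_le hq hx
  refine (freeEnergy_le_iff hβ' _ _).mpr ?_
  rw [sum_bulk_eq β β', sum_bulk_eq β β'] at h1
  nlinarith

/-- At `β = 8 log q` a corner of the simplex has energy sum `-4 log q`, while the uniform point has
at least `-3 log q`. Non-emptiness is needed because the infimum of the empty set of reals is zero
by convention. -/
lemma exists_not_isMinOn_uniformPt (hq : 2 ≤ q) :
    ∃ β, 0 < β ∧ ¬ IsMinOn (freeEnergy β) (stdSimplex ℝ (Fin q)) (uniformPt q) := by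
  have hq2 : (2 : ℝ) ≤ q := by exact_mod_cast hq
  have hq0 : (0 : ℝ) < q := by linarith
  have hlog : 0 < Real.log q := Real.log_pos (by linarith)
  refine ⟨8 * Real.log q, by positivity, fun hmin => ?_⟩
  have i : Fin q := ⟨0, by omega⟩
  have h := (freeEnergy_le_iff (by positivity) _ _).mp
    (hmin (orderedPt_mem hq zero_le_one le_rfl i))
  rw [sum_orderedPt] at h
  simp only [bulk, uniformPt] at h
  rw [show (1 + ((q : ℝ) - 1) * 1) / q = 1 by field_simp; ring] at h
  simp only [sub_self, zero_div, Real.log_one, one_div, Real.log_inv, Finset.sum_const,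
    Finset.card_univ, Fintype.card_fin, nsmul_eq_mul] at h
  have e : (q : ℝ) * ((q : ℝ)⁻¹ * -Real.log q - 8 * Real.log q / 2 * (q : ℝ)⁻¹ ^ 2) =
      -Real.log q - 4 * Real.log q * (q : ℝ)⁻¹ := by field_simp; ring
  rw [e] at h
  have hinv : (q : ℝ)⁻¹ ≤ 1 / 2 := by
    rw [inv_le_comm₀ hq0 (by norm_num)]; linarith
  nlinarith

lemma beta2_set_nonempty (hq : 2 ≤ q) :
    {β : ℝ | 0 < β ∧ ¬ IsMinOn (freeEnergy β) (stdSimplex ℝ (Fin q)) (uniformPt q)}.Nonempty :=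
  exists_not_isMinOn_uniformPt hq

lemma not_isMinOn_of_beta2_lt (hq : 2 ≤ q) (h : beta2 q < β) :
    0 < β ∧ ¬ IsMinOn (freeEnergy β) (stdSimplex ℝ (Fin q)) (uniformPt q) := by
  obtain ⟨β', ⟨hβ', hmin⟩, hlt⟩ := exists_lt_of_csInf_lt (beta2_set_nonempty hq) h
  exact ⟨hβ'.trans hlt, not_isMinOn_uniformPt_of_lt hq hβ' hlt hmin⟩

/-- The infimum provides a smaller inverse temperature with an ordered local minimum. Only its zero
of `gap` is carried over to `β`, where a stable zero follows and is then identified with the largest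
one. -/
lemma ordered_of_beta1_lt (hq : 2 ≤ q) (h : beta1 q < β) :
    0 < β ∧ 0 < orderParam q β ∧ orderParam q β < 1 ∧
      ∀ i, IsLocalMinOn (freeEnergy β) (stdSimplex ℝ (Fin q)) (minPt q β (some i)) := by
  have i₀ : Fin q := ⟨0, by omega⟩
  have hne : {β : ℝ | 0 < β ∧ ∃ x ∈ stdSimplex ℝ (Fin q), x ≠ uniformPt q ∧
      IsLocalMinOn (freeEnergy β) (stdSimplex ℝ (Fin q)) x}.Nonempty := by
    obtain ⟨β', hβ', hmin⟩ := exists_not_isMinOn_uniformPt hq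
    obtain ⟨h0, h1, _, h2⟩ := ordered_of_not_isMinOn hq hβ' hmin
    exact ⟨β', hβ', minPt q β' (some i₀), minPt_mem hq h0 h1 _,
      fun h => by simpa using minPt_injective hq h0 (a₂ := none) h, (h2 i₀).1.localize⟩
  obtain ⟨β', ⟨hβ', x, hx, hxu, hmin⟩, hlt⟩ := exists_lt_of_csInf_lt hne h
  have hβ := hβ'.trans hlt
  rcases eq_minPt_of_isLocalMinOn hq hβ' hx hmin with h1 | ⟨h0, h1, h2, _, _⟩
  · exact absurd h1 hxu
  · obtain ⟨z, hz, hz1, hgap, hstab⟩ := exists_gap_eq_zero hq hβ' hlt h0 h1 h2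
    have hloc := isLocalMinOn_orderedPt hq hβ hz hz1 hgap hstab
    have hz' := orderParam_eq_of_isLocalMinOn hq hβ hz hz1 hgap (hloc i₀)
    refine ⟨hβ, by rw [hz']; exact hz, by rw [hz']; exact hz1, fun i => ?_⟩
    have := hloc i
    rw [← hz'] at this
    exact this

/-- Each regime describes transitions between wells. -/
theorem IsRegime.exists_isWellPair (hq : 2 ≤ q) {m : ℕ → Option (Fin q) → Fin q → ℝ}
    {A B : (N : ℕ) → Set (Config q N)} (h : IsRegime β m A B) :
    0 < β ∧ ∃ IA IB : Set (Option (Fin q)), IsWellPair q β IA IB ∧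
      ∀ N, A N = (⋃ i ∈ IA, level N (m N i)) ∧ B N = ⋃ i ∈ IB, level N (m N i) := by
  have i₀ : Fin q := ⟨0, by omega⟩
  rcases h with ⟨h1, -, hAB⟩ | ⟨h2, hβq, hAB⟩ | ⟨h2, k, hAB⟩
  · obtain ⟨hβ, h0, h1, hloc⟩ := ordered_of_beta1_lt hq h1
    refine ⟨hβ, Set.range some, {none}, ?_, fun N => ?_⟩
    · refine ⟨minPt_mem hq h0 h1, fun x hx hm => exists_eq_minPt hq hβ hx hm, ?_, ?_, ?_, ?_,
        ⟨some i₀, i₀, rfl⟩, ⟨none, rfl⟩⟩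
      · rintro _ ⟨i, rfl⟩; exact hloc i
      · rintro _ ⟨i, rfl⟩ _ ⟨j, rfl⟩; exact freeEnergy_minPt_some hβ i j
      · rintro _ ⟨i, rfl⟩ j hj h
        rw [Set.mem_singleton_iff.mp hj] at h
        simpa using minPt_injective hq h0 h
      · rintro _ - (_ | j) h3 h4
        · exact absurd rfl h4
        · exact absurd ⟨j, rfl⟩ h3
    · rw [(hAB N).1, (hAB N).2]
      simp
  · obtain ⟨hβ, hmin⟩ := not_isMinOn_of_beta2_lt hq h2
    obtain ⟨h0, h1, _, hglob⟩ := ordered_of_not_isMinOn hq hβ hmin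
    refine ⟨hβ, {none}, Set.range some, ?_, fun N => ?_⟩
    · refine ⟨minPt_mem hq h0 h1, fun x hx hm => exists_eq_minPt hq hβ hx hm, ?_, ?_, ?_, ?_,
        ⟨none, rfl⟩, ⟨some i₀, i₀, rfl⟩⟩
      · rintro _ rfl; exact isLocalMinOn_uniformPt hq hβ hβq
      · rintro _ rfl _ rfl; rfl
      · rintro _ rfl _ ⟨j, rfl⟩ h
        simpa using minPt_injective hq h0 h
      · rintro _ - (_ | j) h3 h4
        · exact absurd rfl h3
        · exact absurd ⟨j, rfl⟩ h4
    · rw [(hAB N).1, (hAB N).2]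
      simp
  · obtain ⟨hβ, hmin⟩ := not_isMinOn_of_beta2_lt hq h2
    obtain ⟨h0, h1, _, hglob⟩ := ordered_of_not_isMinOn hq hβ hmin
    refine ⟨hβ, {some k}, some '' {i | i ≠ k}, ?_, fun N => ?_⟩
    · refine ⟨minPt_mem hq h0 h1, fun x hx hm => exists_eq_minPt hq hβ hx hm, ?_, ?_, ?_, ?_,
        ⟨some k, rfl⟩, ?_⟩
      · rintro _ rfl; exact (hglob k).1.localize
      · rintro _ rfl _ rfl; rfl
      · rintro _ rfl _ ⟨j, hj, rfl⟩ h
        exact hj (Option.some_injective _ (minPt_injective hq h0 h)).symm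
      -- Only in the tunnelling regime is a minimum left outside both index sets, namely the uniform
      -- point, and it is strictly higher there.
      · rintro _ rfl (_ | j) h3 h4
        · exact (hglob k).2
        · exact absurd ⟨j, fun h => h3 (by rw [h]; rfl), rfl⟩ h4
      · have : Nontrivial (Fin q) := Fin.nontrivial_iff_two_le.mpr hq
        obtain ⟨j, hj⟩ := exists_ne k
        exact ⟨some j, j, hj, rfl⟩
    · rw [(hAB N).1, (hAB N).2]
      simp

end Wells

end Potts

end

noncomputable section

namespace Potts

/-! ### Colour counts and the mean-field weight of a level -/

section Counts

variable {q N : ℕ}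

/-- Number of spins of each colour. -/
def count (σ : Config q N) (k : Fin q) : ℕ := (Finset.univ.filter fun i => σ i = k).card

/-- Configurations with given colour counts. -/
def fiber (N : ℕ) (n : Fin q → ℕ) : Finset (Config q N) := Finset.univ.filter fun σ => count σ = n

/-- Colour frequencies of given colour counts. -/
def freq (N : ℕ) (n : Fin q → ℕ) : Fin q → ℝ := fun k => n k / N

lemma mem_fiber {σ : Config q N} {n : Fin q → ℕ} : σ ∈ fiber N n ↔ count σ = n := by
  simp [fiber]

lemma empirical_eq (σ : Config q N) : empirical σ = freq N (count σ) := by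
  ext k
  simp [empirical, freq, count, div_eq_inv_mul]

lemma sum_count (σ : Config q N) : ∑ k, count σ k = N := by
  have := Finset.card_eq_sum_card_fiberwise (s := (Finset.univ : Finset (Fin N)))
    (t := (Finset.univ : Finset (Fin q))) (f := σ) (fun _ _ => Finset.mem_univ _)
  simpa [count] using this.symm

lemma count_mem_piAntidiag (σ : Config q N) : count σ ∈ Finset.piAntidiag Finset.univ N := by
  simp [sum_count]

lemma sum_eq_sum_fiber {M : Type*} [AddCommMonoid M] (f : Config q N → M) :
    ∑ σ, f σ = ∑ n ∈ Finset.piAntidiag Finset.univ N, ∑ σ ∈ fiber N n, f σ :=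
  (Finset.sum_fiberwise_of_maps_to (fun σ _ => count_mem_piAntidiag σ) f).symm

lemma card_piAntidiag_le (q N : ℕ) :
    (Finset.piAntidiag (Finset.univ : Finset (Fin q)) N).card ≤ (N + 1) ^ q := by
  have hsub : Finset.piAntidiag (Finset.univ : Finset (Fin q)) N ⊆
      Fintype.piFinset fun _ => Finset.range (N + 1) := by
    intro n hn
    have hn' := (Finset.mem_piAntidiag.mp hn).1
    simp only [Fintype.mem_piFinset, Finset.mem_range]
    intro k
    have := Finset.single_le_sum (f := n) (fun _ _ => Nat.zero_le _) (Finset.mem_univ k)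
    have h' : ∑ k, n k = N := hn'
    omega
  refine (Finset.card_le_card hsub).trans ?_
  simp

/-- Move one unit from `a` to `b`. -/
def move (n : Fin q → ℕ) (a b : Fin q) : Fin q → ℕ :=
  fun k => if k = a then n a - 1 else if k = b then n b + 1 else n k

lemma move_left (n : Fin q → ℕ) (a b : Fin q) : move n a b a = n a - 1 := by simp [move]

lemma move_right (n : Fin q → ℕ) {a b : Fin q} (hab : a ≠ b) : move n a b b = n b + 1 := by
  simp [move, hab.symm]

lemma move_of_ne (n : Fin q → ℕ) {a b k : Fin q} (ha : k ≠ a) (hb : k ≠ b) :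
    move n a b k = n k := by simp [move, ha, hb]

lemma prod_move {M : Type*} [CommMonoid M] (n : Fin q → ℕ) {a b : Fin q} (hab : a ≠ b)
    (f : Fin q → ℕ → M) :
    ∏ k, f k (move n a b k) =
      f a (n a - 1) * f b (n b + 1) * ∏ k ∈ (Finset.univ.erase a).erase b, f k (n k) := by
  have hb : b ∈ Finset.univ.erase a := by simp [hab.symm]
  rw [← Finset.mul_prod_erase _ _ (Finset.mem_univ a), ← Finset.mul_prod_erase _ _ hb,
    move_left, move_right n hab, mul_assoc]
  congr 2
  refine Finset.prod_congr rfl fun k hk => ?_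
  simp only [Finset.mem_erase] at hk
  rw [move_of_ne n hk.2.1 hk.1]

lemma prod_split {M : Type*} [CommMonoid M] (n : Fin q → ℕ) {a b : Fin q} (hab : a ≠ b)
    (f : Fin q → ℕ → M) :
    ∏ k, f k (n k) =
      f a (n a) * f b (n b) * ∏ k ∈ (Finset.univ.erase a).erase b, f k (n k) := by
  have hb : b ∈ Finset.univ.erase a := by simp [hab.symm]
  rw [← Finset.mul_prod_erase _ _ (Finset.mem_univ a), ← Finset.mul_prod_erase _ _ hb, mul_assoc]

lemma sum_move (n : Fin q → ℕ) {a b : Fin q} (hab : a ≠ b) (ha : 0 < n a) :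
    ∑ k, move n a b k = ∑ k, n k := by
  -- Read in the multiplicative copy of `ℕ`, the product formulas become formulas for sums.
  have h1 := prod_move (M := Multiplicative ℕ) n hab fun _ k => Multiplicative.ofAdd k
  have h2 := prod_split (M := Multiplicative ℕ) n hab fun _ k => Multiplicative.ofAdd k
  have h1' : ∑ k, move n a b k = (n a - 1) + (n b + 1) +
    ∑ k ∈ (Finset.univ.erase a).erase b, n k := h1
  have h2' : ∑ k, n k = n a + n b + ∑ k ∈ (Finset.univ.erase a).erase b, n k := h2
  omega

/-- Any two vectors of counts with the same sum are connected by elementary moves, which move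
every coordinate monotonically. -/
theorem count_induction {m : Fin q → ℕ} {P : (Fin q → ℕ) → Prop} (base : P m)
    (step : ∀ n a b, ∑ k, n k = ∑ k, m k → a ≠ b → m a < n a → n b < m b →
      P (move n a b) → P n)
    (n : Fin q → ℕ) (hn : ∑ k, n k = ∑ k, m k) : P n := by
  induction hd : ∑ k, (n k - m k) using Nat.strong_induction_on generalizing n with
  | _ d ih =>
    by_cases hnm : n = m
    · rw [hnm]; exact base
    have hex : ∃ a, m a < n a := by
      by_contra! hcon
      refine hnm (funext fun k => ?_)
      exact (Finset.sum_eq_sum_iff_of_le fun k _ => hcon k).mp hn k (Finset.mem_univ k)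
    have hex' : ∃ b, n b < m b := by
      by_contra! hcon
      refine hnm (funext fun k => ?_)
      exact ((Finset.sum_eq_sum_iff_of_le fun k _ => hcon k).mp hn.symm k (Finset.mem_univ k)).symm
    obtain ⟨a, ha⟩ := hex
    obtain ⟨b, hb⟩ := hex'
    have hab : a ≠ b := fun h => by rw [h] at ha; omega
    refine step n a b hn hab ha hb (ih _ ?_ _ ?_ rfl)
    · rw [← hd]
      refine Finset.sum_lt_sum (fun k _ => ?_) ⟨a, Finset.mem_univ a, ?_⟩
      · by_cases h1 : k = a
        · rw [h1, move_left]; omega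
        by_cases h2 : k = b
        · rw [h2, move_right n hab]; omega
        · rw [move_of_ne n h1 h2]
      · rw [move_left]; omega
    · rw [sum_move n hab (by omega), hn]

lemma count_update {σ : Config q N} {i : Fin N} {a b : Fin q} (hi : σ i = a) (hab : a ≠ b) :
    count (Function.update σ i b) = move (count σ) a b := by
  ext k
  by_cases h1 : k = a
  · subst h1
    rw [move_left, count, count]
    have : (Finset.univ.filter fun j => Function.update σ i b j = k) =
        (Finset.univ.filter fun j => σ j = k).erase i := by
      ext j
      by_cases hj : j = i
      · subst hj; simp [hab.symm]
      · simp [hj]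
    rw [this, Finset.card_erase_of_mem (by simp [hi])]
  by_cases h2 : k = b
  · subst h2
    rw [move_right _ hab, count, count]
    have : (Finset.univ.filter fun j => Function.update σ i k j = k) =
        insert i (Finset.univ.filter fun j => σ j = k) := by
      ext j
      by_cases hj : j = i
      · subst hj; simp
      · simp [hj]
    rw [this, Finset.card_insert_of_notMem (by simp [hi, hab])]
  · rw [move_of_ne _ h1 h2, count, count]
    congr 1
    ext j
    by_cases hj : j = i
    · subst hj; simp [Ne.symm h2, hi, Ne.symm h1]
    · simp [hj]

/-- Pairs of a configuration with counts `n` and a site of colour `a`. -/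
def marked (N : ℕ) (n : Fin q → ℕ) (a : Fin q) : Finset (Config q N × Fin N) :=
  Finset.univ.filter fun p => count p.1 = n ∧ p.1 p.2 = a

lemma mem_marked {n : Fin q → ℕ} {a : Fin q} {p : Config q N × Fin N} :
    p ∈ marked N n a ↔ count p.1 = n ∧ p.1 p.2 = a := by simp [marked]

lemma sum_marked_fst (n : Fin q → ℕ) (a : Fin q) (f : Config q N → ℝ) :
    ∑ p ∈ marked N n a, f p.1 = n a * ∑ σ ∈ fiber N n, f σ := by
  have h : ∑ p ∈ marked N n a, f p.1 =
      ∑ σ ∈ fiber N n, ∑ i ∈ Finset.univ.filter (fun i => σ i = a), f σ := by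
    rw [Finset.sum_sigma' (fiber N n) (fun σ => Finset.univ.filter fun i => σ i = a)]
    refine Finset.sum_bij' (fun p _ => ⟨p.1, p.2⟩) (fun p _ => (p.1, p.2)) ?_ ?_ ?_ ?_ ?_
    · intro p hp
      simpa [mem_fiber] using mem_marked.mp hp
    · intro p hp
      simpa [mem_marked, mem_fiber] using hp
    · intro p _; rfl
    · intro p _; rfl
    · intro p _; rfl
  rw [h, Finset.mul_sum]
  refine Finset.sum_congr rfl fun σ hσ => ?_
  rw [Finset.sum_const, nsmul_eq_mul]
  congr 2
  rw [← mem_fiber.mp hσ]; rfl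

lemma move_move {n : Fin q → ℕ} {a b : Fin q} (hab : a ≠ b) (ha : 0 < n a) :
    move (move n a b) b a = n := by
  ext k
  by_cases h1 : k = b
  · rw [h1, move_left, move_right n hab]; omega
  by_cases h2 : k = a
  · rw [h2, move_right _ hab.symm, move_left]; omega
  · rw [move_of_ne _ h1 h2, move_of_ne _ h2 h1]

/-- Recolouring the marked site is a bijection between configurations with a marked site of colour
`a` and, on the neighbouring level, configurations with a marked site of colour `b`. This double
counting couples the two levels. -/
lemma sum_marked_update {n : Fin q → ℕ} {a b : Fin q} (hab : a ≠ b) (ha : 0 < n a)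
    (f : Config q N → ℝ) :
    ∑ p ∈ marked N n a, f (Function.update p.1 p.2 b) =
      (n b + 1) * ∑ σ ∈ fiber N (move n a b), f σ := by
  have h := sum_marked_fst (N := N) (move n a b) b f
  rw [move_right n hab] at h
  push_cast at h
  rw [← h]
  refine Finset.sum_bij' (fun p _ => (Function.update p.1 p.2 b, p.2))
    (fun p _ => (Function.update p.1 p.2 a, p.2)) ?_ ?_ ?_ ?_ ?_
  · intro p hp
    obtain ⟨h1, h2⟩ := mem_marked.mp hp
    rw [mem_marked]
    exact ⟨by rw [count_update h2 hab, h1], by simp⟩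
  · intro p hp
    obtain ⟨h1, h2⟩ := mem_marked.mp hp
    rw [mem_marked]
    exact ⟨by rw [count_update h2 hab.symm, h1, move_move hab ha], by simp⟩
  · intro p hp
    obtain ⟨h1, h2⟩ := mem_marked.mp hp
    ext <;> simp [← h2]
  · intro p hp
    obtain ⟨h1, h2⟩ := mem_marked.mp hp
    ext <;> simp [← h2]
  · intro p _; rfl

lemma card_fiber_move {n : Fin q → ℕ} {a b : Fin q} (hab : a ≠ b) (ha : 0 < n a) :
    (n a : ℝ) * (fiber N n).card = (n b + 1) * (fiber N (move n a b)).card := by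
  have h1 := sum_marked_fst (N := N) n a fun _ => 1
  have h2 := sum_marked_update (N := N) hab ha fun _ => 1
  simp only [Finset.sum_const, nsmul_eq_mul, mul_one] at h1 h2
  rw [← h1, ← h2]

lemma prod_eq_prod_pow_count (x : Fin q → ℝ) (σ : Config q N) :
    ∏ i, x (σ i) = ∏ k, x k ^ count σ k := by
  rw [← Finset.prod_fiberwise_of_maps_to (fun i (_ : i ∈ Finset.univ) => Finset.mem_univ (σ i))]
  refine Finset.prod_congr rfl fun k _ => ?_
  rw [Finset.prod_congr rfl fun i hi => show x (σ i) = x k by rw [(Finset.mem_filter.mp hi).2],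
    Finset.prod_const]
  rfl

/-- Total mass one of the multinomial law: the sites are coloured independently with probabilities
`x` and grouped by colour counts. -/
lemma sum_card_mul_prod_pow (x : Fin q → ℝ) (hx : ∑ k, x k = 1) :
    ∑ n ∈ Finset.piAntidiag Finset.univ N, ((fiber N n).card : ℝ) * ∏ k, x k ^ n k = 1 := by
  have h1 : ∑ σ : Config q N, ∏ i, x (σ i) = 1 := by
    have := Finset.sum_prod_piFinset (ι := Fin N) (Finset.univ : Finset (Fin q)) fun _ k => x k
    rw [Fintype.piFinset_univ] at this
    rw [this]
    simp [hx]
  rw [← h1, sum_eq_sum_fiber]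
  refine Finset.sum_congr rfl fun n _ => ?_
  rw [Finset.sum_congr rfl fun σ hσ => show ∏ i, x (σ i) = ∏ k, x k ^ n k by
    rw [prod_eq_prod_pow_count, mem_fiber.mp hσ], Finset.sum_const, nsmul_eq_mul]

lemma sum_freq (hN : N ≠ 0) {n : Fin q → ℕ} (hn : ∑ k, n k = N) : ∑ k, freq N n k = 1 := by
  simp only [freq, ← Finset.sum_div]
  rw [← Nat.cast_sum, hn, div_self (by exact_mod_cast hN)]

lemma freq_nonneg (n : Fin q → ℕ) (k : Fin q) : 0 ≤ freq N n k := by unfold freq; positivity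

lemma mem_piAntidiag_univ {n : Fin q → ℕ} :
    n ∈ Finset.piAntidiag Finset.univ N ↔ ∑ k, n k = N := by
  rw [Finset.mem_piAntidiag]
  exact ⟨fun h => h.1, fun h => ⟨h, fun _ _ => Finset.mem_univ _⟩⟩

lemma freq_mem (hN : N ≠ 0) {n : Fin q → ℕ} (hn : ∑ k, n k = N) :
    freq N n ∈ stdSimplex ℝ (Fin q) := ⟨freq_nonneg n, sum_freq hN hn⟩

lemma card_fiber_mul_le (hN : N ≠ 0) {n : Fin q → ℕ} (hn : ∑ k, n k = N) :
    ((fiber N n).card : ℝ) * ∏ k, freq N n k ^ n k ≤ 1 := by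
  rw [← sum_card_mul_prod_pow (N := N) (freq N n) (sum_freq hN hn)]
  exact Finset.single_le_sum (f := fun m => ((fiber N m).card : ℝ) * ∏ k, freq N n k ^ m k)
    (fun m _ => mul_nonneg (Nat.cast_nonneg _)
      (Finset.prod_nonneg fun k _ => pow_nonneg (freq_nonneg n k) _)) (mem_piAntidiag_univ.mpr hn)

/-- Under the multinomial law with frequencies `n / N` the vector `n` is a mode, since moving any
other vector towards it never lowers the probability. As there are at most `(N + 1) ^ q` vectors,
its probability is at least the inverse of that number. This replaces Stirling's formula. -/
lemma one_le_mul_card_fiber_mul (hN : N ≠ 0) {n : Fin q → ℕ} (hn : ∑ k, n k = N) :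
    1 ≤ ((N : ℝ) + 1) ^ q * (((fiber N n).card : ℝ) * ∏ k, freq N n k ^ n k) := by
  have hN0 : (0 : ℝ) < N := by positivity
  have hmax : ∀ m : Fin q → ℕ, ∑ k, m k = ∑ k, n k →
      ((fiber N m).card : ℝ) * ∏ k, freq N n k ^ m k ≤
        ((fiber N n).card : ℝ) * ∏ k, freq N n k ^ n k := by
    refine count_induction le_rfl ?_
    intro m a b hm hab ha hb ih
    refine le_trans ?_ ih
    rw [prod_move m hab fun k j => freq N n k ^ j, prod_split m hab fun k j => freq N n k ^ j]
    have hcard := card_fiber_move (N := N) (n := m) hab (by omega)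
    have hb0 : (0 : ℝ) < m b + 1 := by positivity
    set R := ∏ k ∈ (Finset.univ.erase a).erase b, freq N n k ^ m k
    have hR : 0 ≤ R := Finset.prod_nonneg fun k _ => pow_nonneg (freq_nonneg n k) _
    obtain ⟨j, hj⟩ : ∃ j, m a = j + 1 := ⟨m a - 1, by omega⟩
    have hcard' : ((fiber N (move m a b)).card : ℝ) = m a * (fiber N m).card / (m b + 1) := by
      rw [hcard]; field_simp
    rw [hcard', hj, Nat.add_sub_cancel, pow_succ (freq N n a), pow_succ (freq N n b)]
    -- The ratio of the probabilities of the moved vector and of `m` is `m_a x_b / ((m_b + 1) x_a)`,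
    -- at least one because `a` is over- and `b` under-represented in `m`.
    have hxa : freq N n a * (m b + 1) ≤ m a * freq N n b := by
      unfold freq
      rw [div_mul_eq_mul_div, ← mul_div_assoc]
      refine div_le_div_of_nonneg_right ?_ hN0.le
      have h1 : (n a : ℝ) ≤ m a := by exact_mod_cast ha.le
      have h2 : (m b : ℝ) + 1 ≤ n b := by exact_mod_cast hb
      exact mul_le_mul h1 h2 (by positivity) (by positivity)
    have hnn : 0 ≤ ((fiber N m).card : ℝ) * freq N n a ^ j * freq N n b ^ m b * R := by
      have := freq_nonneg (N := N) n
      exact mul_nonneg (mul_nonneg (mul_nonneg (Nat.cast_nonneg _) (pow_nonneg (this a) _))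
        (pow_nonneg (this b) _)) hR
    rw [← hj]
    calc _ = ((fiber N m).card : ℝ) * freq N n a ^ j * freq N n b ^ m b * R *
          (freq N n a * (m b + 1)) / (m b + 1) := by rw [eq_div_iff hb0.ne']; ring
      _ ≤ ((fiber N m).card : ℝ) * freq N n a ^ j * freq N n b ^ m b * R *
          (m a * freq N n b) / (m b + 1) :=
        div_le_div_of_nonneg_right (mul_le_mul_of_nonneg_left hxa hnn) hb0.le
      _ = _ := by ring
  calc (1 : ℝ) = _ := (sum_card_mul_prod_pow (N := N) (freq N n) (sum_freq hN hn)).symm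
    _ ≤ ∑ m ∈ Finset.piAntidiag (Finset.univ : Finset (Fin q)) N,
        ((fiber N n).card : ℝ) * ∏ k, freq N n k ^ n k :=
        Finset.sum_le_sum fun m hm => hmax m ((mem_piAntidiag_univ.mp hm).trans hn.symm)
    _ ≤ _ := by
        rw [Finset.sum_const, nsmul_eq_mul]
        refine mul_le_mul_of_nonneg_right ?_ (mul_nonneg (Nat.cast_nonneg _)
          (Finset.prod_nonneg fun k _ => pow_nonneg (freq_nonneg n k) _))
        exact_mod_cast card_piAntidiag_le q N

lemma prod_freq_pow (hN : N ≠ 0) (n : Fin q → ℕ) :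
    ∏ k, freq N n k ^ n k = Real.exp (N * ∑ k, freq N n k * Real.log (freq N n k)) := by
  have hN0 : (0 : ℝ) < N := by positivity
  rw [Finset.mul_sum, Real.exp_sum]
  refine Finset.prod_congr rfl fun k _ => ?_
  rcases Nat.eq_zero_or_pos (n k) with h | h
  · simp [freq, h]
  · have hp : 0 < freq N n k := by unfold freq; positivity
    rw [← mul_assoc, show (N : ℝ) * freq N n k = n k by unfold freq; field_simp,
      Real.exp_nat_mul, Real.exp_log hp]

/-- The sum of squared counts runs over all ordered pairs of sites; the `N` diagonal ones account
for the constant `1 / 2`. -/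
lemma hamiltonian_meanField (hN : N ≠ 0) (σ : Config q N) :
    hamiltonian meanField σ = -(N / 2) * ∑ k, freq N (count σ) k ^ 2 + 1 / 2 := by
  have hN0 : (0 : ℝ) < N := by positivity
  have hpairs : ∑ p : Fin N × Fin N, (if σ p.1 = σ p.2 then (1 : ℝ) else 0) =
      ∑ k, (count σ k : ℝ) ^ 2 := by
    have h1 : ∀ k, (count σ k : ℝ) = ∑ i, if σ i = k then (1 : ℝ) else 0 := fun k => by
      simp [count]
    simp only [h1, sq, Finset.sum_mul_sum]
    rw [Finset.sum_comm]
    simp only [Finset.sum_comm (s := (Finset.univ : Finset (Fin q)))]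
    rw [Fintype.sum_prod_type]
    refine Finset.sum_congr rfl fun i _ => Finset.sum_congr rfl fun j _ => ?_
    simp [eq_comm]
  have hsplit : ∑ p : Fin N × Fin N, (if σ p.1 = σ p.2 then (1 : ℝ) else 0) =
      2 * (∑ p : Fin N × Fin N with p.1 < p.2, if σ p.1 = σ p.2 then (1 : ℝ) else 0) + N := by
    have e1 : ∀ p : Fin N × Fin N, (if σ p.1 = σ p.2 then (1 : ℝ) else 0) =
        (if p.1 < p.2 then (if σ p.1 = σ p.2 then (1 : ℝ) else 0) else 0) +
        (if p.2 < p.1 then (if σ p.1 = σ p.2 then (1 : ℝ) else 0) else 0) +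
        (if p.1 = p.2 then (1 : ℝ) else 0) := by
      intro p
      rcases lt_trichotomy p.1 p.2 with h | h | h
      · simp [h, h.ne, h.not_gt]
      · simp [h]
      · simp [h, h.ne', h.not_gt]
    have e2 : ∑ p : Fin N × Fin N,
        (if p.2 < p.1 then (if σ p.1 = σ p.2 then (1 : ℝ) else 0) else 0) =
        ∑ p : Fin N × Fin N,
          (if p.1 < p.2 then (if σ p.1 = σ p.2 then (1 : ℝ) else 0) else 0) := by
      refine Fintype.sum_equiv (Equiv.prodComm _ _) _ _ fun p => ?_
      simp [eq_comm]
    have e3 : ∑ p : Fin N × Fin N, (if p.1 = p.2 then (1 : ℝ) else 0) = N := by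
      rw [Fintype.sum_prod_type]
      simp
    rw [Finset.sum_congr rfl fun p _ => e1 p, Finset.sum_add_distrib, Finset.sum_add_distrib,
      e2, e3, Finset.sum_filter]
    ring
  rw [hpairs] at hsplit
  have hfr : ∑ k, freq N (count σ) k ^ 2 = (∑ k, (count σ k : ℝ) ^ 2) / N ^ 2 := by
    simp only [freq, div_pow, Finset.sum_div]
  rw [hfr, hsplit, hamiltonian]
  simp only [meanField, one_mul]
  field_simp
  ring

/-- Mean-field weight of a level. -/
def levelWeight (β : ℝ) (N : ℕ) (n : Fin q → ℕ) : ℝ :=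
  ∑ σ ∈ fiber N n, weight β meanField σ

lemma weight_meanField (β : ℝ) (hN : N ≠ 0) {n : Fin q → ℕ} {σ : Config q N}
    (hσ : σ ∈ fiber N n) :
    weight β meanField σ = Real.exp (β * (N / 2 * ∑ k, freq N n k ^ 2) - β / 2) := by
  rw [weight, hamiltonian_meanField hN, mem_fiber.mp hσ]
  congr 1; ring

lemma levelWeight_eq {β : ℝ} (hβ : 0 < β) (hN : N ≠ 0) (n : Fin q → ℕ) :
    levelWeight β N n = Real.exp (-β / 2) *
      (((fiber N n).card : ℝ) * ∏ k, freq N n k ^ n k) *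
        Real.exp (-(N * β * freeEnergy β (freq N n))) := by
  rw [levelWeight, Finset.sum_congr rfl fun σ hσ => weight_meanField β hN hσ, Finset.sum_const,
    nsmul_eq_mul, prod_freq_pow hN]
  have h : Real.exp (β * (N / 2 * ∑ k, freq N n k ^ 2) - β / 2) = Real.exp (-β / 2) *
      Real.exp (N * ∑ k, freq N n k * Real.log (freq N n k)) *
        Real.exp (-(N * β * freeEnergy β (freq N n))) := by
    rw [← Real.exp_add, ← Real.exp_add]
    congr 1
    rw [freeEnergy]
    field_simp
    ring
  rw [h]; ring

lemma levelWeight_le {β : ℝ} (hβ : 0 < β) (hN : N ≠ 0) {n : Fin q → ℕ} (hn : ∑ k, n k = N) :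
    levelWeight β N n ≤ Real.exp (-(N * β * freeEnergy β (freq N n))) := by
  rw [levelWeight_eq hβ hN]
  refine mul_le_of_le_one_left (Real.exp_pos _).le ?_
  refine mul_le_one₀ (Real.exp_le_one_iff.mpr (by linarith)) (mul_nonneg (Nat.cast_nonneg _)
    (Finset.prod_nonneg fun k _ => pow_nonneg (freq_nonneg n k) _)) (card_fiber_mul_le hN hn)

lemma le_levelWeight {β : ℝ} (hβ : 0 < β) (hN : N ≠ 0) {n : Fin q → ℕ} (hn : ∑ k, n k = N) :
    Real.exp (-(N * β * freeEnergy β (freq N n))) ≤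
      Real.exp (β / 2) * ((N : ℝ) + 1) ^ q * levelWeight β N n := by
  rw [levelWeight_eq hβ hN]
  have h := one_le_mul_card_fiber_mul hN hn
  have he : Real.exp (β / 2) * Real.exp (-β / 2) = 1 := by
    rw [← Real.exp_add, ← Real.exp_zero]; congr 1; ring
  calc _ ≤ ((N : ℝ) + 1) ^ q * (((fiber N n).card : ℝ) * ∏ k, freq N n k ^ n k) *
        Real.exp (-(N * β * freeEnergy β (freq N n))) :=
        le_mul_of_one_le_left (Real.exp_pos _).le h
    _ = (Real.exp (β / 2) * Real.exp (-β / 2)) * (((N : ℝ) + 1) ^ q *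
          (((fiber N n).card : ℝ) * ∏ k, freq N n k ^ n k) *
        Real.exp (-(N * β * freeEnergy β (freq N n)))) := by rw [he, one_mul]
    _ = _ := by ring

lemma fiber_nonempty (hN : N ≠ 0) {n : Fin q → ℕ} (hn : ∑ k, n k = N) :
    (fiber N n).Nonempty := by
  rw [← Finset.card_pos]
  by_contra h
  have h0 : (fiber N n).card = 0 := by omega
  have := one_le_mul_card_fiber_mul hN hn
  rw [h0] at this
  norm_num at this

lemma levelWeight_pos {β : ℝ} (hN : N ≠ 0) {n : Fin q → ℕ} (hn : ∑ k, n k = N) :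
    0 < levelWeight β N n :=
  Finset.sum_pos (fun σ _ => weight_pos _ _ σ) (fiber_nonempty hN hn)

/-! ### Quadratic means on neighbouring levels -/

/-- Quadratic mean of a function over a level. -/
def quadMean (N : ℕ) (n : Fin q → ℕ) (f : Config q N → ℝ) : ℝ :=
  Real.sqrt ((∑ σ ∈ fiber N n, f σ ^ 2) / (fiber N n).card)

lemma sqrt_sum_sq_le {ι : Type*} (s : Finset ι) (u v : ι → ℝ) :
    Real.sqrt (∑ i ∈ s, u i ^ 2) ≤
      Real.sqrt (∑ i ∈ s, v i ^ 2) + Real.sqrt (∑ i ∈ s, (u i - v i) ^ 2) := by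
  have h := Real.Lp_add_le s v (fun i => u i - v i) (p := 2) (by norm_num)
  simp only [add_sub_cancel, Real.rpow_ofNat, sq_abs, ← Real.sqrt_eq_rpow] at h
  exact h

lemma hammingDist_update {σ : Config q N} {i : Fin N} {b : Fin q} (h : σ i ≠ b) :
    hammingDist σ (Function.update σ i b) = 1 := by
  have : (Finset.univ.filter fun j => σ j ≠ Function.update σ i b j) = {i} := by
    ext j
    by_cases hj : j = i
    · subst hj; simp [h]
    · simp [hj]
  rw [hammingDist, this, Finset.card_singleton]

/-- Comparison of quadratic means over neighbouring levels. -/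
lemma quadMean_le {β : ℝ} (hN : N ≠ 0) {n : Fin q → ℕ} (hn : ∑ k, n k = N)
    {a b : Fin q} (hab : a ≠ b) (ha : 0 < n a) (f : Config q N → ℝ) :
    quadMean N n f ≤ quadMean N (move n a b) f +
      Real.sqrt (2 * N * q * dirichlet (conduct β meanField) f f /
        min (levelWeight β N n) (levelWeight β N (move n a b))) := by
  have hq0 : 0 < q := a.pos
  have hN0 : (0 : ℝ) < N := by positivity
  set n' := move n a b with hn'_def
  have hn' : ∑ k, n' k = N := by rw [hn'_def, sum_move n hab ha, hn]
  set E := marked N n a with hE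
  have hcn : 0 < ((fiber N n).card : ℝ) := by exact_mod_cast (fiber_nonempty hN hn).card_pos
  have hcn' : 0 < ((fiber N n').card : ℝ) := by exact_mod_cast (fiber_nonempty hN hn').card_pos
  have hna : (1 : ℝ) ≤ n a := by exact_mod_cast ha
  have hnb : (1 : ℝ) ≤ n b + 1 := le_add_of_nonneg_left (Nat.cast_nonneg _)
  have hEcard : (E.card : ℝ) = n a * (fiber N n).card := by
    have := sum_marked_fst (N := N) n a fun _ => 1
    simpa using this
  have hEcard' : (E.card : ℝ) = (n b + 1) * (fiber N n').card := by
    rw [hEcard, card_fiber_move hab ha]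
  have hE0 : 0 < (E.card : ℝ) := by rw [hEcard]; positivity
  -- The uniform law on marked pairs projects to the uniform law on the first level and, after
  -- recolouring, to that on the second. Minkowski's inequality on marked pairs then compares the
  -- two means.
  have h1 : quadMean N n f = Real.sqrt ((∑ p ∈ E, f p.1 ^ 2) / E.card) := by
    rw [hEcard, hE, sum_marked_fst n a fun σ => f σ ^ 2, quadMean,
      mul_div_mul_left _ _ (by linarith)]
  have h2 : quadMean N n' f =
      Real.sqrt ((∑ p ∈ E, f (Function.update p.1 p.2 b) ^ 2) / E.card) := by
    rw [hEcard', hE, sum_marked_update hab ha fun σ => f σ ^ 2, quadMean,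
      mul_div_mul_left _ _ (by linarith)]
  have h3 := sqrt_sum_sq_le E (fun p => f p.1) (fun p => f (Function.update p.1 p.2 b))
  rw [h1, h2, Real.sqrt_div' _ hE0.le, Real.sqrt_div' _ hE0.le]
  refine (div_le_div_of_nonneg_right h3 (Real.sqrt_nonneg _)).trans ?_
  rw [add_div, ← Real.sqrt_div' (∑ p ∈ E, (f p.1 - f (Function.update p.1 p.2 b)) ^ 2) hE0.le]
  refine add_le_add le_rfl (Real.sqrt_le_sqrt ?_)
  obtain ⟨σ₀, hσ₀⟩ := fiber_nonempty hN hn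
  obtain ⟨η₀, hη₀⟩ := fiber_nonempty hN hn'
  set κ := Real.exp (-β * max (hamiltonian meanField σ₀) (hamiltonian meanField η₀)) with hκ
  have hκ0 : 0 < κ := Real.exp_pos _
  have hH : ∀ σ ∈ fiber N n, hamiltonian meanField σ = hamiltonian meanField σ₀ := fun σ hσ => by
    rw [hamiltonian_meanField hN, hamiltonian_meanField hN, mem_fiber.mp hσ, mem_fiber.mp hσ₀]
  have hH' : ∀ σ ∈ fiber N n', hamiltonian meanField σ = hamiltonian meanField η₀ :=
    fun σ hσ => by
      rw [hamiltonian_meanField hN, hamiltonian_meanField hN, mem_fiber.mp hσ, mem_fiber.mp hη₀]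
  -- Each edge between the levels carries the weight of the endpoint with the larger Hamiltonian,
  -- and there are at least as many edges as configurations on either level.
  have hmin : min (levelWeight β N n) (levelWeight β N n') ≤ E.card * κ := by
    have w1 : levelWeight β N n = (fiber N n).card * Real.exp (-β * hamiltonian meanField σ₀) := by
      rw [levelWeight, Finset.sum_congr rfl fun σ hσ => show weight β meanField σ =
        Real.exp (-β * hamiltonian meanField σ₀) by rw [weight, hH σ hσ], Finset.sum_const,
        nsmul_eq_mul]
    have w2 : levelWeight β N n' =
        (fiber N n').card * Real.exp (-β * hamiltonian meanField η₀) := by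
      rw [levelWeight, Finset.sum_congr rfl fun σ hσ => show weight β meanField σ =
        Real.exp (-β * hamiltonian meanField η₀) by rw [weight, hH' σ hσ], Finset.sum_const,
        nsmul_eq_mul]
    rcases le_total (hamiltonian meanField σ₀) (hamiltonian meanField η₀) with h | h
    · refine (min_le_right _ _).trans ?_
      rw [w2, hκ, max_eq_right h, hEcard']
      refine mul_le_mul_of_nonneg_right ?_ (Real.exp_pos _).le
      exact le_mul_of_one_le_left hcn'.le hnb
    · refine (min_le_left _ _).trans ?_
      rw [w1, hκ, max_eq_left h, hEcard]
      refine mul_le_mul_of_nonneg_right ?_ (Real.exp_pos _).le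
      exact le_mul_of_one_le_left hcn.le hna
  have hmin0 : 0 < min (levelWeight β N n) (levelWeight β N n') :=
    lt_min (levelWeight_pos hN hn) (levelWeight_pos hN hn')
  have hD : ∑ p ∈ E, ((N : ℝ) * q)⁻¹ * κ * (f p.1 - f (Function.update p.1 p.2 b)) ^ 2 ≤
      2 * dirichlet (conduct β meanField) f f := by
    rw [dirichlet, ← mul_assoc, show (2 : ℝ) * (1 / 2) = 1 by norm_num, one_mul,
      ← Fintype.sum_prod_type' (f := fun x y => conduct β meanField x y *
        ((f x - f y) * (f x - f y)))]
    -- Distinct marked pairs give distinct directed edges, so the sum is part of twice the Dirichlet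
    -- form.
    have hinj : Set.InjOn (fun p : Config q N × Fin N => (p.1, Function.update p.1 p.2 b)) E := by
      rintro ⟨σ, i⟩ hp ⟨τ, j⟩ hp' h
      simp only [Prod.mk.injEq] at h
      obtain ⟨rfl, h⟩ := h
      have hi := (mem_marked.mp hp).2
      have hj := (mem_marked.mp hp').2
      by_contra hne
      have hij : i ≠ j := fun h' => hne (by rw [h'])
      have := congrFun h i
      rw [Function.update_self, Function.update_of_ne hij] at this
      exact hab (hi.symm.trans this.symm)
    have hc := isConductance_conduct (q := q) (N := N) β meanField
    calc _ = ∑ p ∈ E, conduct β meanField p.1 (Function.update p.1 p.2 b) *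
          ((f p.1 - f (Function.update p.1 p.2 b)) * (f p.1 - f (Function.update p.1 p.2 b))) := by
          refine Finset.sum_congr rfl fun p hp => ?_
          obtain ⟨hp1, hp2⟩ := mem_marked.mp hp
          rw [conduct, if_pos (hammingDist_update (by rw [hp2]; exact hab)),
            hH p.1 (mem_fiber.mpr hp1), hH' (Function.update p.1 p.2 b)
              (mem_fiber.mpr (by rw [count_update hp2 hab, hp1])), ← hκ, sq]
      _ = ∑ r ∈ E.image (fun p : Config q N × Fin N => (p.1, Function.update p.1 p.2 b)),
          conduct β meanField r.1 r.2 * ((f r.1 - f r.2) * (f r.1 - f r.2)) := by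
          rw [Finset.sum_image hinj]
      _ ≤ _ := Finset.sum_le_sum_of_subset_of_nonneg (Finset.subset_univ _) fun r _ _ =>
          mul_nonneg (hc.nonneg _ _) (mul_self_nonneg _)
  rw [← Finset.mul_sum] at hD
  set T := ∑ p ∈ E, (f p.1 - f (Function.update p.1 p.2 b)) ^ 2 with hT
  have hT0 : 0 ≤ T := Finset.sum_nonneg fun p _ => sq_nonneg _
  set D := dirichlet (conduct β meanField) f f
  have hq0' : (0 : ℝ) < q := by positivity
  have hTκ : T * κ ≤ 2 * N * q * D := by
    have := mul_le_mul_of_nonneg_left hD (by positivity : (0 : ℝ) ≤ N * q)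
    calc T * κ = N * q * (((N : ℝ) * q)⁻¹ * κ * T) := by field_simp
      _ ≤ _ := this
      _ = _ := by ring
  rw [div_le_div_iff₀ hE0 hmin0]
  calc T * min (levelWeight β N n) (levelWeight β N n') ≤ T * (E.card * κ) :=
        mul_le_mul_of_nonneg_left hmin hT0
    _ = (T * κ) * E.card := by ring
    _ ≤ _ := mul_le_mul_of_nonneg_right hTκ hE0.le

end Counts

end Potts

end

noncomputable section

namespace Potts

/-! ### Paths between levels -/

section Paths

variable {q N : ℕ} {β : ℝ}

/-- Possible colour counts of configurations of `N` spins. -/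
abbrev Counts (q N : ℕ) : Type :=
  {n : Fin q → ℕ // n ∈ Finset.piAntidiag (Finset.univ : Finset (Fin q)) N}

lemma Counts.sum_eq (n : Counts q N) : ∑ k, n.1 k = N := mem_piAntidiag_univ.mp n.2

lemma card_counts_le (q N : ℕ) : Fintype.card (Counts q N) ≤ (N + 1) ^ q := by
  rw [Fintype.card_coe]
  exact card_piAntidiag_le q N

/-- Neighbouring colour counts with free energy at most `v`. -/
def countGraph (q : ℕ) (β : ℝ) (N : ℕ) (v : ℝ) : SimpleGraph (Counts q N) where
  Adj n m := (∃ a b, a ≠ b ∧ 0 < n.1 a ∧ m.1 = move n.1 a b) ∧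
    freeEnergy β (freq N n.1) ≤ v ∧ freeEnergy β (freq N m.1) ≤ v
  symm := ⟨by
    rintro n m ⟨⟨a, b, hab, ha, hm⟩, h1, h2⟩
    refine ⟨⟨b, a, hab.symm, ?_, ?_⟩, h2, h1⟩
    · rw [hm, move_right _ hab]; omega
    · rw [hm, move_move hab ha]⟩
  loopless := ⟨by
    rintro n ⟨⟨a, b, hab, ha, hm⟩, -⟩
    have := congrFun hm a
    rw [move_left] at this
    omega⟩

lemma countGraph_mono {v v' : ℝ} (h : v ≤ v') : countGraph q β N v ≤ countGraph q β N v' :=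
  fun _ _ hadj => ⟨hadj.1, hadj.2.1.trans h, hadj.2.2.trans h⟩

/-- Chains the comparison of neighbouring levels. On a walk below height `v` every level weighs at
least `w`, so each step costs the same. -/
lemma quadMean_le_of_walk (hN : N ≠ 0) {v w : ℝ} (hw0 : 0 < w)
    (hw : ∀ k : Counts q N, freeEnergy β (freq N k.1) ≤ v → w ≤ levelWeight β N k.1)
    (f : Config q N → ℝ) {n m : Counts q N} (p : (countGraph q β N v).Walk n m) :
    quadMean N n.1 f ≤ quadMean N m.1 f +
      p.length * Real.sqrt (2 * N * q * dirichlet (conduct β meanField) f f / w) := by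
  induction p with
  | nil => simp
  | @cons n n' m hadj p ih =>
    have hadj' := hadj
    obtain ⟨⟨a, b, hab, ha, hm⟩, h1, h2⟩ := hadj'
    have hstep := quadMean_le (β := β) hN n.sum_eq hab ha f
    rw [← hm] at hstep
    have hD := dirichlet_self_nonneg (isConductance_conduct (q := q) (N := N) β meanField) f
    have hle : Real.sqrt (2 * N * q * dirichlet (conduct β meanField) f f /
        min (levelWeight β N n.1) (levelWeight β N n'.1)) ≤
        Real.sqrt (2 * N * q * dirichlet (conduct β meanField) f f / w) :=
      Real.sqrt_le_sqrt (div_le_div_of_nonneg_left (by positivity) hw0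
        (le_min (hw n h1) (hw n' h2)))
    rw [SimpleGraph.Walk.length_cons, Nat.cast_add, Nat.cast_one]
    linarith

lemma sum_fiber_weight_mul_sq (hN : N ≠ 0) (n : Counts q N) (f : Config q N → ℝ) :
    ∑ σ ∈ fiber N n.1, weight β meanField σ * f σ ^ 2 =
      levelWeight β N n.1 * quadMean N n.1 f ^ 2 := by
  have hcard : 0 < ((fiber N n.1).card : ℝ) := by
    exact_mod_cast (fiber_nonempty hN n.sum_eq).card_pos
  rw [quadMean, Real.sq_sqrt (div_nonneg (Finset.sum_nonneg fun σ _ => sq_nonneg _) hcard.le),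
    levelWeight, Finset.sum_congr rfl fun σ hσ => weight_meanField β hN hσ, Finset.sum_const,
    nsmul_eq_mul, Finset.sum_congr rfl fun σ hσ => by rw [weight_meanField β hN hσ],
    ← Finset.mul_sum]
  field_simp

/-- Constant of the Poincaré inequality below. -/
def poincareConst (q : ℕ) (β : ℝ) (N : ℕ) (ε : ℝ) : ℝ :=
  2 * N * q * Real.exp (β / 2) * ((N : ℝ) + 1) ^ (4 * q) * Real.exp (N * β * ε)

lemma poincareConst_nonneg (q : ℕ) (β : ℝ) (N : ℕ) (ε : ℝ) : 0 ≤ poincareConst q β N ε := by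
  unfold poincareConst; positivity

/-- Poincaré inequality for functions vanishing on the target levels `T`, on levels from which
`T` can be reached without raising the free energy by more than `ε`. -/
theorem sum_weight_mul_sq_le (hβ : 0 < β) (hN : N ≠ 0) {ε : ℝ} {V T : Set (Counts q N)}
    [DecidablePred (· ∈ V)]
    (hV : ∀ n ∈ V, ∃ m ∈ T, (countGraph q β N (freeEnergy β (freq N n.1) + ε)).Reachable n m)
    {f : Config q N → ℝ} (hf : ∀ m ∈ T, ∀ σ ∈ fiber N m.1, f σ = 0) :
    ∑ n : Counts q N with n ∈ V, ∑ σ ∈ fiber N n.1, weight β meanField σ * f σ ^ 2 ≤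
      poincareConst q β N ε * dirichlet (conduct β meanField) f f := by
  classical
  have hD := dirichlet_self_nonneg (isConductance_conduct (q := q) (N := N) β meanField) f
  set D := dirichlet (conduct β meanField) f f
  have hN1 : (0 : ℝ) < (N : ℝ) + 1 := by positivity
  -- Of the exponent `3 * q`, one `q` comes from the lower bound on the level weights and `2 * q`
  -- from the squared path length; a further `q` appears on summing over levels.
  have key : ∀ n ∈ V, ∑ σ ∈ fiber N n.1, weight β meanField σ * f σ ^ 2 ≤
      2 * N * q * Real.exp (β / 2) * ((N : ℝ) + 1) ^ (3 * q) * Real.exp (N * β * ε) * D := by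
    intro n hn
    obtain ⟨m, hm, hreach⟩ := hV n hn
    set F := freeEnergy β (freq N n.1) with hF
    -- A path without repetition is no longer than the number of levels.
    obtain ⟨p, hp⟩ := hreach.exists_isPath
    set w := Real.exp (-(N * β * (F + ε))) / (Real.exp (β / 2) * ((N : ℝ) + 1) ^ q) with hw_def
    have hw0 : 0 < w := by positivity
    have hw : ∀ k : Counts q N, freeEnergy β (freq N k.1) ≤ F + ε → w ≤ levelWeight β N k.1 := by
      intro k hk
      rw [hw_def, div_le_iff₀ (by positivity)]
      have h1 := le_levelWeight hβ hN k.sum_eq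
      have h2 : Real.exp (-(N * β * (F + ε))) ≤
          Real.exp (-(N * β * freeEnergy β (freq N k.1))) := by
        refine Real.exp_le_exp.mpr (neg_le_neg ?_)
        exact mul_le_mul_of_nonneg_left hk (by positivity)
      linarith
    have h1 := quadMean_le_of_walk hN hw0 hw f p
    have h2 : quadMean N m.1 f = 0 := by
      rw [quadMean, Finset.sum_eq_zero fun σ hσ => by rw [hf m hm σ hσ]; norm_num]
      simp
    rw [h2, zero_add] at h1
    have hlen : (p.length : ℝ) ≤ ((N : ℝ) + 1) ^ q := by
      have := hp.length_lt.le.trans (card_counts_le q N)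
      exact_mod_cast this
    have hq0 : 0 ≤ quadMean N n.1 f := Real.sqrt_nonneg _
    have h3 : quadMean N n.1 f ^ 2 ≤ (((N : ℝ) + 1) ^ q) ^ 2 * (2 * N * q * D / w) := by
      calc quadMean N n.1 f ^ 2 ≤ (p.length * Real.sqrt (2 * N * q * D / w)) ^ 2 :=
            pow_le_pow_left₀ hq0 h1 2
        _ = (p.length : ℝ) ^ 2 * (2 * N * q * D / w) := by
            rw [mul_pow, Real.sq_sqrt (by positivity)]
        _ ≤ _ := mul_le_mul_of_nonneg_right (pow_le_pow_left₀ (by positivity) hlen 2)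
            (by positivity)
    rw [sum_fiber_weight_mul_sq hN]
    have h4 := levelWeight_le hβ hN n.sum_eq
    rw [← hF] at h4
    calc levelWeight β N n.1 * quadMean N n.1 f ^ 2
        ≤ Real.exp (-(N * β * F)) * ((((N : ℝ) + 1) ^ q) ^ 2 * (2 * N * q * D / w)) :=
          mul_le_mul h4 h3 (sq_nonneg _) (Real.exp_pos _).le
      _ = _ := by
          rw [hw_def, mul_add, neg_add, Real.exp_add, Real.exp_neg (N * β * ε)]
          have : (0 : ℝ) < Real.exp (-(N * β * F)) := Real.exp_pos _
          field_simp
          ring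
  calc _ ≤ ∑ n : Counts q N with n ∈ V,
        2 * N * q * Real.exp (β / 2) * ((N : ℝ) + 1) ^ (3 * q) * Real.exp (N * β * ε) * D :=
        Finset.sum_le_sum fun n hn => key n (Finset.mem_filter.mp hn).2
    _ ≤ ((N : ℝ) + 1) ^ q *
        (2 * N * q * Real.exp (β / 2) * ((N : ℝ) + 1) ^ (3 * q) * Real.exp (N * β * ε) * D) := by
        rw [Finset.sum_const, nsmul_eq_mul]
        refine mul_le_mul_of_nonneg_right ?_ (by positivity)
        have := (Finset.card_filter_le (Finset.univ : Finset (Counts q N)) (· ∈ V)).trans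
          (card_counts_le q N)
        exact_mod_cast this
    _ = _ := by unfold poincareConst; ring

/-- Levels are connected through levels with intermediate counts. -/
lemma reachable_of_between {v : ℝ} (n m : Counts q N)
    (h : ∀ k : Counts q N, (∀ j, min (n.1 j) (m.1 j) ≤ k.1 j ∧ k.1 j ≤ max (n.1 j) (m.1 j)) →
      freeEnergy β (freq N k.1) ≤ v) :
    (countGraph q β N v).Reachable n m := by
  obtain ⟨n, hn⟩ := n
  have key : ∀ n : Fin q → ℕ, ∑ k, n k = ∑ k, m.1 k →
      ∀ hn : n ∈ Finset.piAntidiag (Finset.univ : Finset (Fin q)) N,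
      (∀ k : Counts q N, (∀ j, min (n j) (m.1 j) ≤ k.1 j ∧ k.1 j ≤ max (n j) (m.1 j)) →
        freeEnergy β (freq N k.1) ≤ v) → (countGraph q β N v).Reachable ⟨n, hn⟩ m := by
    refine count_induction (fun hn _ => SimpleGraph.Reachable.refl _) ?_
    intro n a b hsum hab ha hb ih hn hle
    have hmem : move n a b ∈ Finset.piAntidiag (Finset.univ : Finset (Fin q)) N := by
      rw [mem_piAntidiag_univ, sum_move n hab (by omega), hsum, m.sum_eq]
    have hbtw : ∀ j, min (n j) (m.1 j) ≤ move n a b j ∧ move n a b j ≤ max (n j) (m.1 j) := by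
      intro j
      by_cases h1 : j = a
      · subst h1; rw [move_left]; omega
      by_cases h2 : j = b
      · subst h2; rw [move_right n hab]; omega
      · rw [move_of_ne n h1 h2]; omega
    have hadj : (countGraph q β N v).Adj ⟨n, hn⟩ ⟨move n a b, hmem⟩ :=
      ⟨⟨a, b, hab, by simp only; omega, rfl⟩, hle _ fun j => by simp, hle _ hbtw⟩
    refine hadj.reachable.trans (ih hmem fun k hk => hle k fun j => ?_)
    have h1 := hk j
    have h2 := hbtw j
    omega
  exact key n (by rw [m.sum_eq]; exact mem_piAntidiag_univ.mp hn) hn h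

lemma dist_freq_le_of_between (n m k : Counts q N)
    (h : ∀ j, min (n.1 j) (m.1 j) ≤ k.1 j ∧ k.1 j ≤ max (n.1 j) (m.1 j)) :
    dist (freq N k.1) (freq N n.1) ≤ dist (freq N m.1) (freq N n.1) := by
  refine (dist_pi_le_iff dist_nonneg).mpr fun j => ?_
  refine le_trans ?_ (dist_le_pi_dist _ _ j)
  simp only [freq, Real.dist_eq, ← sub_div, abs_div, Nat.abs_cast]
  refine div_le_div_of_nonneg_right ?_ (Nat.cast_nonneg _)
  have hj := h j
  rcases le_total (n.1 j) (m.1 j) with h1 | h1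
  · rw [min_eq_left h1, max_eq_right h1] at hj
    have e1 : (n.1 j : ℝ) ≤ k.1 j := by exact_mod_cast hj.1
    have e2 : (k.1 j : ℝ) ≤ m.1 j := by exact_mod_cast hj.2
    rw [abs_of_nonneg (by linarith), abs_of_nonneg (by linarith)]
    linarith
  · rw [min_eq_right h1, max_eq_left h1] at hj
    have e1 : (m.1 j : ℝ) ≤ k.1 j := by exact_mod_cast hj.1
    have e2 : (k.1 j : ℝ) ≤ n.1 j := by exact_mod_cast hj.2
    rw [abs_of_nonpos (by linarith), abs_of_nonpos (by linarith)]
    linarith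

/-- Lattice approximation of points of the simplex. -/
lemma exists_counts_near (hq : 2 ≤ q) (hN : N ≠ 0) {x : Fin q → ℝ}
    (hx : x ∈ stdSimplex ℝ (Fin q)) :
    ∃ n : Counts q N, ∀ k, |freq N n.1 k - x k| ≤ q / N := by
  have hN0 : (0 : ℝ) < N := by positivity
  have hq2 : (2 : ℝ) ≤ q := by exact_mod_cast hq
  set k₀ : Fin q := ⟨0, by omega⟩
  -- All coordinates but `k₀` are rounded down; `k₀` absorbs the total rounding error, at most `q -
  -- 1` units.
  set fl : Fin q → ℕ := fun k => ⌊N * x k⌋₊ with hfl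
  have hfl1 : ∀ k, (fl k : ℝ) ≤ N * x k := fun k => Nat.floor_le (mul_nonneg hN0.le (hx.1 k))
  have hfl2 : ∀ k, N * x k ≤ fl k + 1 := fun k => (Nat.lt_floor_add_one _).le
  set s := ∑ k ∈ Finset.univ.erase k₀, fl k with hs
  have hxsum : x k₀ + ∑ k ∈ Finset.univ.erase k₀, x k = 1 := by
    rw [Finset.add_sum_erase _ _ (Finset.mem_univ k₀)]; exact hx.2
  have hs1 : (s : ℝ) ≤ N * (1 - x k₀) := by
    rw [hs, Nat.cast_sum]
    calc _ ≤ ∑ k ∈ Finset.univ.erase k₀, N * x k := Finset.sum_le_sum fun k _ => hfl1 k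
      _ = _ := by rw [← Finset.mul_sum]; congr 1; linarith
  have hs2 : N * (1 - x k₀) ≤ s + (q - 1) := by
    rw [hs, Nat.cast_sum]
    calc N * (1 - x k₀) = ∑ k ∈ Finset.univ.erase k₀, N * x k := by
          rw [← Finset.mul_sum]; congr 1; linarith
      _ ≤ ∑ k ∈ Finset.univ.erase k₀, ((fl k : ℝ) + 1) := Finset.sum_le_sum fun k _ => hfl2 k
      _ = _ := by
          rw [Finset.sum_add_distrib, Finset.sum_const, Finset.card_erase_of_mem
            (Finset.mem_univ k₀), Finset.card_univ, Fintype.card_fin, nsmul_eq_mul, mul_one,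
            Nat.cast_sub (by omega), Nat.cast_one]
  have hsN : s ≤ N := by
    have h1 := mul_nonneg hN0.le (hx.1 k₀)
    have : (s : ℝ) ≤ N := by linarith
    exact_mod_cast this
  refine ⟨⟨fun k => if k = k₀ then N - s else fl k, ?_⟩, fun k => ?_⟩
  · rw [mem_piAntidiag_univ, ← Finset.add_sum_erase _ _ (Finset.mem_univ k₀), if_pos rfl,
      Finset.sum_congr rfl fun k hk => if_neg (Finset.ne_of_mem_erase hk)]
    exact Nat.sub_add_cancel hsN
  · simp only [freq]
    rw [div_sub' hN0.ne', abs_div, abs_of_pos hN0]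
    refine div_le_div_of_nonneg_right ?_ hN0.le
    split_ifs with hk
    · rw [Nat.cast_sub hsN, hk, abs_le]
      constructor <;> linarith
    · have h1 := hfl1 k
      have h2 := hfl2 k
      rw [abs_le]
      constructor <;> linarith

/-- The closest point is at most as far in Euclidean distance as a rounded one, and the sup distance
is smaller still; enlarging `q³` to `q⁴` turns the bound into a perfect square. -/
lemma exists_counts_of_isClosestLatticePt (hq : 2 ≤ q) (hN : N ≠ 0) {x y : Fin q → ℝ}
    (hx : x ∈ stdSimplex ℝ (Fin q)) (h : IsClosestLatticePt N x y) :
    ∃ n : Counts q N, freq N n.1 = y ∧ dist y x ≤ (q : ℝ) ^ 2 / N := by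
  have hN0 : (0 : ℝ) < N := by positivity
  have hq2 : (2 : ℝ) ≤ q := by exact_mod_cast hq
  obtain ⟨⟨hy, n, hn⟩, hmin⟩ := h
  have hsum : ∑ k, n k = N := by
    have h1 := hy.2
    simp only [hn, ← Finset.sum_div] at h1
    rw [div_eq_one_iff_eq hN0.ne'] at h1
    exact_mod_cast h1
  refine ⟨⟨n, mem_piAntidiag_univ.mpr hsum⟩, funext fun k => (hn k).symm, ?_⟩
  obtain ⟨z, hz⟩ := exists_counts_near hq hN hx
  have h1 := hmin (freq N z.1) ⟨freq_mem hN z.sum_eq, z.1, fun _ => rfl⟩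
  have h2 : ∑ k, (freq N z.1 k - x k) ^ 2 ≤ ((q : ℝ) ^ 2 / N) ^ 2 := by
    calc _ ≤ ∑ _k : Fin q, ((q : ℝ) / N) ^ 2 := Finset.sum_le_sum fun k _ =>
          sq_le_sq' (by linarith [(abs_le.mp (hz k)).1]) (abs_le.mp (hz k)).2
      _ = q * ((q : ℝ) / N) ^ 2 := by simp
      _ = (q : ℝ) ^ 3 / N ^ 2 := by ring
      _ ≤ (q : ℝ) ^ 4 / N ^ 2 := by
          refine div_le_div_of_nonneg_right (pow_le_pow_right₀ (by linarith) (by norm_num))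
            (by positivity)
      _ = _ := by ring
  refine (dist_pi_le_iff (by positivity)).mpr fun k => ?_
  rw [Real.dist_eq]
  refine abs_le_of_sq_le_sq ?_ (by positivity)
  calc (y k - x k) ^ 2 ≤ ∑ k, (y k - x k) ^ 2 :=
        Finset.single_le_sum (f := fun k => (y k - x k) ^ 2) (fun _ _ => sq_nonneg _)
          (Finset.mem_univ k)
    _ ≤ _ := h1.trans h2

/-- Uniform descent away from the local minima of a continuous function on a compact set. -/
lemma exists_descent {X : Type*} [PseudoMetricSpace X] {K : Set X} (hK : IsCompact K) {F : X → ℝ}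
    (hF : Continuous F) {M : Set X} (hM : ∀ x ∈ K, IsLocalMinOn F K x → x ∈ M) {ρ : ℝ}
    (hρ : 0 < ρ) :
    ∃ η > 0, ∀ x ∈ K, (∃ m ∈ M, dist x m < ρ) ∨ ∃ y ∈ K, dist x y < ρ ∧ F y < F x - η := by
  -- Failure for every `η = 1 / (n + 1)` gives a sequence with a cluster point. If that point lies
  -- in `M`, the sequence comes too close to `M`; if not, it is no local minimum, and a lower point
  -- near it serves the sequence as well.
  by_contra! hcon
  have hpos : ∀ n : ℕ, (0 : ℝ) < 1 / (n + 1) := fun n => by positivity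
  choose x hxK hxM hxd using fun n : ℕ => hcon (1 / (n + 1)) (hpos n)
  obtain ⟨z, hzK, φ, hφ, hlim⟩ := hK.tendsto_subseq hxK
  by_cases hz : z ∈ M
  · obtain ⟨n, hn⟩ := (Metric.tendsto_nhds.mp hlim ρ hρ).exists
    exact absurd hn (not_lt.mpr (hxM (φ n) z hz))
  · have hnl : ¬ IsLocalMinOn F K z := fun h => hz (hM z hzK h)
    have hfr : ∃ᶠ y in 𝓝[K] z, F y < F z := by
      intro h
      exact hnl (h.mono fun y hy => not_lt.mp hy)
    have hball : ∀ᶠ y in 𝓝[K] z, dist y z < ρ / 2 :=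
      nhdsWithin_le_nhds (Metric.ball_mem_nhds z (by linarith))
    obtain ⟨y, hy1, hy2, hy3⟩ := (hfr.and_eventually (hball.and self_mem_nhdsWithin)).exists
    have h1 : ∀ᶠ n in atTop, dist (x (φ n)) z < ρ / 2 :=
      Metric.tendsto_nhds.mp hlim (ρ / 2) (by linarith)
    have h2 : Tendsto (fun n => F (x (φ n)) - 1 / ((φ n : ℝ) + 1)) atTop (𝓝 (F z - 0)) :=
      ((hF.tendsto z).comp hlim).sub
        (tendsto_one_div_add_atTop_nhds_zero_nat.comp hφ.tendsto_atTop)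
    rw [sub_zero] at h2
    obtain ⟨n, hn1, hn2⟩ := (h1.and (h2.eventually (lt_mem_nhds hy1))).exists
    have h3 : dist (x (φ n)) y < ρ := by
      have := dist_triangle_right (x (φ n)) y z
      linarith
    exact absurd hn2 (not_lt.mpr (hxd (φ n) y hy3 h3))

lemma exists_uniform (β : ℝ) {ε : ℝ} (hε : 0 < ε) :
    ∃ ρ > 0, ∀ x ∈ stdSimplex ℝ (Fin q), ∀ y ∈ stdSimplex ℝ (Fin q), dist x y < ρ →
      freeEnergy β x < freeEnergy β y + ε := by
  have h := (isCompact_stdSimplex ℝ (Fin q)).uniformContinuousOn_of_continuous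
    (continuous_freeEnergy β).continuousOn
  obtain ⟨ρ, hρ, h'⟩ := Metric.uniformContinuousOn_iff.mp h ε hε
  refine ⟨ρ, hρ, fun x hx y hy hxy => ?_⟩
  have := (abs_lt.mp (h' x hx y hy hxy)).2
  linarith

/-- From every level one can reach, without raising the free energy by more than `ε`, the lattice
approximation of one of the minima. -/
theorem exists_reachable_minPt (hq : 2 ≤ q)
    (hloc : ∀ x ∈ stdSimplex ℝ (Fin q),
      IsLocalMinOn (freeEnergy β) (stdSimplex ℝ (Fin q)) x → ∃ i, x = minPt q β i)
    (hmem : ∀ i, minPt q β i ∈ stdSimplex ℝ (Fin q)) {ε : ℝ} (hε : 0 < ε) :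
    ∃ N₀ : ℕ, ∀ N ≥ N₀, ∀ m : Option (Fin q) → Fin q → ℝ,
      (∀ i, IsClosestLatticePt N (minPt q β i) (m i)) → ∀ n : Counts q N,
      ∃ i, ∃ k : Counts q N, freq N k.1 = m i ∧
        (countGraph q β N (freeEnergy β (freq N n.1) + ε)).Reachable n k := by
  obtain ⟨ρ₀, hρ₀, hun⟩ := exists_uniform (q := q) β hε
  obtain ⟨η, hη, hdesc⟩ := exists_descent (isCompact_stdSimplex ℝ (Fin q))
    (continuous_freeEnergy β) (M := Set.range (minPt q β))
    (fun x hx h => by obtain ⟨i, hi⟩ := hloc x hx h; exact ⟨i, hi.symm⟩)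
    (ρ := ρ₀ / 2) (by linarith)
  obtain ⟨ρ₁, hρ₁, hun₁⟩ := exists_uniform (q := q) β hη
  obtain ⟨N₀, hN₀⟩ := exists_nat_gt ((q : ℝ) ^ 2 / min (ρ₀ / 2) ρ₁)
  have hq2 : (2 : ℝ) ≤ q := by exact_mod_cast hq
  have hmin0 : 0 < min (ρ₀ / 2) ρ₁ := lt_min (by linarith) hρ₁
  refine ⟨N₀, fun N hN m hm => ?_⟩
  have hNN : (N₀ : ℝ) ≤ N := by exact_mod_cast hN
  have hN0 : (0 : ℝ) < N := lt_of_lt_of_le (lt_trans (by positivity) hN₀) hNN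
  have hNne : N ≠ 0 := by rintro rfl; simp at hN0
  have hsmall : (q : ℝ) ^ 2 / N < min (ρ₀ / 2) ρ₁ := by
    rw [div_lt_iff₀ hN0]
    rw [div_lt_iff₀ hmin0] at hN₀
    calc (q : ℝ) ^ 2 < N₀ * min (ρ₀ / 2) ρ₁ := hN₀
      _ ≤ N * min (ρ₀ / 2) ρ₁ := mul_le_mul_of_nonneg_right hNN hmin0.le
      _ = _ := mul_comm _ _
  have hsmall' : (q : ℝ) / N < min (ρ₀ / 2) ρ₁ := by
    refine lt_of_le_of_lt (div_le_div_of_nonneg_right ?_ hN0.le) hsmall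
    nlinarith
  have hconn : ∀ n k : Counts q N, dist (freq N k.1) (freq N n.1) < ρ₀ →
      (countGraph q β N (freeEnergy β (freq N n.1) + ε)).Reachable n k := by
    intro n k hd
    refine reachable_of_between n k fun l hl => (hun _ (freq_mem hNne l.sum_eq) _
      (freq_mem hNne n.sum_eq) ((dist_freq_le_of_between n k l hl).trans_lt hd)).le
  by_contra! hcon
  obtain ⟨n₁, hn₁⟩ := hcon
  classical
  set bad : Finset (Counts q N) := Finset.univ.filter fun n => ∀ i, ∀ k : Counts q N,
    freq N k.1 = m i → ¬ (countGraph q β N (freeEnergy β (freq N n.1) + ε)).Reachable n k with hbad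
  -- A bad level of least free energy: it is either near a minimum, hence directly connected to its
  -- lattice point, or connected to a strictly lower level, which is good by minimality.
  obtain ⟨n, hn, hnmin⟩ := bad.exists_min_image (fun n => freeEnergy β (freq N n.1))
    ⟨n₁, by simp only [hbad, Finset.mem_filter, Finset.mem_univ, true_and]; exact hn₁⟩
  have hn' : ∀ i, ∀ k : Counts q N, freq N k.1 = m i →
      ¬ (countGraph q β N (freeEnergy β (freq N n.1) + ε)).Reachable n k :=
    (Finset.mem_filter.mp hn).2
  rcases hdesc _ (freq_mem hNne n.sum_eq) with ⟨_, ⟨i, rfl⟩, hd⟩ | ⟨y, hy, hd, hlt⟩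
  · obtain ⟨k, hk, hkd⟩ := exists_counts_of_isClosestLatticePt hq hNne (hmem i) (hm i)
    refine hn' i k hk (hconn n k ?_)
    rw [hk]
    have h1 := dist_triangle_right (m i) (freq N n.1) (minPt q β i)
    have h2 := hkd.trans_lt (hsmall.trans_le (min_le_left _ _))
    linarith
  · obtain ⟨k, hk⟩ := exists_counts_near hq hNne hy
    have hkd : dist (freq N k.1) y ≤ q / N := (dist_pi_le_iff (by positivity)).mpr hk
    have hklt : freeEnergy β (freq N k.1) < freeEnergy β (freq N n.1) := by
      have := hun₁ _ (freq_mem hNne k.sum_eq) y hy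
        (hkd.trans_lt (hsmall'.trans_le (min_le_right _ _)))
      linarith
    have hreach : (countGraph q β N (freeEnergy β (freq N n.1) + ε)).Reachable n k := by
      refine hconn n k ?_
      have h1 := dist_triangle_right (freq N k.1) (freq N n.1) y
      have h2 := hkd.trans_lt (hsmall'.trans_le (min_le_left _ _))
      linarith
    have hkbad : k ∉ bad := fun h => absurd (hnmin k h) (not_le.mpr hklt)
    simp only [hbad, Finset.mem_filter, Finset.mem_univ, true_and, not_forall, not_not] at hkbad
    obtain ⟨i, l, hl, hkl⟩ := hkbad
    -- The height allowed from the lower level is smaller, so its graph is contained in that of the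
    -- original one.
    exact hn' i l hl (hreach.trans (hkl.mono (countGraph_mono (by linarith))))

end Paths

end Potts

end

noncomputable section

namespace Potts

/-! ### The potential barrier around the starting wells -/

section Barrier

variable {q N : ℕ} {β : ℝ} {IA IB : Set (Option (Fin q))}

/-- The starting wells are separated from the other ones by a free energy barrier. -/
theorem IsWellPair.exists_barrier (h : IsWellPair q β IA IB) :
    ∃ r > 0, ∃ δ > 0,
      (∀ i ∈ IA, ∀ x ∈ stdSimplex ℝ (Fin q), (∃ j ∈ IA, dist x (minPt q β j) ≤ 2 * r) →
        (∀ j ∈ IA, r / 2 ≤ dist x (minPt q β j)) →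
          freeEnergy β (minPt q β i) + δ ≤ freeEnergy β x) ∧
      (∀ i ∈ IA, ∀ j ∈ IB, 4 * r ≤ dist (minPt q β j) (minPt q β i)) ∧
      ∀ i ∈ IA, ∀ j, j ∉ IA → j ∉ IB →
        freeEnergy β (minPt q β i) + δ ≤ freeEnergy β (minPt q β j) := by
  obtain ⟨i₀, hi₀⟩ := h.nonempty_left
  have hr1 : ∀ i j : Option (Fin q), ∀ᶠ r in 𝓝[>] (0 : ℝ),
      minPt q β i ≠ minPt q β j → 4 * r ≤ dist (minPt q β j) (minPt q β i) := by
    intro i j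
    by_cases hij : minPt q β i = minPt q β j
    · exact Eventually.of_forall fun r h => absurd hij h
    · have hd : 0 < dist (minPt q β j) (minPt q β i) := dist_pos.mpr (Ne.symm hij)
      have : ∀ᶠ r in 𝓝[>] (0 : ℝ), r < dist (minPt q β j) (minPt q β i) / 4 :=
        nhdsWithin_le_nhds (eventually_lt_nhds (by linarith))
      filter_upwards [this] with r hr _
      linarith
  have hr2 : ∀ i : Option (Fin q), ∀ᶠ r in 𝓝[>] (0 : ℝ), i ∈ IA →
      ∀ x ∈ stdSimplex ℝ (Fin q), dist x (minPt q β i) < 4 * r →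
        freeEnergy β (minPt q β i) ≤ freeEnergy β x := by
    intro i
    by_cases hi : i ∈ IA
    · obtain ⟨ρ, hρ, hball⟩ := Metric.mem_nhdsWithin_iff.mp (h.isLocalMinOn i hi)
      have : ∀ᶠ r in 𝓝[>] (0 : ℝ), r < ρ / 4 :=
        nhdsWithin_le_nhds (eventually_lt_nhds (by linarith))
      filter_upwards [this] with r hr _ x hx hd
      exact hball ⟨Metric.mem_ball.mpr (by linarith), hx⟩
    · exact Eventually.of_forall fun r h => absurd h hi
  have hr3 : ∀ᶠ r in 𝓝[>] (0 : ℝ), r ∈ Set.Ioi (0 : ℝ) := self_mem_nhdsWithin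
  obtain ⟨r, hr, hsep, hmin⟩ := (hr3.and
    ((eventually_all.mpr fun i => eventually_all.mpr fun j => hr1 i j).and
      (eventually_all.mpr hr2))).exists
  have hr0 : (0 : ℝ) < r := hr
  -- A nearby point of equal energy would itself be a local minimum, hence one of the listed points,
  -- and these are at mutual distance at least `4 * r`.
  have hstrict : ∀ i ∈ IA, ∀ x ∈ stdSimplex ℝ (Fin q), dist x (minPt q β i) ≤ 2 * r →
      x ≠ minPt q β i → freeEnergy β (minPt q β i) < freeEnergy β x := by
    intro i hi x hx hd hne
    refine (hmin i hi x hx (by linarith)).lt_of_ne fun heq => ?_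
    have hloc : IsLocalMinOn (freeEnergy β) (stdSimplex ℝ (Fin q)) x := by
      refine eventually_nhdsWithin_iff.mpr ?_
      filter_upwards [Metric.ball_mem_nhds x hr0] with y hy hyS
      rw [← heq]
      refine hmin i hi y hyS ?_
      have h1 := dist_triangle y x (minPt q β i)
      have h2 := Metric.mem_ball.mp hy
      linarith
    obtain ⟨j, rfl⟩ := h.eq_minPt x hx hloc
    have := hsep i j (Ne.symm hne)
    linarith
  -- A compact collar around the starting wells; the minimum of the free energy on it gives the
  -- height of the barrier.
  set Q : Set (Fin q → ℝ) := stdSimplex ℝ (Fin q) ∩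
    ((⋃ j ∈ IA, {x | dist x (minPt q β j) ≤ 2 * r}) ∩
      ⋂ j ∈ IA, {x | r / 2 ≤ dist x (minPt q β j)}) with hQ_def
  have hQ : IsCompact Q := by
    refine (isCompact_stdSimplex ℝ (Fin q)).inter_right (IsClosed.inter ?_ ?_)
    · exact (Set.toFinite IA).isClosed_biUnion fun j _ =>
        isClosed_le (by fun_prop) (by fun_prop)
    · exact isClosed_biInter fun j _ => isClosed_le (by fun_prop) (by fun_prop)
  have hδ1 : ∃ δ > 0, ∀ x ∈ Q, freeEnergy β (minPt q β i₀) + δ ≤ freeEnergy β x := by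
    rcases Q.eq_empty_or_nonempty with hE | hne
    · exact ⟨1, one_pos, fun x hx => by rw [hE] at hx; exact absurd hx (Set.notMem_empty x)⟩
    · obtain ⟨x, hx, hxmin⟩ := hQ.exists_isMinOn hne (continuous_freeEnergy β).continuousOn
      obtain ⟨hxS, hx1, hx2⟩ := hx
      simp only [Set.mem_iUnion, Set.mem_ofPred_eq, exists_prop] at hx1
      simp only [Set.mem_iInter, Set.mem_ofPred_eq] at hx2
      obtain ⟨j, hj, hjd⟩ := hx1
      have hlt := hstrict j hj x hxS hjd fun heq => by
        have := hx2 j hj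
        rw [heq, dist_self] at this
        linarith
      rw [← h.same i₀ hi₀ j hj] at hlt
      refine ⟨freeEnergy β x - freeEnergy β (minPt q β i₀), by linarith, fun y hy => ?_⟩
      have : freeEnergy β x ≤ freeEnergy β y := hxmin hy
      linarith
  have hδ2 : ∃ δ > 0, ∀ j, j ∉ IA → j ∉ IB →
      freeEnergy β (minPt q β i₀) + δ ≤ freeEnergy β (minPt q β j) := by
    have : ∀ j, ∀ᶠ δ in 𝓝[>] (0 : ℝ), j ∉ IA → j ∉ IB →
        freeEnergy β (minPt q β i₀) + δ ≤ freeEnergy β (minPt q β j) := by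
      intro j
      by_cases hj : j ∉ IA ∧ j ∉ IB
      · have hlt := h.deeper i₀ hi₀ j hj.1 hj.2
        have : ∀ᶠ δ in 𝓝[>] (0 : ℝ), δ < freeEnergy β (minPt q β j) -
            freeEnergy β (minPt q β i₀) := nhdsWithin_le_nhds (eventually_lt_nhds (by linarith))
        filter_upwards [this] with δ hδ _ _
        linarith
      · exact Eventually.of_forall fun δ h1 h2 => absurd ⟨h1, h2⟩ hj
    have h0 : ∀ᶠ δ in 𝓝[>] (0 : ℝ), δ ∈ Set.Ioi (0 : ℝ) := self_mem_nhdsWithin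
    obtain ⟨δ, hδ, hall⟩ := (h0.and (eventually_all.mpr this)).exists
    exact ⟨δ, hδ, hall⟩
  obtain ⟨δ₁, hδ₁, hb1⟩ := hδ1
  obtain ⟨δ₂, hδ₂, hb2⟩ := hδ2
  refine ⟨r, hr0, min δ₁ δ₂, lt_min hδ₁ hδ₂, ?_, ?_, ?_⟩
  · intro i hi x hx h1 h2
    rw [h.same i hi i₀ hi₀]
    have := hb1 x ⟨hx, by simpa using h1, by simpa using h2⟩
    linarith [min_le_left δ₁ δ₂]
  · exact fun i hi j hj => hsep i j (h.ne i hi j hj)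
  · intro i hi j hj1 hj2
    rw [h.same i hi i₀ hi₀]
    linarith [hb2 j hj1 hj2, min_le_right δ₁ δ₂]

/-- The colour counts of a configuration. -/
def cnt (σ : Config q N) : Counts q N := ⟨count σ, count_mem_piAntidiag σ⟩

lemma sum_filter_cnt {V : Set (Counts q N)} [DecidablePred (· ∈ V)]
    [DecidablePred fun σ : Config q N => cnt σ ∈ V] (f : Config q N → ℝ) :
    ∑ σ with cnt σ ∈ V, f σ = ∑ n : Counts q N with n ∈ V, ∑ σ ∈ fiber N n.1, f σ := by
  classical
  rw [← Finset.sum_fiberwise_of_maps_to (g := cnt) (t := Finset.univ.filter (· ∈ V))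
    (fun σ hσ => by simpa using hσ)]
  refine Finset.sum_congr rfl fun n hn => Finset.sum_congr ?_ fun _ _ => rfl
  ext σ
  simp only [Finset.mem_filter, Finset.mem_univ, true_and, mem_fiber]
  constructor
  · rintro ⟨_, rfl⟩; rfl
  · intro h
    have : cnt σ = n := Subtype.ext h
    rw [this]
    exact ⟨(Finset.mem_filter.mp hn).2, rfl⟩

lemma sum_weight_le_of_le (hβ : 0 < β) (hN : N ≠ 0) {v : ℝ} {T : Finset (Config q N)}
    (hT : ∀ σ ∈ T, v ≤ freeEnergy β (freq N (count σ))) :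
    ∑ σ ∈ T, weight β meanField σ ≤ ((N : ℝ) + 1) ^ q * Real.exp (-(N * β * v)) := by
  classical
  obtain ⟨V, hV⟩ : ∃ V : Set (Counts q N), ∀ n, n ∈ V ↔ v ≤ freeEnergy β (freq N n.1) :=
    ⟨{n | v ≤ freeEnergy β (freq N n.1)}, fun _ => Iff.rfl⟩
  calc ∑ σ ∈ T, weight β meanField σ ≤ ∑ σ with cnt σ ∈ V, weight β meanField σ :=
        Finset.sum_le_sum_of_subset_of_nonneg
          (fun σ hσ => Finset.mem_filter.mpr ⟨Finset.mem_univ _, (hV _).mpr (hT σ hσ)⟩) fun σ _ _ => (weight_pos _ _ σ).le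
    _ = ∑ n : Counts q N with n ∈ V, levelWeight β N n.1 := by rw [sum_filter_cnt]; rfl
    _ ≤ ∑ n : Counts q N with n ∈ V, Real.exp (-(N * β * v)) := by
        refine Finset.sum_le_sum fun n hn => (levelWeight_le hβ hN n.sum_eq).trans ?_
        refine Real.exp_le_exp.mpr (neg_le_neg (mul_le_mul_of_nonneg_left ?_ (by positivity)))
        exact (hV n).mp (Finset.mem_filter.mp hn).2
    _ ≤ _ := by
        rw [Finset.sum_const, nsmul_eq_mul]
        refine mul_le_mul_of_nonneg_right ?_ (Real.exp_pos _).le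
        have := (Finset.card_filter_le (Finset.univ : Finset (Counts q N)) (· ∈ V)).trans
          (card_counts_le q N)
        exact_mod_cast this

lemma dist_freq_count_le {σ η : Config q N} (h : hammingDist σ η = 1) :
    dist (freq N (count σ)) (freq N (count η)) ≤ 1 / N := by
  have h1 : (Finset.univ.filter fun i => σ i ≠ η i).card = 1 := h
  obtain ⟨i, hi⟩ := Finset.card_eq_one.mp h1
  have hi' : σ i ≠ η i := by
    have : i ∈ Finset.univ.filter fun i => σ i ≠ η i := by rw [hi]; simp
    simpa using this
  have hη : η = Function.update σ i (η i) := by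
    funext j
    by_cases hj : j = i
    · subst hj; simp
    · have : j ∉ (Finset.univ.filter fun i => σ i ≠ η i) := by rw [hi]; simpa using hj
      rw [Function.update_of_ne hj]
      simpa [eq_comm] using this
  have hpos : 0 < count σ (σ i) := Finset.card_pos.mpr ⟨i, by simp⟩
  rw [hη, count_update rfl hi']
  refine (dist_pi_le_iff (by positivity)).mpr fun k => ?_
  simp only [freq, Real.dist_eq, ← sub_div, abs_div, Nat.abs_cast]
  refine div_le_div_of_nonneg_right ?_ (Nat.cast_nonneg _)
  by_cases h1 : k = σ i
  · rw [h1, move_left, Nat.cast_sub hpos]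
    simp
  by_cases h2 : k = η i
  · rw [h2, move_right _ hi']
    simp
  · rw [move_of_ne _ h1 h2]; simp

lemma conduct_le (hβ : 0 ≤ β) (g : ℕ → ℕ → ℝ) (σ η : Config q N) :
    conduct β g σ η ≤ if hammingDist σ η = 1 then ((N : ℝ) * q)⁻¹ * weight β g σ else 0 := by
  unfold conduct
  split_ifs
  · refine mul_le_mul_of_nonneg_left (Real.exp_le_exp.mpr ?_) (by positivity)
    have := mul_le_mul_of_nonneg_left (le_max_left (hamiltonian g σ) (hamiltonian g η)) hβ
    linarith
  · exact le_rfl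

/-- The Dirichlet form of an indicator is bounded by the weight of the boundary. -/
lemma dirichlet_indicator_le (hβ : 0 ≤ β) (g : ℕ → ℕ → ℝ) {U : Set (Config q N)}
    {T : Finset (Config q N)}
    (hT : ∀ σ η, hammingDist σ η = 1 → (σ ∈ U ∧ η ∉ U ∨ σ ∉ U ∧ η ∈ U) → σ ∈ T) :
    dirichlet (conduct β g) (U.indicator 1) (U.indicator 1) ≤ ∑ σ ∈ T, weight β g σ := by
  classical
  have hterm : ∀ σ η : Config q N, conduct β g σ η *
      ((U.indicator 1 σ - U.indicator 1 η) * (U.indicator 1 σ - U.indicator 1 η)) ≤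
      if σ ∈ T then (if hammingDist σ η = 1 then ((N : ℝ) * q)⁻¹ * weight β g σ else 0)
        else 0 := by
    intro σ η
    have hc := conduct_le hβ g σ η
    have hc0 := (isConductance_conduct (q := q) (N := N) β g).nonneg σ η
    have hw := weight_pos β g σ
    have hnn : (0 : ℝ) ≤ if σ ∈ T then
        (if hammingDist σ η = 1 then ((N : ℝ) * q)⁻¹ * weight β g σ else 0) else 0 := by
      split_ifs <;> positivity
    by_cases h1 : hammingDist σ η = 1
    · by_cases h2 : (σ ∈ U ∧ η ∉ U ∨ σ ∉ U ∧ η ∈ U)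
      · have hsq : (U.indicator (1 : Config q N → ℝ) σ - U.indicator 1 η) *
            (U.indicator 1 σ - U.indicator 1 η) = 1 := by
          rcases h2 with ⟨h3, h4⟩ | ⟨h3, h4⟩ <;> simp [h3, h4]
        rw [hsq, mul_one, if_pos (hT σ η h1 h2)]
        exact hc
      · have hsq : (U.indicator (1 : Config q N → ℝ) σ - U.indicator 1 η) = 0 := by
          by_cases h3 : σ ∈ U <;> by_cases h4 : η ∈ U <;> simp [h3, h4] <;> tauto
        rw [hsq]; simpa using hnn
    · rw [conduct, if_neg h1, zero_mul]; exact hnn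
  calc dirichlet (conduct β g) (U.indicator 1) (U.indicator 1)
      ≤ (1 / 2) * ∑ σ : Config q N, ∑ η : Config q N, (if σ ∈ T then
        (if hammingDist σ η = 1 then ((N : ℝ) * q)⁻¹ * weight β g σ else 0) else 0) :=
        mul_le_mul_of_nonneg_left (Finset.sum_le_sum fun σ _ => Finset.sum_le_sum fun η _ =>
          hterm σ η) (by norm_num)
    _ ≤ (1 / 2) * ∑ σ : Config q N, (if σ ∈ T then weight β g σ else 0) := by
        refine mul_le_mul_of_nonneg_left (Finset.sum_le_sum fun σ _ => ?_) (by norm_num)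
        split_ifs
        · rw [← Finset.sum_filter, Finset.sum_const, nsmul_eq_mul, ← mul_assoc]
          refine mul_le_of_le_one_left (weight_pos β g σ).le ?_
          calc _ ≤ ((N : ℝ) * q) * ((N : ℝ) * q)⁻¹ := by
                refine mul_le_mul_of_nonneg_right ?_ (by positivity)
                exact_mod_cast card_neighbours_le σ
            _ ≤ 1 := mul_inv_le_one
        · simp
    _ ≤ ∑ σ ∈ T, weight β g σ := by
        rw [← Finset.sum_filter, Finset.filter_mem_eq_inter, Finset.univ_inter]
        have : 0 ≤ ∑ σ ∈ T, weight β g σ := Finset.sum_nonneg fun σ _ => (weight_pos β g σ).le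
        linarith

/-! ### Perturbation of the mean-field model -/

lemma weight_le_of_abs_le (hβ : 0 ≤ β) {g g' : ℕ → ℕ → ℝ} {σ : Config q N} {d : ℝ}
    (h : |hamiltonian g σ - hamiltonian g' σ| ≤ d) :
    weight β g σ ≤ Real.exp (β * d) * weight β g' σ := by
  rw [weight, weight, ← Real.exp_add]
  refine Real.exp_le_exp.mpr ?_
  have := mul_le_mul_of_nonneg_left (abs_le.mp h).1 hβ
  linarith

lemma conduct_le_of_abs_le (hβ : 0 ≤ β) {g g' : ℕ → ℕ → ℝ} {d : ℝ}
    (h : ∀ σ : Config q N, |hamiltonian g σ - hamiltonian g' σ| ≤ d) (σ η : Config q N) :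
    conduct β g σ η ≤ Real.exp (β * d) * conduct β g' σ η := by
  unfold conduct
  split_ifs
  · rw [mul_left_comm, ← Real.exp_add]
    refine mul_le_mul_of_nonneg_left (Real.exp_le_exp.mpr ?_) (by positivity)
    have h1 := (abs_le.mp (h σ)).1
    have h2 := (abs_le.mp (h η)).1
    have h3 : max (hamiltonian g' σ) (hamiltonian g' η) ≤
        max (hamiltonian g σ) (hamiltonian g η) + d := by
      refine max_le ?_ ?_
      · linarith [le_max_left (hamiltonian g σ) (hamiltonian g η)]
      · linarith [le_max_right (hamiltonian g σ) (hamiltonian g η)]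
    have := mul_le_mul_of_nonneg_left h3 hβ
    linarith
  · rw [mul_zero]

lemma eventually_mul_pow_mul_exp_le (C : ℝ) (p : ℕ) {c : ℝ} (hc : 0 < c) :
    ∀ᶠ N : ℕ in atTop, C * ((N : ℝ) + 1) ^ p * Real.exp (-(c * N)) ≤ 1 / 4 := by
  have h1 : Tendsto (fun x : ℝ => (C * (c⁻¹ ^ p * Real.exp c)) *
      (x ^ p * Real.exp (-x))) atTop (𝓝 ((C * (c⁻¹ ^ p * Real.exp c)) * 0)) :=
    (Real.tendsto_pow_mul_exp_neg_atTop_nhds_zero p).const_mul _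
  rw [mul_zero] at h1
  have h2 : Tendsto (fun N : ℕ => c * ((N : ℝ) + 1)) atTop atTop :=
    (tendsto_natCast_atTop_atTop.atTop_add tendsto_const_nhds).const_mul_atTop hc
  filter_upwards [(h1.comp h2).eventually (ge_mem_nhds (show (0 : ℝ) < 1 / 4 by norm_num))] with N hN
  refine le_trans (le_of_eq ?_) hN
  simp only [Function.comp]
  rw [mul_pow, show -(c * ((N : ℝ) + 1)) = -c + -(c * N) by ring, Real.exp_add, Real.exp_neg c]
  have h3 : Real.exp c * (Real.exp c)⁻¹ = 1 := mul_inv_cancel₀ (Real.exp_pos c).ne'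
  have h4 : c⁻¹ ^ p * c ^ p = 1 := by rw [← mul_pow, inv_mul_cancel₀ hc.ne', one_pow]
  linear_combination (-(C * ((N : ℝ) + 1) ^ p * Real.exp (-(c * N)))) * (h3 * c⁻¹ ^ p * c ^ p + h4)

end Barrier

end Potts

end

noncomputable section

namespace Potts

/-! ### Localization of the equilibrium potential -/

section Localization

/-- If Poincaré inequalities hold on `VA` relative to `A` and on `VB` relative to `B`, the
equilibrium potential is close to one on `VA`, and the rest does not contribute. -/
lemma IsEquilibrium.sum_mul_mem {S : Type*} [Fintype S] {c : S → S → ℝ} (hc : IsConductance c)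
    {A B : Set S} (hA : A.Nonempty) (hB : B.Nonempty) {h : S → ℝ} (hh : IsEquilibrium c A B h)
    {w : S → ℝ} (hw : ∀ x, 0 ≤ w x) {VA VB R : Finset S} (hAB : Disjoint VA VB)
    (hR : ∀ x, x ∉ VA → x ∉ VB → x ∈ R) {K : ℝ} (hK0 : 0 ≤ K)
    (hKA : ∀ f : S → ℝ, (∀ x ∈ A, f x = 0) → ∑ x ∈ VA, w x * f x ^ 2 ≤ K * dirichlet c f f)
    (hKB : ∀ f : S → ℝ, (∀ x ∈ B, f x = 0) → ∑ x ∈ VB, w x * f x ^ 2 ≤ K * dirichlet c f f)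
    {n : ℕ} (h1 : (1 / 2) ^ n * ∑ x, w x ≤ 1 / 4 * ∑ x ∈ VA, w x)
    (h2 : 2 * n * K * dirichlet c h h ≤ 1 / 4 * ∑ x ∈ VA, w x)
    (h3 : ∑ x ∈ R, w x ≤ 1 / 4 * ∑ x ∈ VA, w x) :
    1 / 2 * ∑ x ∈ VA, w x ≤ ∑ x, w x * h x ∧ ∑ x, w x * h x ≤ 2 * ∑ x ∈ VA, w x := by
  classical
  have hu := hh.mem_unit hc hA
  have hnn : ∀ x, 0 ≤ w x * h x := fun x => mul_nonneg (hw x) (hu x).1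
  have hle : ∀ x, w x * h x ≤ w x := fun x => mul_le_of_le_one_right (hw x) (hu x).2
  have hsub : ∀ V : Finset S, (1 / 2) ^ n * ∑ x ∈ V, w x ≤ (1 / 2 : ℝ) ^ n * ∑ x, w x := fun V =>
    mul_le_mul_of_nonneg_left (Finset.sum_le_sum_of_subset_of_nonneg (Finset.subset_univ _)
      fun x _ _ => hw x) (by positivity)
  have hZ : 0 ≤ ∑ x ∈ VA, w x := Finset.sum_nonneg fun x _ => hw x
  constructor
  -- `1 - h` is the potential with the boundary sets exchanged and has the same energy, so the bound
  -- for `h` on the basin of `B` transfers to the deficit of `h` on the basin of `A`.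
  · have h4 := hh.symm.sum_mul_le hc hB hw hKA hK0 n
    rw [dirichlet_one_sub] at h4
    have h5 : ∑ x ∈ VA, w x * (1 - h x) = ∑ x ∈ VA, w x - ∑ x ∈ VA, w x * h x := by
      rw [← Finset.sum_sub_distrib]
      exact Finset.sum_congr rfl fun x _ => by ring
    have h6 : ∑ x ∈ VA, w x * h x ≤ ∑ x, w x * h x :=
      Finset.sum_le_sum_of_subset_of_nonneg (Finset.subset_univ _) fun x _ _ => hnn x
    have := hsub VA
    linarith
  · have h4 := hh.sum_mul_le hc hA hw hKB hK0 n
    have h5 : ∑ x, w x * h x ≤ ∑ x ∈ VA ∪ VB ∪ R, w x * h x :=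
      Finset.sum_le_sum_of_subset_of_nonneg (fun x _ => by
        by_cases hxA : x ∈ VA
        · simp [hxA]
        by_cases hxB : x ∈ VB
        · simp [hxB]
        simp [hR x hxA hxB]) fun x _ _ => hnn x
    have h6 : ∑ x ∈ VA ∪ VB ∪ R, w x * h x ≤
        ∑ x ∈ VA, w x * h x + ∑ x ∈ VB, w x * h x + ∑ x ∈ R, w x * h x := by
      rw [← Finset.sum_union hAB, ← Finset.sum_union_inter]
      exact le_add_of_nonneg_right (Finset.sum_nonneg fun x _ => hnn x)
    have h7 : ∑ x ∈ VA, w x * h x ≤ ∑ x ∈ VA, w x := Finset.sum_le_sum fun x _ => hle x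
    have h8 : ∑ x ∈ R, w x * h x ≤ ∑ x ∈ R, w x := Finset.sum_le_sum fun x _ => hle x
    have := hsub VB
    linarith

variable {q N : ℕ} {β : ℝ} {IA IB : Set (Option (Fin q))}

lemma freeEnergy_le_of_reachable {v : ℝ} {n k : Counts q N}
    (h : (countGraph q β N v).Reachable n k) (hn : freeEnergy β (freq N n.1) ≤ v) :
    freeEnergy β (freq N k.1) ≤ v := by
  obtain ⟨p⟩ := h.symm
  cases p with
  | nil => exact hn
  | cons hadj _ => exact hadj.2.1

lemma exists_abs_freeEnergy_le (β : ℝ) :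
    ∃ L : ℝ, ∀ x ∈ stdSimplex ℝ (Fin q), |freeEnergy β x| ≤ L := by
  obtain ⟨L, hL⟩ := (isCompact_stdSimplex ℝ (Fin q)).exists_bound_of_continuousOn
    (continuous_freeEnergy β).continuousOn
  exact ⟨L, fun x hx => by simpa using hL x hx⟩

lemma mem_iUnion_level_iff {I : Set (Option (Fin q))} {m : Option (Fin q) → Fin q → ℝ}
    {σ : Config q N} :
    σ ∈ (⋃ i ∈ I, level N (m i)) ↔ ∃ i ∈ I, freq N (count σ) = m i := by
  simp only [Set.mem_iUnion, level, Set.mem_ofPred_eq, exists_prop, empirical_eq]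

/-- The capacity is bounded by the height of the barrier around the starting wells. -/
lemma capacity_meanField_le (hβ : 0 < β) (hN : N ≠ 0) {r v : ℝ}
    (hbar : ∀ x ∈ stdSimplex ℝ (Fin q), (∃ j ∈ IA, dist x (minPt q β j) ≤ 2 * r) →
      (∀ j ∈ IA, r / 2 ≤ dist x (minPt q β j)) → v ≤ freeEnergy β x)
    (hsep : ∀ i ∈ IA, ∀ j ∈ IB, 4 * r ≤ dist (minPt q β j) (minPt q β i))
    {m : Option (Fin q) → Fin q → ℝ} (hm : ∀ i, dist (m i) (minPt q β i) < r / 2)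
    (hNr : 1 / (N : ℝ) < r / 2) (hA : (⋃ i ∈ IA, level N (m i)).Nonempty)
    (hAB : Disjoint (⋃ i ∈ IA, level N (m i)) (⋃ i ∈ IB, level N (m i))) :
    capacity (conduct β meanField) (⋃ i ∈ IA, level N (m i)) (⋃ i ∈ IB, level N (m i)) ≤
      ((N : ℝ) + 1) ^ q * Real.exp (-(N * β * v)) := by
  classical
  have hc := isConductance_conduct (q := q) (N := N) β meanField
  have hr : 0 < r := by
    have : 0 ≤ 1 / (N : ℝ) := by positivity
    linarith
  -- The test function is the indicator of the `r`-neighbourhood of the starting wells. One spin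
  -- flip moves the frequencies by at most `1 / N < r / 2`, so its boundary lies in the collar.
  set U : Set (Config q N) := {σ | ∃ i ∈ IA, dist (freq N (count σ)) (minPt q β i) < r} with hU
  refine ((isEquilibrium_equilibrium hc hA hAB).dirichlet_le hc (f := U.indicator 1) ?_ ?_).trans
    ((dirichlet_indicator_le hβ.le meanField (U := U)
      (T := Finset.univ.filter fun σ => v ≤ freeEnergy β (freq N (count σ))) ?_).trans
      (sum_weight_le_of_le hβ hN fun σ hσ => (Finset.mem_filter.mp hσ).2))
  · intro σ hσ
    obtain ⟨i, hi, he⟩ := mem_iUnion_level_iff.mp hσ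
    refine Set.indicator_of_mem (show σ ∈ U from ⟨i, hi, ?_⟩) _
    rw [he]; linarith [hm i]
  · intro σ hσ
    obtain ⟨j, hj, he⟩ := mem_iUnion_level_iff.mp hσ
    refine Set.indicator_of_notMem (fun hσU => ?_) _
    obtain ⟨i, hi, hd⟩ := hσU
    rw [he] at hd
    have h1 := hsep i hi j hj
    have h2 := dist_triangle_left (minPt q β j) (minPt q β i) (m j)
    have h3 := hm j
    linarith
  · intro σ η hd hcases
    have hdist := dist_freq_count_le hd
    refine Finset.mem_filter.mpr ⟨Finset.mem_univ _, hbar _ (freq_mem hN (sum_count σ)) ?_ ?_⟩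
    · rcases hcases with ⟨⟨j, hj, h1⟩, -⟩ | ⟨-, ⟨j, hj, h1⟩⟩
      · exact ⟨j, hj, by linarith⟩
      · refine ⟨j, hj, ?_⟩
        have := dist_triangle (freq N (count σ)) (freq N (count η)) (minPt q β j)
        linarith
    · intro j hj
      rcases hcases with ⟨-, h1⟩ | ⟨h1, -⟩
      · have h2 : r ≤ dist (freq N (count η)) (minPt q β j) := not_lt.mp fun h => h1 ⟨j, hj, h⟩
        have := dist_triangle_left (freq N (count η)) (minPt q β j) (freq N (count σ))
        linarith
      · have h2 : r ≤ dist (freq N (count σ)) (minPt q β j) := not_lt.mp fun h => h1 ⟨j, hj, h⟩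
        linarith

/-- The Poincaré inequality is stable under small perturbations of the Hamiltonian. -/
lemma sum_weight_mul_sq_le_of_abs_le (hβ : 0 < β) (hN : N ≠ 0) {ε d : ℝ} {V T : Set (Counts q N)}
    [DecidablePred fun σ : Config q N => cnt σ ∈ V]
    (hV : ∀ n ∈ V, ∃ m ∈ T, (countGraph q β N (freeEnergy β (freq N n.1) + ε)).Reachable n m)
    {g : ℕ → ℕ → ℝ} (hg : ∀ σ : Config q N, |hamiltonian g σ - hamiltonian meanField σ| ≤ d)
    {f : Config q N → ℝ} (hf : ∀ σ, cnt σ ∈ T → f σ = 0) :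
    ∑ σ with cnt σ ∈ V, weight β g σ * f σ ^ 2 ≤
      Real.exp (β * d) ^ 2 * poincareConst q β N ε * dirichlet (conduct β g) f f := by
  classical
  have hg' : ∀ σ : Config q N, |hamiltonian meanField σ - hamiltonian g σ| ≤ d := fun σ => by
    rw [abs_sub_comm]; exact hg σ
  have h1 := sum_weight_mul_sq_le hβ hN hV (f := f) (fun k hk σ hσ => hf σ (by
    have : cnt σ = k := Subtype.ext (mem_fiber.mp hσ)
    rwa [this]))
  rw [← sum_filter_cnt] at h1
  have h2 := dirichlet_mono (conduct_le_of_abs_le hβ.le hg') f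
  calc ∑ σ with cnt σ ∈ V, weight β g σ * f σ ^ 2
      ≤ ∑ σ with cnt σ ∈ V, Real.exp (β * d) * (weight β meanField σ * f σ ^ 2) := by
        refine Finset.sum_le_sum fun σ _ => ?_
        rw [← mul_assoc]
        exact mul_le_mul_of_nonneg_right (weight_le_of_abs_le hβ.le (hg σ)) (sq_nonneg _)
    _ = Real.exp (β * d) * ∑ σ with cnt σ ∈ V, weight β meanField σ * f σ ^ 2 := by
        rw [Finset.mul_sum]
    _ ≤ Real.exp (β * d) * (poincareConst q β N ε * (Real.exp (β * d) *
          dirichlet (conduct β g) f f)) :=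
        mul_le_mul_of_nonneg_left (h1.trans
          (mul_le_mul_of_nonneg_left h2 (poincareConst_nonneg _ _ _ _))) (Real.exp_pos _).le
    _ = _ := by ring

lemma sum_weight_le_of_abs_le (hβ : 0 < β) (hN : N ≠ 0) {v d : ℝ} {g : ℕ → ℕ → ℝ}
    (hg : ∀ σ : Config q N, |hamiltonian g σ - hamiltonian meanField σ| ≤ d)
    {T : Finset (Config q N)} (hT : ∀ σ ∈ T, v ≤ freeEnergy β (freq N (count σ))) :
    ∑ σ ∈ T, weight β g σ ≤
      Real.exp (β * d) * (((N : ℝ) + 1) ^ q * Real.exp (-(N * β * v))) := by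
  refine le_trans ?_ (mul_le_mul_of_nonneg_left (sum_weight_le_of_le hβ hN hT) (Real.exp_pos _).le)
  rw [Finset.mul_sum]
  exact Finset.sum_le_sum fun σ _ => weight_le_of_abs_le hβ.le (hg σ)

lemma le_sum_weight_of_abs_le (hβ : 0 < β) (hN : N ≠ 0) {v d : ℝ} {g : ℕ → ℕ → ℝ}
    (hg : ∀ σ : Config q N, |hamiltonian g σ - hamiltonian meanField σ| ≤ d)
    {n : Counts q N} (hn : freeEnergy β (freq N n.1) ≤ v)
    {T : Finset (Config q N)} (hT : fiber N n.1 ⊆ T) :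
    Real.exp (-(N * β * v)) ≤
      Real.exp (β * d) * (Real.exp (β / 2) * ((N : ℝ) + 1) ^ q) * ∑ σ ∈ T, weight β g σ := by
  have hg' : ∀ σ : Config q N, |hamiltonian meanField σ - hamiltonian g σ| ≤ d := fun σ => by
    rw [abs_sub_comm]; exact hg σ
  calc Real.exp (-(N * β * v)) ≤ Real.exp (-(N * β * freeEnergy β (freq N n.1))) :=
        Real.exp_le_exp.mpr (neg_le_neg (mul_le_mul_of_nonneg_left hn (by positivity)))
    _ ≤ Real.exp (β / 2) * ((N : ℝ) + 1) ^ q * levelWeight β N n.1 :=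
        le_levelWeight hβ hN n.sum_eq
    _ ≤ Real.exp (β / 2) * ((N : ℝ) + 1) ^ q * (Real.exp (β * d) * ∑ σ ∈ T, weight β g σ) := by
        refine mul_le_mul_of_nonneg_left ?_ (by positivity)
        rw [Finset.mul_sum]
        exact (Finset.sum_le_sum fun σ _ => weight_le_of_abs_le hβ.le (hg' σ)).trans
          (Finset.sum_le_sum_of_subset_of_nonneg hT fun σ _ _ =>
            (mul_pos (Real.exp_pos _) (weight_pos β g σ)).le)
    _ = _ := by ring

end Localization

end Potts

end

noncomputable section

namespace Potts

/-! ### Localization on a valley for couplings near the mean-field ones -/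

section Localization

variable {q N : ℕ} {β : ℝ} {IA IB : Set (Option (Fin q))}

/-- Exponent bookkeeping: of the `2 * β * ε * N`, one half pays for the height `ε` of the lattice
level above the minimum, the other for the perturbation of the Hamiltonian. The surplus `c` then
beats the polynomials. -/
lemma le_quarter_mul {N : ℕ} {β F ε C c X Z : ℝ} {p q : ℕ} (hC : 0 ≤ C)
    (hX : X ≤ C * ((N : ℝ) + 1) ^ p * Real.exp (-(c * N) - N * β * F - 2 * β * ε * N))
    (hZ0 : 0 ≤ Z)
    (hZ : Real.exp (-(N * β * (F + ε))) ≤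
      Real.exp (β * (ε * N)) * (Real.exp (β / 2) * ((N : ℝ) + 1) ^ q) * Z)
    (hev : C * Real.exp (β / 2) * ((N : ℝ) + 1) ^ (p + q) * Real.exp (-(c * N)) ≤ 1 / 4) :
    X ≤ 1 / 4 * Z := by
  have h1 : Real.exp (-(c * N) - N * β * F - 2 * β * ε * N) =
      Real.exp (-(c * N)) * (Real.exp (-(β * (ε * N))) * Real.exp (-(N * β * (F + ε)))) := by
    rw [← Real.exp_add, ← Real.exp_add]; congr 1; ring
  have h2 : Real.exp (-(β * (ε * N))) * Real.exp (β * (ε * N)) = 1 := by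
    rw [← Real.exp_add, neg_add_cancel, Real.exp_zero]
  calc X ≤ C * ((N : ℝ) + 1) ^ p * Real.exp (-(c * N) - N * β * F - 2 * β * ε * N) := hX
    _ = C * ((N : ℝ) + 1) ^ p * Real.exp (-(c * N)) * Real.exp (-(β * (ε * N))) *
          Real.exp (-(N * β * (F + ε))) := by rw [h1]; ring
    _ ≤ C * ((N : ℝ) + 1) ^ p * Real.exp (-(c * N)) * Real.exp (-(β * (ε * N))) *
          (Real.exp (β * (ε * N)) * (Real.exp (β / 2) * ((N : ℝ) + 1) ^ q) * Z) :=
        mul_le_mul_of_nonneg_left hZ (by positivity)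
    _ = C * Real.exp (β / 2) * ((N : ℝ) + 1) ^ (p + q) * Real.exp (-(c * N)) * Z *
          (Real.exp (-(β * (ε * N))) * Real.exp (β * (ε * N))) := by rw [pow_add]; ring
    _ ≤ 1 / 4 * Z := by rw [h2, mul_one]; exact mul_le_mul_of_nonneg_right hev hZ0

/-- For couplings close to the mean-field ones, the mean of the equilibrium potential is
comparable to the weight of a fixed valley. -/
theorem IsWellPair.exists_valley (h : IsWellPair q β IA IB) (hq : 2 ≤ q) (hβ : 0 < β) :
    ∃ d > 0, ∃ N₀ : ℕ, ∀ N ≥ N₀, ∀ m : Option (Fin q) → Fin q → ℝ,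
      (∀ i, IsClosestLatticePt N (minPt q β i) (m i)) → ∀ A B : Set (Config q N),
      A = (⋃ i ∈ IA, level N (m i)) → B = (⋃ i ∈ IB, level N (m i)) →
      A.Nonempty ∧ B.Nonempty ∧ Disjoint A B ∧ ∃ V : Finset (Config q N), V.Nonempty ∧
        ∀ g : ℕ → ℕ → ℝ,
          (∀ σ : Config q N, |hamiltonian g σ - hamiltonian meanField σ| ≤ d * N) →
          1 / 2 * ∑ σ ∈ V, weight β g σ ≤
              ∑ σ, weight β g σ * equilibrium (conduct β g) A B σ ∧
            ∑ σ, weight β g σ * equilibrium (conduct β g) A B σ ≤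
              2 * ∑ σ ∈ V, weight β g σ := by
  classical
  obtain ⟨r, hr, δ, hδ, hbar, hsep, hdeep⟩ := h.exists_barrier
  obtain ⟨i₀, hi₀⟩ := h.nonempty_left
  obtain ⟨j₀, hj₀⟩ := h.nonempty_right
  -- A fixed fraction of the barrier covers all losses: climbs along paths, lattice errors and the
  -- perturbation of the Hamiltonian, for which `d = ε` is chosen as well.
  obtain ⟨ε, hεδ⟩ : ∃ ε, δ = 20 * ε := ⟨δ / 20, by ring⟩
  subst hεδ
  have hε : 0 < ε := by linarith
  set F := freeEnergy β (minPt q β i₀) with hF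
  obtain ⟨L, hL⟩ := exists_abs_freeEnergy_le (q := q) β
  -- Chosen so that after `M * N` dyadic scales the remainder beats the ratio of the total mass to
  -- the weight of the valley.
  obtain ⟨M, hM⟩ := exists_nat_ge ((β * (3 * ε + 2 * L) + 1) / Real.log 2)
  obtain ⟨ρ, hρ, hun⟩ := exists_uniform (q := q) β hε
  obtain ⟨N₁, hN₁⟩ := exists_reachable_minPt hq h.eq_minPt h.mem hε
  have hlog2 : 0 < Real.log 2 := Real.log_pos (by norm_num)
  rw [div_le_iff₀ hlog2] at hM
  have hq2 : (2 : ℝ) ≤ q := by exact_mod_cast hq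
  have hev : ∀ᶠ N : ℕ in atTop, (q : ℝ) ^ 2 / N < min (r / 2) ρ :=
    (tendsto_const_div_atTop_nhds_zero_nat ((q : ℝ) ^ 2)).eventually
      (gt_mem_nhds (lt_min (by linarith) hρ))
  have hβε : 0 < β * ε := mul_pos hβ hε
  have hev1 := eventually_mul_pow_mul_exp_le (1 * Real.exp (β / 2)) (q + q) one_pos
  have hev2 := eventually_mul_pow_mul_exp_le (4 * M * q * Real.exp (β / 2) * Real.exp (β / 2))
    (5 * q + 2 + q) (c := 14 * (β * ε)) (by linarith)
  have hev3 := eventually_mul_pow_mul_exp_le (1 * Real.exp (β / 2)) (q + q) (c := 15 * (β * ε))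
    (by linarith)
  obtain ⟨N₂, hN₂⟩ := eventually_atTop.mp
    (hev.and (hev1.and (hev2.and (hev3.and (eventually_ge_atTop 1)))))
  refine ⟨ε, hε, max N₁ N₂, fun N hN m hm A B hAeq hBeq => ?_⟩
  obtain ⟨hsmall, hq1, hq2', hq3, hN1⟩ := hN₂ N ((le_max_right _ _).trans hN)
  have hreach := hN₁ N ((le_max_left _ _).trans hN) m hm
  have hN0 : N ≠ 0 := by omega
  have hNpos : (0 : ℝ) < N := by positivity
  have hmd : ∀ i, dist (m i) (minPt q β i) < min (r / 2) ρ := fun i => by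
    obtain ⟨k, -, hk⟩ := exists_counts_of_isClosestLatticePt hq hN0 (h.mem i) (hm i)
    exact hk.trans_lt hsmall
  have hNr : 1 / (N : ℝ) < r / 2 := by
    refine lt_of_le_of_lt ?_ (hsmall.trans_le (min_le_left _ _))
    exact div_le_div_of_nonneg_right (by nlinarith) hNpos.le
  have hmr : ∀ i, dist (m i) (minPt q β i) < r / 2 := fun i =>
    (hmd i).trans_le (min_le_left _ _)
  have hcnt : ∀ i, ∃ k : Counts q N, freq N k.1 = m i := fun i => by
    obtain ⟨k, hk, -⟩ := exists_counts_of_isClosestLatticePt hq hN0 (h.mem i) (hm i)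
    exact ⟨k, hk⟩
  have hlev : ∀ i, ∃ σ : Config q N, freq N (count σ) = m i := fun i => by
    obtain ⟨k, hk⟩ := hcnt i
    obtain ⟨σ, hσ⟩ := fiber_nonempty hN0 k.sum_eq
    exact ⟨σ, by rw [mem_fiber.mp hσ, hk]⟩
  have hA : A.Nonempty := by
    obtain ⟨σ, hσ⟩ := hlev i₀
    exact ⟨σ, hAeq ▸ mem_iUnion_level_iff.mpr ⟨i₀, hi₀, hσ⟩⟩
  have hB : B.Nonempty := by
    obtain ⟨σ, hσ⟩ := hlev j₀
    exact ⟨σ, hBeq ▸ mem_iUnion_level_iff.mpr ⟨j₀, hj₀, hσ⟩⟩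
  have hAB : Disjoint A B := by
    rw [Set.disjoint_left, hAeq, hBeq]
    intro σ h1 h2
    obtain ⟨i, hi, hi'⟩ := mem_iUnion_level_iff.mp h1
    obtain ⟨j, hj, hj'⟩ := mem_iUnion_level_iff.mp h2
    have h3 := hsep i hi j hj
    have h4 := dist_triangle_left (minPt q β j) (minPt q β i) (m j)
    have h5 := hmr i
    rw [← hi', hj'] at h5
    linarith [hmr j]
  obtain ⟨T, hT⟩ : ∃ T : Set (Option (Fin q)) → Set (Counts q N),
      ∀ I k, k ∈ T I ↔ ∃ i ∈ I, freq N k.1 = m i := ⟨fun I => {k | ∃ i ∈ I, freq N k.1 = m i},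
    fun _ _ => Iff.rfl⟩
  -- `W I` is the basin of the minima in `I`, read off from the mean-field colour counts; this is
  -- why one valley serves all couplings. Basins may overlap, and the valley takes precedence over
  -- the basin of `B` below.
  obtain ⟨W, hW⟩ : ∃ W : Set (Option (Fin q)) → Set (Counts q N), ∀ I n, n ∈ W I ↔ ∃ k ∈ T I,
      (countGraph q β N (freeEnergy β (freq N n.1) + ε)).Reachable n k :=
    ⟨fun I => {n | ∃ k ∈ T I,
      (countGraph q β N (freeEnergy β (freq N n.1) + ε)).Reachable n k}, fun _ _ => Iff.rfl⟩
  have hcntmem : ∀ I (σ : Config q N), cnt σ ∈ T I ↔ σ ∈ ⋃ i ∈ I, level N (m i) := fun I σ => by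
    rw [hT, mem_iUnion_level_iff]; rfl
  obtain ⟨kA, hkA⟩ := hcnt i₀
  have hkW : kA ∈ W IA := (hW _ _).mpr ⟨kA, (hT _ _).mpr ⟨i₀, hi₀, hkA⟩, SimpleGraph.Reachable.refl _⟩
  have hfib : fiber N kA.1 ⊆ Finset.univ.filter fun σ : Config q N => cnt σ ∈ W IA := by
    intro σ hσ
    have : cnt σ = kA := Subtype.ext (mem_fiber.mp hσ)
    exact Finset.mem_filter.mpr ⟨Finset.mem_univ _, this ▸ hkW⟩
  refine ⟨hA, hB, hAB, Finset.univ.filter fun σ => cnt σ ∈ W IA, ?_, fun g hg => ?_⟩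
  · exact (fiber_nonempty hN0 kA.sum_eq).mono hfib
  have hc := isConductance_conduct (q := q) (N := N) β g
  have hh := isEquilibrium_equilibrium hc hA hAB
  have hFA : freeEnergy β (freq N kA.1) ≤ F + ε := by
    rw [hkA]
    refine (hun _ ?_ _ (h.mem i₀) ((hmd i₀).trans_le (min_le_right _ _))).le
    rw [← hkA]; exact freq_mem hN0 kA.sum_eq
  have hZ := le_sum_weight_of_abs_le hβ hN0 hg hFA hfib
  have hZ0 : 0 ≤ ∑ σ with cnt σ ∈ W IA, weight β g σ :=
    Finset.sum_nonneg fun σ _ => (weight_pos β g σ).le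
  have hP1 : (1 : ℝ) ≤ (N : ℝ) + 1 := by linarith
  refine hh.sum_mul_mem hc hA hB (fun σ => (weight_pos β g σ).le)
    (VB := Finset.univ.filter fun σ => cnt σ ∈ W IB \ W IA)
    (R := Finset.univ.filter fun σ => cnt σ ∉ W IA ∧ cnt σ ∉ W IB)
    (K := Real.exp (β * (ε * N)) ^ 2 * poincareConst q β N ε) (n := M * N) ?_ ?_ ?_ ?_ ?_ ?_ ?_ ?_
  · rw [Finset.disjoint_filter]
    exact fun σ _ h1 h2 => h2.2 h1
  · intro σ h1 h2
    simp only [Finset.mem_filter, Finset.mem_univ, true_and, Set.mem_sdiff, not_and, not_not] at h1 h2 ⊢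
    exact ⟨h1, fun h3 => h1 (h2 h3)⟩
  · exact mul_nonneg (by positivity) (poincareConst_nonneg _ _ _ _)
  · intro f hf
    refine sum_weight_mul_sq_le_of_abs_le hβ hN0 (T := T IA) (fun n hn => (hW _ _).mp hn) hg
      fun σ hσ => hf σ ?_
    rw [hAeq]; exact (hcntmem _ _).mp hσ
  · intro f hf
    refine sum_weight_mul_sq_le_of_abs_le hβ hN0 (T := T IB) (fun n hn => (hW _ _).mp hn.1) hg
      fun σ hσ => hf σ ?_
    rw [hBeq]; exact (hcntmem _ _).mp hσ
  · refine le_quarter_mul (C := 1) (c := 1) (p := q) zero_le_one ?_ hZ0 hZ hq1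
    have h1 := sum_weight_le_of_abs_le hβ hN0 hg (T := Finset.univ) (v := -L)
      fun σ _ => (abs_le.mp (hL _ (freq_mem hN0 (sum_count σ)))).1
    have h2 : (1 / 2 : ℝ) ^ (M * N) = Real.exp (-(Real.log 2 * (M * N))) := by
      rw [← Real.exp_log (show (0 : ℝ) < (1 / 2) ^ (M * N) by positivity), Real.log_pow, one_div,
        Real.log_inv]
      congr 1; push_cast; ring
    rw [h2]
    calc _ ≤ Real.exp (-(Real.log 2 * (M * N))) *
          (Real.exp (β * (ε * N)) * (((N : ℝ) + 1) ^ q * Real.exp (-(N * β * -L)))) :=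
          mul_le_mul_of_nonneg_left h1 (Real.exp_pos _).le
      _ = 1 * ((N : ℝ) + 1) ^ q *
          Real.exp (-(Real.log 2 * (M * N)) + β * (ε * N) + -(N * β * -L)) := by
          rw [Real.exp_add, Real.exp_add]; ring
      _ ≤ _ := by
          refine mul_le_mul_of_nonneg_left (Real.exp_le_exp.mpr ?_) (by positivity)
          have h3 := mul_le_mul_of_nonneg_right hM hNpos.le
          have h4 : F ≤ L := (abs_le.mp (hL _ (h.mem i₀))).2
          have h5 : N * β * F ≤ N * β * L := mul_le_mul_of_nonneg_left h4 (by positivity)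
          nlinarith
  -- The barrier gives `20`; the perturbed Poincaré inequality costs `2 + 1` and the perturbed
  -- capacity `1`, leaving `16 = 14 + 2`.
  · refine le_quarter_mul (C := 4 * M * q * Real.exp (β / 2)) (c := 14 * (β * ε)) (p := 5 * q + 2)
      (by positivity) ?_ hZ0 hZ hq2'
    have h1 := capacity_meanField_le (N := N) hβ hN0 (v := F + 20 * ε) (hbar i₀ hi₀) hsep hmr hNr
      (hAeq ▸ hA) (hAeq ▸ hBeq ▸ hAB)
    rw [← hAeq, ← hBeq] at h1
    have h2 := (capacity_mono hc (isConductance_conduct β meanField) hA hAB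
      (conduct_le_of_abs_le hβ.le hg)).trans (mul_le_mul_of_nonneg_left h1 (Real.exp_pos _).le)
    have h3 : (N : ℝ) ^ 2 ≤ ((N : ℝ) + 1) ^ 2 := pow_le_pow_left₀ hNpos.le (by linarith) 2
    change 2 * ((M * N : ℕ) : ℝ) * _ * capacity (conduct β g) A B ≤ _
    calc _ ≤ 2 * ((M * N : ℕ) : ℝ) * (Real.exp (β * (ε * N)) ^ 2 * poincareConst q β N ε) *
          (Real.exp (β * (ε * N)) * (((N : ℝ) + 1) ^ q * Real.exp (-(N * β * (F + 20 * ε))))) := by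
          refine mul_le_mul_of_nonneg_left h2 ?_
          have := poincareConst_nonneg q β N ε
          positivity
      _ = 4 * M * q * Real.exp (β / 2) * ((N : ℝ) + 1) ^ (5 * q) * (N : ℝ) ^ 2 *
          Real.exp (-(14 * (β * ε) * N) - N * β * F - 2 * β * ε * N) := by
          have : Real.exp (-(14 * (β * ε) * N) - N * β * F - 2 * β * ε * N) =
              Real.exp (β * (ε * N)) ^ 2 * Real.exp (N * β * ε) * Real.exp (β * (ε * N)) *
                Real.exp (-(N * β * (F + 20 * ε))) := by
            rw [← Real.exp_nat_mul, ← Real.exp_add, ← Real.exp_add, ← Real.exp_add]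
            congr 1; push_cast; ring
          rw [this, poincareConst]
          push_cast
          ring
      _ ≤ _ := by
          refine mul_le_mul_of_nonneg_right ?_ (Real.exp_pos _).le
          rw [pow_add, ← mul_assoc]
          exact mul_le_mul_of_nonneg_left h3 (by positivity)
  -- A level in neither basin leads to a minimum outside both index sets, at height at least `20`;
  -- the lattice error and the climb cost `1` each. The perturbation costs one more, leaving `17 =
  -- 15 + 2`.
  · refine le_quarter_mul (C := 1) (c := 15 * (β * ε)) (p := q) zero_le_one ?_ hZ0 hZ hq3
    have h1 := sum_weight_le_of_abs_le hβ hN0 hg (v := F + 18 * ε)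
      (T := Finset.univ.filter fun σ => cnt σ ∉ W IA ∧ cnt σ ∉ W IB) fun σ hσ => by
        obtain ⟨hσA, hσB⟩ := (Finset.mem_filter.mp hσ).2
        obtain ⟨i, k, hk, hrk⟩ := hreach (cnt σ)
        have hiA : i ∉ IA := fun hi => hσA ((hW _ _).mpr ⟨k, (hT _ _).mpr ⟨i, hi, hk⟩, hrk⟩)
        have hiB : i ∉ IB := fun hi => hσB ((hW _ _).mpr ⟨k, (hT _ _).mpr ⟨i, hi, hk⟩, hrk⟩)
        have h2 := freeEnergy_le_of_reachable hrk (by linarith)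
        have h3 := hun _ (h.mem i) (freq N k.1) (freq_mem hN0 k.sum_eq) (by
          rw [hk, dist_comm]; exact (hmd i).trans_le (min_le_right _ _))
        have h4 := hdeep i₀ hi₀ i hiA hiB
        change F + 18 * ε ≤ freeEnergy β (freq N (cnt σ).1)
        linarith
    refine h1.trans (le_of_eq ?_)
    have : Real.exp (-(15 * (β * ε) * N) - N * β * F - 2 * β * ε * N) =
        Real.exp (β * (ε * N)) * Real.exp (-(N * β * (F + 18 * ε))) := by
      rw [← Real.exp_add]; congr 1; ring
    rw [this]; ring

end Localization

end Potts

end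

noncomputable section

namespace Potts

/-! ### Concentration of Lipschitz functions of independent variables -/

section Concentration

lemma exp_le_add_sq_mul_exp_abs (y : ℝ) : Real.exp y ≤ 1 + y + y ^ 2 * Real.exp |y| := by
  have h := Complex.norm_exp_sub_sum_le_norm_mul_exp (y : ℂ) 2
  have h1 : Complex.exp (y : ℂ) - ∑ m ∈ Finset.range 2, (y : ℂ) ^ m / (m.factorial : ℂ) =
      ((Real.exp y - (1 + y) : ℝ) : ℂ) := by
    simp [Finset.sum_range_succ]
  rw [h1, Complex.norm_real, Complex.norm_real, Real.norm_eq_abs, Real.norm_eq_abs, sq_abs] at h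
  linarith [le_abs_self (Real.exp y - (1 + y))]

/-- `f` is Lipschitz with constant `L` in every coordinate. -/
def CoordLipschitz {ι : Type*} [Fintype ι] (L : ℝ) (f : (ι → ℝ) → ℝ) : Prop :=
  ∀ x y, |f x - f y| ≤ L * ∑ i, |x i - y i|

/-- A sub-Gaussian bound for the Laplace transform of Lipschitz functions near the origin. -/
structure LaplaceBound (ν : Measure ℝ) (t a : ℝ) : Prop where
  integrable : Integrable (fun x => Real.exp (t * |x|)) ν
  le : ∀ (φ : ℝ → ℝ) (l L : ℝ), (∀ x y, |φ x - φ y| ≤ L * |x - y|) → |l| * L ≤ t →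
    ∫ x, Real.exp (l * φ x) ∂ν ≤ Real.exp (a * (l * L) ^ 2 + l * ∫ x, φ x ∂ν)

lemma integrable_abs_of_integrable_exp {ν : Measure ℝ} {t : ℝ} (ht : 0 < t)
    (h : Integrable (fun x => Real.exp (t * |x|)) ν) : Integrable (fun x : ℝ => |x|) ν := by
  refine (h.const_mul (1 / t)).mono' (by fun_prop) (ae_of_all _ fun x => ?_)
  rw [Real.norm_eq_abs, abs_abs]
  have := Real.add_one_le_exp (t * |x|)
  rw [one_div, ← div_eq_inv_mul, le_div_iff₀ ht]
  linarith

lemma LaplaceBound.integrable_abs {ν : Measure ℝ} {t a : ℝ} (h : LaplaceBound ν t a) (ht : 0 < t) :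
    Integrable (fun x : ℝ => |x|) ν := integrable_abs_of_integrable_exp ht h.integrable

lemma continuous_of_abs_sub_le {φ : ℝ → ℝ} {L : ℝ} (h : ∀ x y, |φ x - φ y| ≤ L * |x - y|) :
    Continuous φ := by
  have hL : 0 ≤ L := by
    have := (abs_nonneg _).trans (h 1 0)
    simpa using this
  exact (LipschitzWith.of_dist_le_mul (K := ⟨L, hL⟩) fun x y => h x y).continuous

/-- A measure with exponential moments satisfies a sub-Gaussian Laplace bound near the origin. -/
theorem exists_laplaceBound {ν : Measure ℝ} [IsProbabilityMeasure ν]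
    (h : 0 ∈ interior (integrableExpSet id ν)) : ∃ t > 0, ∃ a > 0, LaplaceBound ν t a := by
  obtain ⟨ρ, hρ, hball⟩ := Metric.mem_nhds_iff.mp (mem_interior_iff_mem_nhds.mp h)
  -- Moments of order `2 * t` remain available: one `t` serves the exponential remainder, the other
  -- absorbs the quadratic factor.
  obtain ⟨t, ht⟩ : ∃ t, ρ = 3 * t := ⟨ρ / 3, by ring⟩
  have ht0 : 0 < t := by linarith
  have hint : ∀ s, |s| < ρ → Integrable (fun x : ℝ => Real.exp (s * x)) ν := fun s hs =>
    hball (by simpa [Real.norm_eq_abs] using hs)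
  have h2 : Integrable (fun x : ℝ => Real.exp (2 * t * |x|)) ν :=
    integrable_exp_mul_abs (X := id) (hint _ (by rw [abs_of_pos (by linarith)]; linarith))
      (hint _ (by rw [abs_neg, abs_of_pos (by linarith)]; linarith))
  have h1 : Integrable (fun x : ℝ => Real.exp (t * |x|)) ν :=
    integrable_exp_mul_abs (X := id) (hint _ (by rw [abs_of_pos (by linarith)]; linarith))
      (hint _ (by rw [abs_neg, abs_of_pos (by linarith)]; linarith))
  have habs := integrable_abs_of_integrable_exp ht0 h1
  set m := ∫ x, |x| ∂ν with hm
  have hm0 : 0 ≤ m := integral_nonneg fun x => abs_nonneg x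
  have hI : Integrable (fun x : ℝ => 2 / t ^ 2 * Real.exp (2 * t * (|x| + m))) ν := by
    have := (h2.mul_const (Real.exp (2 * t * m))).const_mul (2 / t ^ 2)
    refine this.congr (ae_of_all _ fun x => ?_)
    simp only
    rw [← Real.exp_add, ← mul_add]
  refine ⟨t, ht0, ∫ x, 2 / t ^ 2 * Real.exp (2 * t * (|x| + m)) ∂ν, ?_, h1, ?_⟩
  · have h0 : ∫ _, 2 / t ^ 2 ∂ν ≤ ∫ x, 2 / t ^ 2 * Real.exp (2 * t * (|x| + m)) ∂ν :=
      integral_mono (integrable_const _) hI fun x => by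
        refine le_mul_of_one_le_right (by positivity) (Real.one_le_exp (by positivity))
    rw [integral_const, probReal_univ, one_smul] at h0
    exact lt_of_lt_of_le (by positivity) h0
  intro φ l L hφ hl
  have hL : 0 ≤ L := by
    have := (abs_nonneg _).trans (hφ 1 0)
    simpa using this
  have hφc := continuous_of_abs_sub_le hφ
  have hφi : Integrable φ ν := by
    refine ((integrable_const |φ 0|).add (habs.const_mul L)).mono'
      hφc.aestronglyMeasurable (ae_of_all _ fun x => ?_)
    have h3 := hφ x 0
    rw [sub_zero] at h3
    have := abs_sub_abs_le_abs_sub (φ x) (φ 0)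
    simp only [Real.norm_eq_abs, Pi.add_apply]
    linarith
  set e := ∫ x, φ x ∂ν with he
  have hdev : ∀ x, |φ x - e| ≤ L * (|x| + m) := by
    intro x
    have h3 : φ x - e = ∫ y, (φ x - φ y) ∂ν := by
      rw [integral_sub (integrable_const _) hφi, integral_const, probReal_univ, one_smul]
    rw [h3]
    refine (abs_integral_le_integral_abs).trans ?_
    have h4 : ∫ y, |φ x - φ y| ∂ν ≤ ∫ y, L * (|x| + |y|) ∂ν :=
      integral_mono ((integrable_const _).sub hφi).abs
        (((integrable_const _).add habs).const_mul L) fun y =>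
        (hφ x y).trans (mul_le_mul_of_nonneg_left (abs_sub x y) hL)
    refine h4.trans (le_of_eq ?_)
    rw [integral_const_mul, integral_add (integrable_const _) habs, integral_const, probReal_univ,
      one_smul]
  -- The linear term integrates to zero, so only a multiple of `(l * L) ^ 2` remains, and `1 + y ≤
  -- exp y` turns it into the sub-Gaussian bound.
  have hpt : ∀ x, Real.exp (l * (φ x - e)) ≤
      1 + l * (φ x - e) + (l * L) ^ 2 * (2 / t ^ 2 * Real.exp (2 * t * (|x| + m))) := by
    intro x
    refine (exp_le_add_sq_mul_exp_abs _).trans ?_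
    have hu : 0 ≤ |x| + m := by positivity
    have h3 : |l * (φ x - e)| ≤ |l| * L * (|x| + m) := by
      rw [abs_mul, mul_assoc]
      exact mul_le_mul_of_nonneg_left (hdev x) (abs_nonneg _)
    have h4 : (l * (φ x - e)) ^ 2 ≤ (l * L) ^ 2 * (|x| + m) ^ 2 := by
      rw [← sq_abs]
      calc _ ≤ (|l| * L * (|x| + m)) ^ 2 := pow_le_pow_left₀ (abs_nonneg _) h3 2
        _ = _ := by rw [mul_pow, mul_pow, sq_abs, mul_pow]
    have h5 : Real.exp |l * (φ x - e)| ≤ Real.exp (t * (|x| + m)) :=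
      Real.exp_le_exp.mpr (h3.trans (mul_le_mul_of_nonneg_right hl hu))
    have h6 : (|x| + m) ^ 2 ≤ 2 / t ^ 2 * Real.exp (t * (|x| + m)) := by
      have := Real.pow_div_factorial_le_exp (t * (|x| + m)) (by positivity) 2
      rw [mul_pow] at this
      norm_num at this
      rw [div_mul_eq_mul_div, le_div_iff₀ (by positivity)]
      linarith
    have h7 : Real.exp (2 * t * (|x| + m)) =
        Real.exp (t * (|x| + m)) * Real.exp (t * (|x| + m)) := by
      rw [← Real.exp_add]; congr 1; ring
    have h8 : (l * (φ x - e)) ^ 2 * Real.exp |l * (φ x - e)| ≤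
        (l * L) ^ 2 * (2 / t ^ 2 * Real.exp (2 * t * (|x| + m))) := by
      calc _ ≤ (l * L) ^ 2 * (|x| + m) ^ 2 * Real.exp (t * (|x| + m)) :=
            mul_le_mul h4 h5 (Real.exp_pos _).le (by positivity)
        _ ≤ (l * L) ^ 2 * (2 / t ^ 2 * Real.exp (t * (|x| + m))) * Real.exp (t * (|x| + m)) := by
            gcongr
        _ = _ := by rw [h7]; ring
    linarith
  have hJ1 : Integrable (fun x => l * (φ x - e)) ν := (hφi.sub (integrable_const _)).const_mul l
  have hJ2 : Integrable (fun x => 1 + l * (φ x - e)) ν := (integrable_const _).add hJ1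
  have hJ : Integrable (fun x => 1 + l * (φ x - e) +
      (l * L) ^ 2 * (2 / t ^ 2 * Real.exp (2 * t * (|x| + m)))) ν :=
    hJ2.add (hI.const_mul _)
  have hcent : ∫ x, (φ x - e) ∂ν = 0 := by
    rw [integral_sub hφi (integrable_const _), integral_const, probReal_univ, one_smul, sub_self]
  have hfin : ∫ x, Real.exp (l * (φ x - e)) ∂ν ≤
      1 + (∫ x, 2 / t ^ 2 * Real.exp (2 * t * (|x| + m)) ∂ν) * (l * L) ^ 2 := by
    have h3 := integral_mono_of_nonneg (ae_of_all ν fun x => (Real.exp_pos (l * (φ x - e))).le) hJ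
      (ae_of_all _ hpt)
    refine h3.trans (le_of_eq ?_)
    rw [integral_add hJ2 (hI.const_mul _), integral_add (integrable_const _) hJ1,
      integral_const, integral_const_mul, integral_const_mul, hcent, probReal_univ]
    simp only [smul_eq_mul]
    ring
  have hshift : ∫ x, Real.exp (l * φ x) ∂ν =
      Real.exp (l * e) * ∫ x, Real.exp (l * (φ x - e)) ∂ν := by
    rw [← integral_const_mul]
    refine integral_congr_ae (ae_of_all _ fun x => ?_)
    simp only
    rw [← Real.exp_add]; congr 1; ring
  rw [hshift, add_comm, Real.exp_add]
  refine mul_le_mul_of_nonneg_left (hfin.trans ?_) (Real.exp_pos _).le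
  rw [add_comm]
  exact Real.add_one_le_exp _

variable {ι : Type*} [Fintype ι] {ν : Measure ℝ} [IsProbabilityMeasure ν] {t a : ℝ}

lemma CoordLipschitz.continuous {L : ℝ} {f : (ι → ℝ) → ℝ} (hf : CoordLipschitz L f) :
    Continuous f := by
  refine continuous_iff_continuousAt.mpr fun x => ?_
  refine tendsto_iff_dist_tendsto_zero.mpr ?_
  have h1 : Tendsto (fun y : ι → ℝ => L * ∑ i, |y i - x i|) (𝓝 x) (𝓝 (L * ∑ i, |x i - x i|)) := by
    have : Continuous fun y : ι → ℝ => L * ∑ i, |y i - x i| := by fun_prop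
    exact this.tendsto x
  simp only [sub_self, abs_zero, Finset.sum_const_zero, mul_zero] at h1
  exact squeeze_zero (fun _ => dist_nonneg) (fun y => hf y x) h1

lemma CoordLipschitz.integrable {L : ℝ} {f : (ι → ℝ) → ℝ} (hf : CoordLipschitz L f)
    (h : LaplaceBound ν t a) (ht : 0 < t) : Integrable f (Measure.pi fun _ : ι => ν) := by
  have h1 : Integrable (fun x : ι → ℝ => |f 0| + L * ∑ i, |x i|) (Measure.pi fun _ : ι => ν) :=
    (integrable_const _).add ((integrable_finsetSum _ fun i _ =>
      integrable_comp_eval (h.integrable_abs ht)).const_mul L)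
  refine h1.mono' hf.continuous.aestronglyMeasurable (ae_of_all _ fun x => ?_)
  have h3 := hf x 0
  simp only [Pi.zero_apply, sub_zero] at h3
  have := abs_sub_abs_le_abs_sub (f x) (f 0)
  rw [Real.norm_eq_abs]
  linarith

lemma CoordLipschitz.integrable_exp {l L : ℝ} {f : (ι → ℝ) → ℝ} (hf : CoordLipschitz L f)
    (h : LaplaceBound ν t a) (hl : |l| * L ≤ t) :
    Integrable (fun x => Real.exp (l * f x)) (Measure.pi fun _ : ι => ν) := by
  have h1 : Integrable (fun x : ι → ℝ => Real.exp (|l| * |f 0|) * ∏ i, Real.exp (t * |x i|))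
      (Measure.pi fun _ : ι => ν) :=
    (Integrable.fintype_prod (f := fun _ x => Real.exp (t * |x|))
      fun _ : ι => h.integrable).const_mul _
  have := hf.continuous
  refine h1.mono' (by fun_prop) (ae_of_all _ fun x => ?_)
  rw [Real.norm_eq_abs, Real.abs_exp, ← Real.exp_sum, ← Real.exp_add, ← Finset.mul_sum]
  refine Real.exp_le_exp.mpr ?_
  have h3 := hf x 0
  simp only [Pi.zero_apply, sub_zero] at h3
  have h4 := abs_sub_abs_le_abs_sub (f x) (f 0)
  have h5 : 0 ≤ ∑ i, |x i| := Finset.sum_nonneg fun i _ => abs_nonneg _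
  calc l * f x ≤ |l| * |f x| := by rw [← abs_mul]; exact le_abs_self _
    _ ≤ |l| * (|f 0| + L * ∑ i, |x i|) :=
        mul_le_mul_of_nonneg_left (by linarith) (abs_nonneg _)
    _ = |l| * |f 0| + |l| * L * ∑ i, |x i| := by ring
    _ ≤ _ := by linarith [mul_le_mul_of_nonneg_right hl h5]

/-- Tensorization of the Laplace bound. -/
theorem CoordLipschitz.integral_exp_le (h : LaplaceBound ν t a) (ht : 0 < t) {l L : ℝ}
    (hl : |l| * L ≤ t) (n : ℕ) (f : (Fin n → ℝ) → ℝ) (hf : CoordLipschitz L f) :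
    ∫ x, Real.exp (l * f x) ∂(Measure.pi fun _ => ν) ≤
      Real.exp (n * (a * (l * L) ^ 2) + l * ∫ x, f x ∂(Measure.pi fun _ => ν)) := by
  induction n with
  | zero =>
    rw [Measure.pi_of_empty]
    simp
  | succ n ih =>
    set e := MeasurableEquiv.piFinSuccAbove (fun _ : Fin (n + 1) => ℝ) 0 with he
    have hmp := measurePreserving_piFinSuccAbove (fun _ : Fin (n + 1) => ν) 0
    have hmp' := hmp.symm
    have hsymm : ∀ p, e.symm p = Fin.insertNth (α := fun _ => ℝ) 0 p.1 p.2 := fun _ => rfl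
    have hsum : ∀ p p' : ℝ × (Fin n → ℝ), ∑ i, |e.symm p i - e.symm p' i| =
        |p.1 - p'.1| + ∑ i, |p.2 i - p'.2 i| := fun p p' => by
      rw [Fin.sum_univ_succAbove _ 0]
      simp only [hsymm, Fin.insertNth_apply_same, Fin.insertNth_apply_succAbove]
    have hfi : Integrable (fun p => f (e.symm p)) (ν.prod (Measure.pi fun _ => ν)) :=
      (hmp'.integrable_comp_emb e.symm.measurableEmbedding).mpr (hf.integrable h ht)
    have hei : Integrable (fun p => Real.exp (l * f (e.symm p)))
        (ν.prod (Measure.pi fun _ => ν)) :=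
      (hmp'.integrable_comp_emb (g := fun x => Real.exp (l * f x))
        e.symm.measurableEmbedding).mpr (hf.integrable_exp h hl)
    have h1 : ∫ x, f x ∂(Measure.pi fun _ => ν) =
        ∫ u, ∫ y, f (e.symm (u, y)) ∂(Measure.pi fun _ => ν) ∂ν := by
      rw [← integral_prod _ hfi]
      exact (hmp'.integral_comp' f).symm
    have h2 : ∫ x, Real.exp (l * f x) ∂(Measure.pi fun _ => ν) =
        ∫ u, ∫ y, Real.exp (l * f (e.symm (u, y))) ∂(Measure.pi fun _ => ν) ∂ν := by
      rw [← integral_prod _ hei]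
      exact (hmp'.integral_comp' fun x => Real.exp (l * f x)).symm
    have hsec : ∀ u, CoordLipschitz L fun y => f (e.symm (u, y)) := fun u y y' => by
      have := hf (e.symm (u, y)) (e.symm (u, y'))
      rwa [hsum, sub_self, abs_zero, zero_add] at this
    -- Averaging over all coordinates but one preserves the Lipschitz constant, so the one-variable
    -- bound applies to `φ` after the induction hypothesis has been used on the sections.
    set φ : ℝ → ℝ := fun u => ∫ y, f (e.symm (u, y)) ∂(Measure.pi fun _ => ν) with hφ
    have hφL : ∀ u u', |φ u - φ u'| ≤ L * |u - u'| := by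
      intro u u'
      rw [hφ]
      simp only
      rw [← integral_sub ((hsec u).integrable h ht) ((hsec u').integrable h ht)]
      refine abs_integral_le_integral_abs.trans ?_
      have h3 : ∫ y, |f (e.symm (u, y)) - f (e.symm (u', y))| ∂(Measure.pi fun _ => ν) ≤
          ∫ _, L * |u - u'| ∂(Measure.pi fun _ : Fin n => ν) := by
        refine integral_mono (((hsec u).integrable h ht).sub ((hsec u').integrable h ht)).abs
          (integrable_const _) fun y => ?_
        have := hf (e.symm (u, y)) (e.symm (u', y))
        rw [hsum] at this
        simpa using this
      rwa [integral_const, probReal_univ, one_smul] at h3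
    -- Integrability in one variable is read off from the case of a one-point index set.
    have hφi : Integrable (fun u => Real.exp (n * (a * (l * L) ^ 2) + l * φ u)) ν := by
      have h3 : CoordLipschitz (ι := Unit) L fun x => φ (x ()) := fun x y => by
        simpa using hφL (x ()) (y ())
      have h4 := h3.integrable_exp h hl
      have h5 := (measurePreserving_funUnique ν Unit).symm
      have h6 := (h5.integrable_comp_emb (MeasurableEquiv.measurableEmbedding _)).mpr h4
      simp only [Real.exp_add]
      exact h6.const_mul _
    rw [h2, h1]
    calc ∫ u, ∫ y, Real.exp (l * f (e.symm (u, y))) ∂(Measure.pi fun _ => ν) ∂ν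
        ≤ ∫ u, Real.exp (n * (a * (l * L) ^ 2) + l * φ u) ∂ν :=
          integral_mono hei.integral_prod_left hφi fun u => ih _ (hsec u)
      _ = Real.exp (n * (a * (l * L) ^ 2)) * ∫ u, Real.exp (l * φ u) ∂ν := by
          rw [← integral_const_mul]
          simp only [Real.exp_add]
      _ ≤ Real.exp (n * (a * (l * L) ^ 2)) *
            Real.exp (a * (l * L) ^ 2 + l * ∫ u, φ u ∂ν) :=
          mul_le_mul_of_nonneg_left (h.le φ l L hφL hl) (Real.exp_pos _).le
      _ = _ := by
          rw [← Real.exp_add]; congr 1; push_cast; ring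

end Concentration

end Potts

end

noncomputable section

namespace Potts

/-! ### Tail bounds from the Laplace transform -/

section Tail

variable {ν : Measure ℝ} [IsProbabilityMeasure ν] {t a : ℝ} {n N : ℕ}

lemma CoordLipschitz.neg {L : ℝ} {f : (Fin n → ℝ) → ℝ} (hf : CoordLipschitz L f) :
    CoordLipschitz L fun x => -f x := fun x y => by
  rw [neg_sub_neg, abs_sub_comm]; exact hf x y

/-- Chernoff's bound with the tensorised Laplace estimate; it holds only for `l` up to `t / L`,
which is why large deviations need separate treatment. -/
lemma CoordLipschitz.measureReal_ge_le (h : LaplaceBound ν t a) (ht : 0 < t) {l L : ℝ}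
    (hl0 : 0 ≤ l) (hl : l * L ≤ t) {f : (Fin n → ℝ) → ℝ} (hf : CoordLipschitz L f) (s : ℝ) :
    (Measure.pi fun _ => ν).real {x | s ≤ f x - ∫ y, f y ∂(Measure.pi fun _ => ν)} ≤
      Real.exp (-(l * s) + n * (a * (l * L) ^ 2)) := by
  have hl' : |l| * L ≤ t := by rwa [abs_of_nonneg hl0]
  set E := ∫ y, f y ∂(Measure.pi fun _ => ν) with hE
  have h1 : (Measure.pi fun _ : Fin n => ν).real {x | s ≤ f x - E} =
      (Measure.pi fun _ : Fin n => ν).real {x | s + E ≤ f x} := by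
    congr 1
    ext x
    simp only [Set.mem_ofPred_eq]
    constructor <;> intro <;> linarith
  rw [h1]
  refine (measure_ge_le_exp_mul_mgf (s + E) hl0 (hf.integrable_exp h hl')).trans ?_
  calc _ ≤ Real.exp (-l * (s + E)) * Real.exp (n * (a * (l * L) ^ 2) + l * E) :=
        mul_le_mul_of_nonneg_left (CoordLipschitz.integral_exp_le h ht hl' n f hf)
          (Real.exp_pos _).le
    _ = _ := by rw [← Real.exp_add]; congr 1; ring

/-- Concentration for functions of at most `N ^ 2` variables with Lipschitz constants of order
`1 / N`. -/
theorem CoordLipschitz.measureReal_abs_ge_le (h : LaplaceBound ν t a) (ht : 0 < t) (ha : 0 < a)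
    {κ : ℝ} (hκ : 0 < κ) (hN : N ≠ 0) (hn : n ≤ N ^ 2) {f : (Fin n → ℝ) → ℝ}
    (hf : CoordLipschitz (κ / N) f) {s : ℝ} (hs : 0 ≤ s) :
    (Measure.pi fun _ => ν).real {x | s ≤ |f x - ∫ y, f y ∂(Measure.pi fun _ => ν)|} ≤
      2 * (Real.exp (-(s ^ 2 / (4 * a * κ ^ 2))) + Real.exp (-(a * t ^ 2 * N ^ 2))) := by
  have hNpos : (0 : ℝ) < N := by positivity
  have hone : ∀ f : (Fin n → ℝ) → ℝ, CoordLipschitz (κ / N) f →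
      (Measure.pi fun _ => ν).real {x | s ≤ f x - ∫ y, f y ∂(Measure.pi fun _ => ν)} ≤
        Real.exp (-(s ^ 2 / (4 * a * κ ^ 2))) + Real.exp (-(a * t ^ 2 * N ^ 2)) := by
    intro f hf
    have hb : ∀ l, 0 ≤ l → l * κ ≤ t * N →
        (Measure.pi fun _ => ν).real {x | s ≤ f x - ∫ y, f y ∂(Measure.pi fun _ => ν)} ≤
          Real.exp (-(l * s) + a * κ ^ 2 * l ^ 2) := by
      intro l hl0 hl
      refine (hf.measureReal_ge_le h ht hl0 (L := κ / N) ?_ s).trans (Real.exp_le_exp.mpr ?_)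
      · rw [← mul_div_assoc, div_le_iff₀ hNpos]; exact hl
      · have h1 : (n : ℝ) ≤ N ^ 2 := by exact_mod_cast hn
        have h2 : (n : ℝ) * (a * (l * (κ / N)) ^ 2) ≤ N ^ 2 * (a * (l * (κ / N)) ^ 2) :=
          mul_le_mul_of_nonneg_right h1 (by positivity)
        have h3 : (N : ℝ) ^ 2 * (a * (l * (κ / N)) ^ 2) = a * κ ^ 2 * l ^ 2 := by
          field_simp
        linarith
    -- The optimal `l` is `s / (2 a κ²)`. If it is not admissible, the largest admissible value is
    -- used, and then `s` is so large that the exponent is at most `-a t² N²`.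
    by_cases hc : s / (2 * a * κ ^ 2) * κ ≤ t * N
    · refine (hb _ (by positivity) hc).trans ?_
      refine le_add_of_le_of_nonneg (Real.exp_le_exp.mpr (le_of_eq ?_)) (Real.exp_pos _).le
      field_simp
      ring
    · push Not at hc
      refine (hb (t * N / κ) (by positivity) (by rw [div_mul_cancel₀ _ hκ.ne'])).trans ?_
      refine le_add_of_nonneg_of_le (Real.exp_pos _).le (Real.exp_le_exp.mpr ?_)
      have h1 : t * N * (2 * a * κ) ≤ s := by
        have : s / (2 * a * κ ^ 2) * κ = s / (2 * a * κ) := by field_simp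
        rw [this, lt_div_iff₀ (by positivity)] at hc
        exact hc.le
      have h2 : t * N / κ * (t * N * (2 * a * κ)) ≤ t * N / κ * s :=
        mul_le_mul_of_nonneg_left h1 (by positivity)
      have h3 : t * N / κ * (t * N * (2 * a * κ)) = 2 * (a * t ^ 2 * N ^ 2) := by
        field_simp
      have h4 : a * κ ^ 2 * (t * N / κ) ^ 2 = a * t ^ 2 * N ^ 2 := by
        field_simp
      linarith
  have h1 := hone f hf
  have h2 := hone _ hf.neg
  rw [integral_neg] at h2
  have h3 : {x | s ≤ |f x - ∫ y, f y ∂(Measure.pi fun _ => ν)|} ⊆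
      {x | s ≤ f x - ∫ y, f y ∂(Measure.pi fun _ => ν)} ∪
        {x | s ≤ -f x - -∫ y, f y ∂(Measure.pi fun _ => ν)} := by
    intro x hx
    rcases le_abs.mp (show s ≤ |f x - ∫ y, f y ∂(Measure.pi fun _ => ν)| from hx) with h | h
    · exact Or.inl h
    · right
      simp only [Set.mem_ofPred_eq]
      linarith
  have h4 := measureReal_mono (μ := Measure.pi fun _ : Fin n => ν) h3
  have h5 := h4.trans (measureReal_union_le _ _)
  linarith

end Tail

/-! ### Couplings as functions of a vector -/

section Couplings

variable {q N : ℕ} {β : ℝ}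

/-- Pairs of sites. -/
abbrev Pairs (N : ℕ) : Type := {p : Fin N × Fin N // p.1 < p.2}

/-- An enumeration of the pairs of sites. -/
def pairEquiv (N : ℕ) : Fin (Fintype.card (Pairs N)) ≃ Pairs N := (Fintype.equivFin _).symm

lemma card_pairs_le (N : ℕ) : Fintype.card (Pairs N) ≤ N ^ 2 := by
  refine (Fintype.card_subtype_le _).trans (le_of_eq ?_)
  simp [sq]

open Classical in
/-- The couplings with prescribed values on the pairs of sites. -/
def couplings (N : ℕ) (x : Fin (Fintype.card (Pairs N)) → ℝ) : ℕ → ℕ → ℝ := fun i j =>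
  if h : ∃ p : Pairs N, (p.1.1 : ℕ) = i ∧ (p.1.2 : ℕ) = j then x ((pairEquiv N).symm h.choose)
  else 0

lemma couplings_apply (x : Fin (Fintype.card (Pairs N)) → ℝ) (p : Pairs N) :
    couplings N x p.1.1 p.1.2 = x ((pairEquiv N).symm p) := by
  have h : ∃ p' : Pairs N, (p'.1.1 : ℕ) = p.1.1 ∧ (p'.1.2 : ℕ) = p.1.2 := ⟨p, rfl, rfl⟩
  rw [couplings, dif_pos h]
  congr 2
  exact Subtype.ext (Prod.ext (Fin.ext h.choose_spec.1) (Fin.ext h.choose_spec.2))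

lemma hamiltonian_eq_sum (g : ℕ → ℕ → ℝ) (σ : Config q N) :
    hamiltonian g σ = -(1 / (N : ℝ)) * ∑ k, g (pairEquiv N k).1.1 (pairEquiv N k).1.2 *
      (if σ (pairEquiv N k).1.1 = σ (pairEquiv N k).1.2 then 1 else 0) := by
  rw [hamiltonian, (pairEquiv N).sum_comp fun p : Pairs N => g p.1.1 p.1.2 *
    (if σ p.1.1 = σ p.1.2 then (1 : ℝ) else 0)]
  congr 1
  exact Finset.sum_subtype _ (fun p => by simp) _

lemma hamiltonian_couplings (x : Fin (Fintype.card (Pairs N)) → ℝ) (σ : Config q N) :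
    hamiltonian (couplings N x) σ = -(1 / (N : ℝ)) * ∑ k, x k *
      (if σ (pairEquiv N k).1.1 = σ (pairEquiv N k).1.2 then 1 else 0) := by
  simp only [hamiltonian_eq_sum, couplings_apply, Equiv.symm_apply_apply]

/-- The Hamiltonian sees only entries with `i < j < N`, so an infinite array may be replaced by a
finite vector of independent variables. -/
lemma hamiltonian_eq_couplings (g : ℕ → ℕ → ℝ) (σ : Config q N) :
    hamiltonian g σ =
      hamiltonian (couplings N fun k => g (pairEquiv N k).1.1 (pairEquiv N k).1.2) σ := by
  rw [hamiltonian_couplings, hamiltonian_eq_sum]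

lemma coordLipschitz_hamiltonian (σ : Config q N) :
    CoordLipschitz (1 / N) fun x => hamiltonian (couplings N x) σ := by
  intro x y
  simp only [hamiltonian_couplings]
  rw [← mul_sub, ← Finset.sum_sub_distrib, abs_mul, abs_neg, abs_of_nonneg (by positivity)]
  refine mul_le_mul_of_nonneg_left ((Finset.abs_sum_le_sum_abs _ _).trans
    (Finset.sum_le_sum fun k _ => ?_)) (by positivity)
  split_ifs <;> simp

variable {ν : Measure ℝ} [IsProbabilityMeasure ν] {t a : ℝ}

lemma integral_hamiltonian (hi : Integrable (fun x : ℝ => x) ν) (hν : ∫ x, x ∂ν = 1)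
    (σ : Config q N) :
    ∫ x, hamiltonian (couplings N x) σ ∂(Measure.pi fun _ => ν) = hamiltonian meanField σ := by
  have hk : ∀ k, Integrable (fun x : Fin (Fintype.card (Pairs N)) → ℝ => x k)
      (Measure.pi fun _ => ν) := fun k =>
    integrable_comp_eval (μ := fun _ : Fin (Fintype.card (Pairs N)) => ν) (i := k) hi
  simp only [hamiltonian_couplings]
  rw [hamiltonian_eq_sum, integral_const_mul, integral_finsetSum _ fun k _ => (hk k).mul_const _]
  congr 1
  refine Finset.sum_congr rfl fun k _ => ?_
  rw [integral_mul_const, integral_comp_eval (μ := fun _ : Fin (Fintype.card (Pairs N)) => ν)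
    (f := fun x : ℝ => x) hi.aestronglyMeasurable, hν]
  rfl

/-- Annealed bound for the Boltzmann factors. -/
lemma integral_exp_hamiltonian_sub_le (h : LaplaceBound ν t a) (ht : 0 < t) (ha : 0 < a)
    (hi : Integrable (fun x : ℝ => x) ν) (hν : ∫ x, x ∂ν = 1) (hN : N ≠ 0) {l : ℝ}
    (hl : |l| ≤ t * N) (σ : Config q N) :
    Integrable (fun x => Real.exp (l * (hamiltonian (couplings N x) σ - hamiltonian meanField σ)))
        (Measure.pi fun _ => ν) ∧
      ∫ x, Real.exp (l * (hamiltonian (couplings N x) σ - hamiltonian meanField σ))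
        ∂(Measure.pi fun _ => ν) ≤ Real.exp (a * l ^ 2) := by
  have hNpos : (0 : ℝ) < N := by positivity
  have hl' : |l| * (1 / N) ≤ t := by rwa [mul_one_div, div_le_iff₀ hNpos]
  have hexp : ∀ x, Real.exp (l * (hamiltonian (couplings N x) σ - hamiltonian meanField σ)) =
      Real.exp (-(l * hamiltonian meanField σ)) * Real.exp (l * hamiltonian (couplings N x) σ) :=
    fun x => by rw [← Real.exp_add]; congr 1; ring
  simp only [hexp]
  refine ⟨((coordLipschitz_hamiltonian σ).integrable_exp h hl').const_mul _, ?_⟩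
  rw [integral_const_mul]
  have h1 := CoordLipschitz.integral_exp_le h ht hl' _ _ (coordLipschitz_hamiltonian σ)
  rw [integral_hamiltonian hi hν] at h1
  refine (mul_le_mul_of_nonneg_left h1 (Real.exp_pos _).le).trans ?_
  rw [← Real.exp_add]
  refine Real.exp_le_exp.mpr ?_
  have h2 : (Fintype.card (Pairs N) : ℝ) ≤ N ^ 2 := by exact_mod_cast card_pairs_le N
  have h3 : (Fintype.card (Pairs N) : ℝ) * (a * (l * (1 / N)) ^ 2) ≤
      N ^ 2 * (a * (l * (1 / N)) ^ 2) := mul_le_mul_of_nonneg_right h2 (by positivity)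
  have h4 : (N : ℝ) ^ 2 * (a * (l * (1 / N)) ^ 2) = a * l ^ 2 := by field_simp
  linarith

/-- Comparison of the mean of a random quantity with its mean-field value. -/
lemma abs_integral_sub_le (h : LaplaceBound ν t a) (ht : 0 < t) (ha : 0 < a)
    (hi : Integrable (fun x : ℝ => x) ν) (hν : ∫ x, x ∂ν = 1) (hN : N ≠ 0) (hβ : 0 ≤ β)
    (hl : β ≤ t * N) {f : (Fin (Fintype.card (Pairs N)) → ℝ) → ℝ} {L f₀ : ℝ}
    (hf : CoordLipschitz L f) {b : Config q N → ℝ} (hb : ∀ σ, 0 ≤ b σ) (hb2 : ∑ σ, b σ ≤ 2)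
    (hup : ∀ x, f x - f₀ ≤ ∑ σ, b σ *
      Real.exp (-β * (hamiltonian (couplings N x) σ - hamiltonian meanField σ)))
    (hlow : ∀ x, f₀ - f x ≤ ∑ σ, b σ *
      Real.exp (β * (hamiltonian (couplings N x) σ - hamiltonian meanField σ))) :
    |∫ x, f x ∂(Measure.pi fun _ => ν) - f₀| ≤ 2 * Real.exp (a * β ^ 2) := by
  have hfi := hf.integrable h ht
  have key : ∀ l, |l| ≤ t * N → l ^ 2 = β ^ 2 → ∀ g : (Fin (Fintype.card (Pairs N)) → ℝ) → ℝ,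
      Integrable g (Measure.pi fun _ => ν) → (∀ x, g x ≤ ∑ σ, b σ *
        Real.exp (l * (hamiltonian (couplings N x) σ - hamiltonian meanField σ))) →
      ∫ x, g x ∂(Measure.pi fun _ => ν) ≤ 2 * Real.exp (a * β ^ 2) := by
    intro l hl hlβ g hg hle
    have hI := fun σ : Config q N => integral_exp_hamiltonian_sub_le h ht ha hi hν hN hl σ
    refine (integral_mono hg (integrable_finsetSum _ fun σ _ => (hI σ).1.const_mul (b σ))
      hle).trans ?_
    rw [integral_finsetSum _ fun σ _ => (hI σ).1.const_mul (b σ)]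
    calc _ ≤ ∑ σ, b σ * Real.exp (a * β ^ 2) := by
          refine Finset.sum_le_sum fun σ _ => ?_
          rw [integral_const_mul, ← hlβ]
          exact mul_le_mul_of_nonneg_left (hI σ).2 (hb σ)
      _ = (∑ σ, b σ) * Real.exp (a * β ^ 2) := by rw [Finset.sum_mul]
      _ ≤ _ := mul_le_mul_of_nonneg_right hb2 (Real.exp_pos _).le
  have h1 := key (-β) (by rwa [abs_neg, abs_of_nonneg hβ]) (by ring) _
    (hfi.sub (integrable_const f₀)) hup
  have h2 := key β (by rwa [abs_of_nonneg hβ]) rfl _ ((integrable_const f₀).sub hfi) hlow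
  have h3 : ∫ x, (f x - f₀) ∂(Measure.pi fun _ => ν) = ∫ x, f x ∂(Measure.pi fun _ => ν) - f₀ := by
    rw [integral_sub hfi (integrable_const f₀), integral_const, probReal_univ, one_smul]
  have h4 : ∫ x, (f₀ - f x) ∂(Measure.pi fun _ => ν) = f₀ - ∫ x, f x ∂(Measure.pi fun _ => ν) := by
    rw [integral_sub (integrable_const f₀) hfi, integral_const, probReal_univ, one_smul]
  simp only [Pi.sub_apply] at h1 h2
  rw [h3] at h1
  rw [h4] at h2
  exact abs_le.mpr ⟨by linarith, h1⟩

/-- Concentration around the mean, recentred at the mean-field value `f₀` by adding the bias bound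
to the deviation. -/
theorem measureReal_abs_sub_ge_le (h : LaplaceBound ν t a) (ht : 0 < t) (ha : 0 < a)
    (hi : Integrable (fun x : ℝ => x) ν) (hν : ∫ x, x ∂ν = 1) (hN : N ≠ 0) (hβ : 0 < β)
    (hl : β ≤ t * N) {f : (Fin (Fintype.card (Pairs N)) → ℝ) → ℝ} {f₀ : ℝ}
    (hf : CoordLipschitz (β / N) f) {b : Config q N → ℝ} (hb : ∀ σ, 0 ≤ b σ)
    (hb2 : ∑ σ, b σ ≤ 2)
    (hup : ∀ x, f x - f₀ ≤ ∑ σ, b σ *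
      Real.exp (-β * (hamiltonian (couplings N x) σ - hamiltonian meanField σ)))
    (hlow : ∀ x, f₀ - f x ≤ ∑ σ, b σ *
      Real.exp (β * (hamiltonian (couplings N x) σ - hamiltonian meanField σ)))
    {s : ℝ} (hs : 0 ≤ s) :
    (Measure.pi fun _ => ν).real {x | s + 2 * Real.exp (a * β ^ 2) ≤ |f x - f₀|} ≤
      2 * (Real.exp (-(s ^ 2 / (4 * a * β ^ 2))) + Real.exp (-(a * t ^ 2 * N ^ 2))) := by
  refine (measureReal_mono ?_).trans
    (hf.measureReal_abs_ge_le h ht ha hβ hN (card_pairs_le N) hs)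
  intro x hx
  have h1 := abs_integral_sub_le h ht ha hi hν hN hβ.le hl hf hb hb2 hup hlow
  have h2 := abs_sub_le (f x) (∫ y, f y ∂(Measure.pi fun _ => ν)) f₀
  simp only [Set.mem_ofPred_eq] at hx ⊢
  linarith

/-- The Hamiltonian is uniformly close to the mean-field one. -/
lemma eventually_measureReal_hamiltonian_le (h : LaplaceBound ν t a) (ht : 0 < t) (ha : 0 < a)
    (hi : Integrable (fun x : ℝ => x) ν) (hν : ∫ x, x ∂ν = 1) (hq : q ≠ 0) {d : ℝ} (hd : 0 < d) :
    ∀ᶠ N : ℕ in atTop, (Measure.pi fun _ => ν).real {x | ∃ σ : Config q N,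
      d * N ≤ |hamiltonian (couplings N x) σ - hamiltonian meanField σ|} ≤ Real.exp (-(N : ℝ)) := by
  have hc : 0 < min (d ^ 2 / (4 * a)) (a * t ^ 2) := lt_min (by positivity) (by positivity)
  set c := min (d ^ 2 / (4 * a)) (a * t ^ 2) with hc_def
  have hlq : 0 ≤ Real.log q := Real.log_natCast_nonneg q
  have hl4 : 0 ≤ Real.log 4 := Real.log_nonneg (by norm_num)
  filter_upwards [eventually_ge_atTop 1, tendsto_natCast_atTop_atTop.eventually_ge_atTop
    ((Real.log q + Real.log 4 + 1) / c)] with N hN1 hN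
  have hN0 : N ≠ 0 := by omega
  have hN1' : (1 : ℝ) ≤ N := by exact_mod_cast hN1
  rw [div_le_iff₀ hc] at hN
  have hone : ∀ σ : Config q N, (Measure.pi fun _ => ν).real
      {x | d * N ≤ |hamiltonian (couplings N x) σ - hamiltonian meanField σ|} ≤
        4 * Real.exp (-(c * N ^ 2)) := by
    intro σ
    have h1 := (coordLipschitz_hamiltonian σ).measureReal_abs_ge_le h ht ha one_pos hN0
      (card_pairs_le N) (s := d * N) (by positivity)
    rw [integral_hamiltonian hi hν] at h1
    refine h1.trans ?_
    have h2 : Real.exp (-((d * N) ^ 2 / (4 * a * 1 ^ 2))) ≤ Real.exp (-(c * N ^ 2)) := by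
      refine Real.exp_le_exp.mpr (neg_le_neg ?_)
      have : (d * (N : ℝ)) ^ 2 / (4 * a * 1 ^ 2) = d ^ 2 / (4 * a) * N ^ 2 := by ring
      rw [this]
      exact mul_le_mul_of_nonneg_right (min_le_left _ _) (by positivity)
    have h3 : Real.exp (-(a * t ^ 2 * N ^ 2)) ≤ Real.exp (-(c * N ^ 2)) :=
      Real.exp_le_exp.mpr (neg_le_neg (mul_le_mul_of_nonneg_right (min_le_right _ _)
        (by positivity)))
    linarith
  have hset : {x | ∃ σ : Config q N,
      d * N ≤ |hamiltonian (couplings N x) σ - hamiltonian meanField σ|} =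
      ⋃ σ : Config q N, {x | d * N ≤ |hamiltonian (couplings N x) σ - hamiltonian meanField σ|} := by
    ext x; simp
  rw [hset]
  -- A deviation of order `N` of one energy costs `e^{-cN²}`, which beats the number `q ^ N` of
  -- configurations.
  refine (measureReal_iUnion_fintype_le _).trans ((Finset.sum_le_sum fun σ _ => hone σ).trans ?_)
  rw [Finset.sum_const, nsmul_eq_mul, Finset.card_univ, Fintype.card_fun, Fintype.card_fin,
    Fintype.card_fin]
  have hqe : ((q ^ N : ℕ) : ℝ) = Real.exp (N * Real.log q) := by
    rw [Nat.cast_pow, Real.exp_nat_mul, Real.exp_log (by positivity)]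
  rw [hqe, ← Real.exp_log (show (0 : ℝ) < 4 by norm_num), ← Real.exp_add, ← Real.exp_add]
  refine Real.exp_le_exp.mpr ?_
  have h5 := mul_le_mul_of_nonneg_right hN (show (0 : ℝ) ≤ N by positivity)
  have h6 : Real.log 4 ≤ Real.log 4 * N := le_mul_of_one_le_right hl4 hN1'
  nlinarith

end Couplings

end Potts

end

noncomputable section

namespace Potts

/-! ### Comparison of capacities and partition functions -/

section Network

variable {S : Type*} [Fintype S]

lemma dirichlet_add_mul {c : S → S → ℝ} (hc : IsConductance c) (e f : S → ℝ) :
    dirichlet (fun x y => (e x + e y) * c x y) f f =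
      ∑ x, e x * ∑ y, c x y * (f x - f y) ^ 2 := by
  have h1 : ∑ x, ∑ y, (e x + e y) * c x y * ((f x - f y) * (f x - f y)) =
      ∑ x, ∑ y, e x * (c x y * (f x - f y) ^ 2) + ∑ x, ∑ y, e y * (c x y * (f x - f y) ^ 2) := by
    simp only [← Finset.sum_add_distrib]
    exact Finset.sum_congr rfl fun x _ => Finset.sum_congr rfl fun y _ => by ring
  have h2 : ∑ x, ∑ y, e y * (c x y * (f x - f y) ^ 2) =
      ∑ x, ∑ y, e x * (c x y * (f x - f y) ^ 2) := by
    rw [Finset.sum_comm]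
    exact Finset.sum_congr rfl fun x _ => Finset.sum_congr rfl fun y _ => by
      rw [hc.symm y x]; ring
  rw [dirichlet, h1, h2]
  simp only [Finset.mul_sum]
  ring

/-- The Dirichlet principle with the potential of the reference network as test function. -/
lemma capacity_le_sum {c c' : S → S → ℝ} (hc : IsConductance c) (hc' : IsConductance c')
    {A B : Set S} (hA : A.Nonempty) (hAB : Disjoint A B) {e : S → ℝ}
    (h : ∀ x y, c x y ≤ (e x + e y) * c' x y) :
    capacity c A B ≤ ∑ x, e x * ∑ y, c' x y *
      (equilibrium c' A B x - equilibrium c' A B y) ^ 2 := by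
  have h' := isEquilibrium_equilibrium hc' hA hAB
  rw [← dirichlet_add_mul hc']
  refine ((isEquilibrium_equilibrium hc hA hAB).dirichlet_le hc h'.one h'.zero).trans ?_
  have := dirichlet_mono (c := c) (c' := fun x y => (e x + e y) * c' x y) (K := 1)
    (fun x y => by rw [one_mul]; exact h x y) (equilibrium c' A B)
  rwa [one_mul] at this

/-- The reverse comparison uses the same reference potential, so neither bound involves averages
over a potential that depends on the disorder. -/
lemma capacity_sq_le_mul_sum {c c' : S → S → ℝ} (hc : IsConductance c) (hc' : IsConductance c')
    {A B : Set S} (hA : A.Nonempty) (hAB : Disjoint A B) {e : S → ℝ} (he : ∀ x, 0 ≤ e x)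
    (h : ∀ x y, c' x y ≤ (e x + e y) * c x y) :
    capacity c' A B ^ 2 ≤ capacity c A B * ∑ x, e x * ∑ y, c' x y *
      (equilibrium c' A B x - equilibrium c' A B y) ^ 2 := by
  rw [← dirichlet_add_mul hc']
  refine capacity_sq_le hc hc' (isEquilibrium_equilibrium hc hA hAB)
    (isEquilibrium_equilibrium hc' hA hAB) (fun x y => ?_)
    (fun x y => mul_nonneg (add_nonneg (he x) (he y)) (hc'.nonneg x y))
  have := mul_le_mul_of_nonneg_left (h x y) (hc'.nonneg x y)
  linarith

end Network

section Comparison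

variable {q N : ℕ} {β : ℝ}

/-- A conductance involves the larger of two energies. Bounding the ratio at the endpoint where `H'`
is larger and adding the other endpoint gives a sum of one-configuration factors, whose expectations
are known. -/
lemma conduct_le_add_mul (hβ : 0 ≤ β) (g g' : ℕ → ℕ → ℝ) (σ η : Config q N) :
    conduct β g σ η ≤ (Real.exp (-β * (hamiltonian g σ - hamiltonian g' σ)) +
      Real.exp (-β * (hamiltonian g η - hamiltonian g' η))) * conduct β g' σ η := by
  unfold conduct
  split_ifs
  · rw [mul_left_comm]
    refine mul_le_mul_of_nonneg_left ?_ (by positivity)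
    rw [add_mul, ← Real.exp_add, ← Real.exp_add]
    have h1 := mul_le_mul_of_nonneg_left (le_max_left (hamiltonian g σ) (hamiltonian g η)) hβ
    have h2 := mul_le_mul_of_nonneg_left (le_max_right (hamiltonian g σ) (hamiltonian g η)) hβ
    rcases le_total (hamiltonian g' σ) (hamiltonian g' η) with h | h
    · refine le_add_of_nonneg_of_le (Real.exp_pos _).le (Real.exp_le_exp.mpr ?_)
      rw [max_eq_right h]
      linarith
    · refine le_add_of_le_of_nonneg (Real.exp_le_exp.mpr ?_) (Real.exp_pos _).le
      rw [max_eq_left h]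
      linarith
  · rw [mul_zero]

lemma log_sub_log_le_div {x y : ℝ} (hx : 0 < x) (hy : 0 < y) :
    Real.log x - Real.log y ≤ x / y := by
  rw [← Real.log_div hx.ne' hy.ne']
  exact Real.log_le_self (div_pos hx hy).le

/-- The logarithmic capacity ratio is controlled by averages of Boltzmann factors. -/
lemma exists_log_capacity_sub_le (hβ : 0 ≤ β) (g' : ℕ → ℕ → ℝ) {A B : Set (Config q N)}
    (hA : A.Nonempty) (hB : B.Nonempty) (hAB : Disjoint A B) :
    ∃ b : Config q N → ℝ, (∀ σ, 0 ≤ b σ) ∧ ∑ σ, b σ ≤ 2 ∧ ∀ g : ℕ → ℕ → ℝ,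
      Real.log (capacity (conduct β g) A B) - Real.log (capacity (conduct β g') A B) ≤
        ∑ σ, b σ * Real.exp (-β * (hamiltonian g σ - hamiltonian g' σ)) ∧
      Real.log (capacity (conduct β g') A B) - Real.log (capacity (conduct β g) A B) ≤
        ∑ σ, b σ * Real.exp (β * (hamiltonian g σ - hamiltonian g' σ)) := by
  have hc' := isConductance_conduct (q := q) (N := N) β g'
  have hC' := capacity_pos hc' hA hB hAB
  set h' := equilibrium (conduct β g') A B with hh'
  have hdiv : ∀ e : Config q N → ℝ, (∑ σ, e σ * ∑ η, conduct β g' σ η * (h' σ - h' η) ^ 2) /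
      capacity (conduct β g') A B = ∑ σ, (∑ η, conduct β g' σ η * (h' σ - h' η) ^ 2) /
        capacity (conduct β g') A B * e σ := fun e => by
    rw [Finset.sum_div]
    exact Finset.sum_congr rfl fun σ _ => by ring
  -- The normalised local energy of the reference potential. Its total mass is two, because the
  -- Dirichlet form carries the factor one half.
  refine ⟨fun σ => (∑ η, conduct β g' σ η * (h' σ - h' η) ^ 2) / capacity (conduct β g') A B,
    fun σ => div_nonneg (Finset.sum_nonneg fun η _ =>
      mul_nonneg (hc'.nonneg σ η) (sq_nonneg _)) hC'.le, ?_, fun g => ?_⟩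
  · rw [← Finset.sum_div, div_le_iff₀ hC', capacity, dirichlet, ← mul_assoc]
    norm_num
    exact le_of_eq (Finset.sum_congr rfl fun σ _ => Finset.sum_congr rfl fun η _ => by
      rw [sq])
  have hc := isConductance_conduct (q := q) (N := N) β g
  have hC := capacity_pos hc hA hB hAB
  constructor
  · rw [← hdiv]
    refine (log_sub_log_le_div hC hC').trans (div_le_div_of_nonneg_right ?_ hC'.le)
    exact capacity_le_sum hc hc' hA hAB fun σ η => conduct_le_add_mul hβ g g' σ η
  · rw [← hdiv]
    refine (log_sub_log_le_div hC' hC).trans ?_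
    rw [div_le_div_iff₀ hC hC', ← sq, mul_comm]
    refine capacity_sq_le_mul_sum hc hc' hA hAB (fun σ => (Real.exp_pos _).le) fun σ η => ?_
    refine (conduct_le_add_mul hβ g' g σ η).trans (le_of_eq ?_)
    congr 2 <;> congr 1 <;> ring

/-- The logarithmic ratio of restricted partition functions is controlled by averages of
Boltzmann factors. -/
lemma exists_log_sum_weight_sub_le (g' : ℕ → ℕ → ℝ) {V : Finset (Config q N)}
    (hV : V.Nonempty) :
    ∃ b : Config q N → ℝ, (∀ σ, 0 ≤ b σ) ∧ ∑ σ, b σ ≤ 2 ∧ ∀ g : ℕ → ℕ → ℝ,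
      Real.log (∑ σ ∈ V, weight β g σ) - Real.log (∑ σ ∈ V, weight β g' σ) ≤
        ∑ σ, b σ * Real.exp (-β * (hamiltonian g σ - hamiltonian g' σ)) ∧
      Real.log (∑ σ ∈ V, weight β g' σ) - Real.log (∑ σ ∈ V, weight β g σ) ≤
        ∑ σ, b σ * Real.exp (β * (hamiltonian g σ - hamiltonian g' σ)) := by
  classical
  have hpos : ∀ g, 0 < ∑ σ ∈ V, weight β g σ := fun g =>
    Finset.sum_pos (fun σ _ => weight_pos β g σ) hV
  set Z' := ∑ σ ∈ V, weight β g' σ with hZ'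
  have hsum : ∀ e : Config q N → ℝ, ∑ σ, (if σ ∈ V then weight β g' σ / Z' else 0) * e σ =
      (∑ σ ∈ V, weight β g' σ * e σ) / Z' := fun e => by
    simp only [ite_mul, zero_mul]
    rw [← Finset.sum_filter, Finset.filter_mem_eq_inter, Finset.univ_inter, Finset.sum_div]
    exact Finset.sum_congr rfl fun σ _ => by ring
  refine ⟨fun σ => if σ ∈ V then weight β g' σ / Z' else 0, fun σ => ?_, ?_, fun g => ⟨?_, ?_⟩⟩
  · have h1 := (weight_pos β g' σ).le
    have h2 := (hpos g').le
    dsimp only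
    split_ifs <;> positivity
  · have := hsum 1
    simp only [Pi.one_apply, mul_one] at this
    rw [this, div_self (hpos g').ne']
    norm_num
  · rw [hsum]
    refine (log_sub_log_le_div (hpos g) (hpos g')).trans (le_of_eq ?_)
    congr 1
    refine Finset.sum_congr rfl fun σ _ => ?_
    rw [weight, weight, ← Real.exp_add]
    congr 1; ring
  · rw [hsum]
    refine (log_sub_log_le_div (hpos g') (hpos g)).trans ?_
    rw [div_le_div_iff₀ (hpos g) (hpos g'), ← sq]
    -- Cauchy-Schwarz: the square of the reference weight is the product of the actual weight and
    -- the tilted reference weight.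
    refine Finset.sum_sq_le_sum_mul_sum_of_sq_le_mul V
      (fun σ _ => mul_nonneg (weight_pos β g' σ).le (Real.exp_pos _).le)
      (fun σ _ => (weight_pos β g σ).le) fun σ _ => ?_
    rw [weight, weight, ← Real.exp_nat_mul, ← Real.exp_add, ← Real.exp_add]
    refine le_of_eq ?_
    congr 1; push_cast; ring

lemma abs_log_sub_log_le {x y d : ℝ} (hx : 0 < x) (hy : 0 < y) (h1 : x ≤ Real.exp d * y)
    (h2 : y ≤ Real.exp d * x) : |Real.log x - Real.log y| ≤ d := by
  have h3 := Real.log_le_log hx h1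
  have h4 := Real.log_le_log hy h2
  rw [Real.log_mul (Real.exp_pos _).ne' hy.ne', Real.log_exp] at h3
  rw [Real.log_mul (Real.exp_pos _).ne' hx.ne', Real.log_exp] at h4
  exact abs_le.mpr ⟨by linarith, by linarith⟩

/-- A change of the couplings shifts every energy by at most its `ℓ¹` size over `N`, hence
multiplies all conductances by a bounded factor; capacities are monotone in the conductances. -/
lemma coordLipschitz_log_capacity (hβ : 0 ≤ β) {A B : Set (Config q N)} (hA : A.Nonempty)
    (hB : B.Nonempty) (hAB : Disjoint A B) :
    CoordLipschitz (β / N) fun x => Real.log (capacity (conduct β (couplings N x)) A B) := by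
  have hc := fun x => isConductance_conduct (q := q) (N := N) β (couplings N x)
  have hC := fun x => capacity_pos (hc x) hA hB hAB
  have hle : ∀ x y, capacity (conduct β (couplings N x)) A B ≤
      Real.exp (β / N * ∑ i, |x i - y i|) * capacity (conduct β (couplings N y)) A B := by
    intro x y
    refine capacity_mono (hc x) (hc y) hA hAB fun σ η => ?_
    refine (conduct_le_of_abs_le hβ (fun σ => coordLipschitz_hamiltonian σ x y) σ η).trans
      (le_of_eq ?_)
    congr 2; ring
  intro x y
  refine abs_log_sub_log_le (hC x) (hC y) (hle x y) ((hle y x).trans (le_of_eq ?_))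
  simp only [abs_sub_comm]

lemma coordLipschitz_log_sum_weight (hβ : 0 ≤ β) {V : Finset (Config q N)} (hV : V.Nonempty) :
    CoordLipschitz (β / N) fun x => Real.log (∑ σ ∈ V, weight β (couplings N x) σ) := by
  have hpos : ∀ x, 0 < ∑ σ ∈ V, weight β (couplings N x) σ := fun x =>
    Finset.sum_pos (fun σ _ => weight_pos β _ σ) hV
  have hle : ∀ x y, ∑ σ ∈ V, weight β (couplings N x) σ ≤
      Real.exp (β / N * ∑ i, |x i - y i|) * ∑ σ ∈ V, weight β (couplings N y) σ := by
    intro x y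
    rw [Finset.mul_sum]
    refine Finset.sum_le_sum fun σ _ => ?_
    refine (weight_le_of_abs_le hβ (coordLipschitz_hamiltonian σ x y)).trans (le_of_eq ?_)
    congr 2; ring
  intro x y
  refine abs_log_sub_log_le (hpos x) (hpos y) (hle x y) ((hle y x).trans (le_of_eq ?_))
  simp only [abs_sub_comm]

end Comparison

/-! ### Law of the couplings -/

section Law

variable {Ω : Type*} [MeasurableSpace Ω] {P : Measure Ω} {J : ℕ → ℕ → Ω → ℝ}

lemma IsDisorder.integral_map_eq_one (hJ : IsDisorder P J) : ∫ x, x ∂(P.map (J 0 1)) = 1 := by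
  rw [integral_map (hJ.measurable 0 1 one_pos).aemeasurable (by fun_prop), hJ.mean]

variable [IsProbabilityMeasure P]

lemma IsDisorder.map_eq_pi (hJ : IsDisorder P J) (N : ℕ) :
    P.map (fun ω k => J (pairEquiv N k).1.1 (pairEquiv N k).1.2 ω) =
      Measure.pi fun _ => P.map (J 0 1) := by
  set e : Fin (Fintype.card (Pairs N)) → {p : ℕ × ℕ // p.1 < p.2} := fun k =>
    ⟨((pairEquiv N k).1.1, (pairEquiv N k).1.2), (pairEquiv N k).2⟩ with he
  have hinj : Function.Injective e := by
    intro k k' h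
    have h1 := congrArg Subtype.val h
    simp only [he, Prod.mk.injEq] at h1
    exact (pairEquiv N).injective (Subtype.ext (Prod.ext (Fin.ext h1.1) (Fin.ext h1.2)))
  have hind := hJ.indep.precomp hinj
  rw [iIndepFun_iff_map_fun_eq_pi_map fun k =>
    (hJ.measurable _ _ (e k).2).aemeasurable] at hind
  refine hind.trans ?_
  congr 1
  funext k
  exact (hJ.ident _ _ (e k).2).map_eq

lemma IsDisorder.exists_laplaceBound (hJ : IsDisorder P J) :
    ∃ t > 0, ∃ a > 0, LaplaceBound (P.map (J 0 1)) t a := by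
  have hm := hJ.measurable 0 1 one_pos
  have := Measure.isProbabilityMeasure_map (μ := P) hm.aemeasurable
  refine Potts.exists_laplaceBound ?_
  have : integrableExpSet id (P.map (J 0 1)) = integrableExpSet (J 0 1) P := by
    ext s
    simp only [integrableExpSet, Set.mem_ofPred_eq]
    rw [integrable_map_measure (by fun_prop) hm.aemeasurable]
    rfl
  rw [this]
  exact hJ.exp_moment

end Law

end Potts

end

noncomputable section

namespace Potts

/-! ### From logarithmic comparisons to the ratio of hitting times -/

section Ratio

variable {q N : ℕ}

lemma weight_congr {β : ℝ} {g g' : ℕ → ℕ → ℝ}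
    (h : ∀ σ : Config q N, hamiltonian g σ = hamiltonian g' σ) :
    weight (q := q) (N := N) β g = weight β g' := by
  funext σ; rw [weight, weight, h]

lemma conduct_congr {β : ℝ} {g g' : ℕ → ℕ → ℝ}
    (h : ∀ σ : Config q N, hamiltonian g σ = hamiltonian g' σ) :
    conduct (q := q) (N := N) β g = conduct β g' := by
  funext σ η; rw [conduct, conduct, h, h]

lemma le_exp_mul_of_abs_log_sub_log_le {x y u : ℝ} (hx : 0 < x) (hy : 0 < y)
    (h : |Real.log x - Real.log y| ≤ u) : x ≤ Real.exp u * y ∧ y ≤ Real.exp u * x := by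
  obtain ⟨h1, h2⟩ := abs_le.mp h
  constructor
  · rw [← Real.log_le_log_iff hx (by positivity), Real.log_mul (Real.exp_pos _).ne' hy.ne',
      Real.log_exp]
    linarith
  · rw [← Real.log_le_log_iff hy (by positivity), Real.log_mul (Real.exp_pos _).ne' hx.ne',
      Real.log_exp]
    linarith

/-- The factor `4` collects the factor two of localization from each model, and `2 * u` the
logarithmic errors of valley weight and capacity. -/
lemma div_div_div_le {G G' Z Z' C C' u : ℝ} (hZ : 0 < Z) (hZ' : 0 < Z') (hC : 0 < C)
    (hC' : 0 < C') (hG : G ≤ 2 * Z) (hG' : 1 / 2 * Z' ≤ G')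
    (hzz : |Real.log Z - Real.log Z'| ≤ u) (hcc : |Real.log C - Real.log C'| ≤ u) :
    G / C / (G' / C') ≤ 4 * Real.exp (2 * u) := by
  have hG'0 : 0 < G' := by linarith
  obtain ⟨h1, -⟩ := le_exp_mul_of_abs_log_sub_log_le hZ hZ' hzz
  obtain ⟨-, h2⟩ := le_exp_mul_of_abs_log_sub_log_le hC hC' hcc
  have hE := Real.exp_pos u
  rw [div_div_div_eq, div_le_iff₀ (by positivity), two_mul u, Real.exp_add]
  have h3 : G ≤ 4 * Real.exp u * G' := by nlinarith
  calc G * C' ≤ 4 * Real.exp u * G' * (Real.exp u * C) :=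
        mul_le_mul h3 h2 hC'.le (by positivity)
    _ = _ := by ring

/-- Mean hitting times of two models with comparable valleys and capacities. -/
lemma meanHit_div_meanHit_mem (β : NNReal) {A B : Set (Config q N)} (hA : A.Nonempty)
    (hB : B.Nonempty) (hAB : Disjoint A B) {V : Finset (Config q N)} (hV : V.Nonempty)
    {g g' : ℕ → ℕ → ℝ} {u : ℝ}
    (hG : 1 / 2 * ∑ σ ∈ V, weight β g σ ≤
        ∑ σ, weight β g σ * equilibrium (conduct β g) A B σ ∧
      ∑ σ, weight β g σ * equilibrium (conduct β g) A B σ ≤ 2 * ∑ σ ∈ V, weight β g σ)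
    (hG' : 1 / 2 * ∑ σ ∈ V, weight β g' σ ≤
        ∑ σ, weight β g' σ * equilibrium (conduct β g') A B σ ∧
      ∑ σ, weight β g' σ * equilibrium (conduct β g') A B σ ≤ 2 * ∑ σ ∈ V, weight β g' σ)
    (hzz : |Real.log (∑ σ ∈ V, weight β g σ) - Real.log (∑ σ ∈ V, weight β g' σ)| ≤ u)
    (hcc : |Real.log (capacity (conduct β g) A B) -
      Real.log (capacity (conduct β g') A B)| ≤ u) :
    ENNReal.ofReal (Real.exp (-(2 * u) - Real.log 4)) ≤ meanHit β g A B / meanHit β g' A B ∧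
      meanHit β g A B / meanHit β g' A B ≤ ENNReal.ofReal (Real.exp (2 * u + Real.log 4)) := by
  have hC := fun g => capacity_pos (isConductance_conduct (q := q) (N := N) β g) hA hB hAB
  have hZ : ∀ g, 0 < ∑ σ ∈ V, weight β g σ := fun g =>
    Finset.sum_pos (fun σ _ => weight_pos β g σ) hV
  have h4 : Real.exp (Real.log 4) = 4 := Real.exp_log (by norm_num)
  have hGpos : 0 < ∑ σ, weight β g σ * equilibrium (conduct β g) A B σ := by
    have := hZ g; linarith [hG.1]
  have hGpos' : 0 < ∑ σ, weight β g' σ * equilibrium (conduct β g') A B σ := by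
    have := hZ g'; linarith [hG'.1]
  rw [meanHit_eq β g hA hB hAB, meanHit_eq β g' hA hB hAB,
    ← ENNReal.ofReal_div_of_pos (div_pos hGpos' (hC g'))]
  constructor
  · refine ENNReal.ofReal_le_ofReal ?_
    rw [abs_sub_comm] at hzz hcc
    have h1 := div_div_div_le (hZ g') (hZ g) (hC g') (hC g) hG'.2 hG.1 hzz hcc
    have h2 : 0 < (∑ σ, weight β g' σ * equilibrium (conduct β g') A B σ) /
      capacity (conduct β g') A B := div_pos hGpos' (hC g')
    have h3 : 0 < (∑ σ, weight β g σ * equilibrium (conduct β g) A B σ) /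
      capacity (conduct β g) A B := div_pos hGpos (hC g)
    rw [div_le_iff₀ h3] at h1
    rw [le_div_iff₀ h2, show -(2 * u) - Real.log 4 = -(Real.log 4 + 2 * u) by ring, Real.exp_neg,
      Real.exp_add, h4, inv_mul_le_iff₀ (by positivity)]
    exact h1
  · refine ENNReal.ofReal_le_ofReal ?_
    rw [add_comm, Real.exp_add, h4]
    exact div_div_div_le (hZ g) (hZ g') (hC g) (hC g') hG.2 hG'.1 hzz hcc

end Ratio

end Potts

end

/-! ### Proof of the theorem -/

theorem theorem3 {Ω : Type*} [MeasurableSpace Ω] (P : Measure Ω) [IsProbabilityMeasure P]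
    (J : ℕ → ℕ → Ω → ℝ) (hJ : Potts.IsDisorder P J)
    (q : ℕ) (hq : 2 ≤ q) (β : NNReal) (hβ : Potts.beta1 q < β)
    (m : ℕ → Option (Fin q) → Fin q → ℝ)
    (hm : ∀ N, 1 ≤ N → ∀ i, Potts.IsClosestLatticePt N (Potts.minPt q β i) (m N i))
    (A B : (N : ℕ) → Set (Potts.Config q N)) (hAB : Potts.IsRegime (β : ℝ) m A B) :
    ∃ c₁ c₂ c₃ c₄ c₅ c₆ : ℝ, 0 < c₁ ∧ 0 < c₂ ∧ 0 < c₃ ∧ 0 < c₄ ∧ 0 < c₅ ∧ 0 < c₆ ∧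
      ∃ N₀ : ℕ, ∀ N ≥ N₀, ∀ s : ℝ, 0 ≤ s →
        1 - c₃ * Real.exp (-c₄ * s ^ 2) - c₅ * Real.exp (-c₆ * N) ≤
          P.real {ω |
            ENNReal.ofReal (Real.exp (-s - c₁)) ≤
                Potts.meanHit β (fun i j => J i j ω) (A N) (B N) /
                  Potts.meanHit β Potts.meanField (A N) (B N) ∧
            Potts.meanHit β (fun i j => J i j ω) (A N) (B N) /
                Potts.meanHit β Potts.meanField (A N) (B N) ≤
              ENNReal.ofReal (Real.exp (s + c₂))} := by
  open Potts in
  obtain ⟨hβ0, IA, IB, hW, hABeq⟩ := hAB.exists_isWellPair hq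
  obtain ⟨d, hd, N₁, hN₁⟩ := hW.exists_valley hq hβ0
  obtain ⟨t, ht, a, ha, hL⟩ := hJ.exists_laplaceBound
  have hJm := hJ.measurable 0 1 one_pos
  have hprob := Measure.isProbabilityMeasure_map (μ := P) hJm.aemeasurable
  have hmean := hJ.integral_map_eq_one
  set ν := P.map (J 0 1) with hν
  have hi : Integrable (fun x : ℝ => x) ν :=
    (hL.integrable_abs ht).mono' (by fun_prop) (ae_of_all _ fun x => le_rfl)
  have hl4 : 0 < Real.log 4 := Real.log_pos (by norm_num)
  set K := 2 * Real.exp (a * (β : ℝ) ^ 2) with hK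
  have hK0 : 0 < K := by positivity
  obtain ⟨N₂, hN₂⟩ := eventually_atTop.mp
    ((eventually_measureReal_hamiltonian_le hL ht ha hi hmean (q := q) (by omega) hd).and
      ((eventually_ge_atTop 1).and
        (tendsto_natCast_atTop_atTop.eventually_ge_atTop ((β : ℝ) / t))))
  -- Each logarithm may deviate by `s / 2 + K`. The `4` counts the two Gaussian terms with factor
  -- two from capacity and valley weight, and the `5` adds to the corresponding `e^{-cN²}` terms the
  -- one from the uniform closeness of the Hamiltonian.
  refine ⟨2 * K + Real.log 4, 2 * K + Real.log 4, 4, 1 / (16 * a * (β : ℝ) ^ 2), 5,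
    min 1 (a * t ^ 2), by positivity, by positivity, by norm_num, by positivity, by norm_num,
    lt_min one_pos (by positivity), max N₁ N₂, fun N hN s hs => ?_⟩
  obtain ⟨hham, hN1, hNt⟩ := hN₂ N ((le_max_right _ _).trans hN)
  rw [div_le_iff₀ ht, mul_comm] at hNt
  have hN0 : N ≠ 0 := by omega
  have hN1' : (1 : ℝ) ≤ N := by exact_mod_cast hN1
  obtain ⟨hA, hB, hdisj, V, hV, hval⟩ := hN₁ N ((le_max_left _ _).trans hN) (m N) (hm N hN1)
    (A N) (B N) (hABeq N).1 (hABeq N).2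
  set μ := Measure.pi fun _ : Fin (Fintype.card (Pairs N)) => ν with hμ
  obtain ⟨b₁, hb₁, hb₁2, hcap⟩ := exists_log_capacity_sub_le hβ0.le meanField hA hB hdisj
  obtain ⟨b₂, hb₂, hb₂2, hwei⟩ := exists_log_sum_weight_sub_le (β := β) meanField hV
  have hLc := coordLipschitz_log_capacity hβ0.le hA hB hdisj
  have hLz := coordLipschitz_log_sum_weight hβ0.le hV
  have hs2 : 0 ≤ s / 2 := by linarith
  have hPc := measureReal_abs_sub_ge_le hL ht ha hi hmean hN0 hβ0 hNt hLc hb₁ hb₁2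
    (fun x => (hcap _).1) (fun x => (hcap _).2) hs2
  have hPz := measureReal_abs_sub_ge_le hL ht ha hi hmean hN0 hβ0 hNt hLz hb₂ hb₂2
    (fun x => (hwei _).1) (fun x => (hwei _).2) hs2
  set E₁ := {x | ∃ σ : Config q N,
    d * N ≤ |hamiltonian (couplings N x) σ - hamiltonian meanField σ|} with hE₁
  set E₂ := {x | s / 2 + 2 * Real.exp (a * (β : ℝ) ^ 2) ≤
    |Real.log (capacity (conduct β (couplings N x)) (A N) (B N)) -
      Real.log (capacity (conduct β meanField) (A N) (B N))|} with hE₂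
  set E₃ := {x | s / 2 + 2 * Real.exp (a * (β : ℝ) ^ 2) ≤
    |Real.log (∑ σ ∈ V, weight β (couplings N x) σ) -
      Real.log (∑ σ ∈ V, weight β meanField σ)|} with hE₃
  have hmE : MeasurableSet (E₁ ∪ E₂ ∪ E₃) := by
    refine (MeasurableSet.union ?_ ?_).union ?_
    · have : E₁ = ⋃ σ : Config q N,
          {x | d * N ≤ |hamiltonian (couplings N x) σ - hamiltonian meanField σ|} := by
        ext x; simp [hE₁]
      rw [this]
      refine MeasurableSet.iUnion fun σ => measurableSet_le measurable_const ?_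
      exact (((coordLipschitz_hamiltonian σ).continuous.sub continuous_const).abs).measurable
    · exact measurableSet_le measurable_const
        ((hLc.continuous.sub continuous_const).abs).measurable
    · exact measurableSet_le measurable_const
        ((hLz.continuous.sub continuous_const).abs).measurable
  set X : Ω → Fin (Fintype.card (Pairs N)) → ℝ :=
    fun ω k => J (pairEquiv N k).1.1 (pairEquiv N k).1.2 ω with hX
  have hXm : Measurable X := measurable_pi_lambda _ fun k => hJ.measurable _ _ (pairEquiv N k).2
  have hmap : P.map X = μ := hJ.map_eq_pi N
  have hsub : (X ⁻¹' (E₁ ∪ E₂ ∪ E₃))ᶜ ⊆ {ω |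
      ENNReal.ofReal (Real.exp (-s - (2 * K + Real.log 4))) ≤
          meanHit β (fun i j => J i j ω) (A N) (B N) / meanHit β meanField (A N) (B N) ∧
        meanHit β (fun i j => J i j ω) (A N) (B N) / meanHit β meanField (A N) (B N) ≤
          ENNReal.ofReal (Real.exp (s + (2 * K + Real.log 4)))} := by
    intro ω hω
    simp only [Set.mem_compl_iff, Set.mem_preimage, Set.mem_union, not_or] at hω
    obtain ⟨⟨h1, h2⟩, h3⟩ := hω
    have hH : ∀ σ : Config q N,
        hamiltonian (fun i j => J i j ω) σ = hamiltonian (couplings N (X ω)) σ := fun σ =>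
      hamiltonian_eq_couplings _ σ
    have hg := hval (fun i j => J i j ω) fun σ => by
      rw [hH]
      exact (not_le.mp fun h => h1 ⟨σ, h⟩).le
    -- The mean-field couplings are trivially close to themselves, so the same valley localizes the
    -- denominator.
    have hg' := hval meanField fun σ => by
      rw [sub_self, abs_zero]; positivity
    have hz : |Real.log (∑ σ ∈ V, weight β (fun i j => J i j ω) σ) -
        Real.log (∑ σ ∈ V, weight β meanField σ)| ≤ s / 2 + K := by
      rw [weight_congr hH]
      exact (not_le.mp h3).le
    have hc : |Real.log (capacity (conduct β fun i j => J i j ω) (A N) (B N)) -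
        Real.log (capacity (conduct β meanField) (A N) (B N))| ≤ s / 2 + K := by
      rw [conduct_congr hH]
      exact (not_le.mp h2).le
    have hfin := meanHit_div_meanHit_mem β hA hB hdisj hV hg hg' hz hc
    rw [show -(2 * (s / 2 + K)) - Real.log 4 = -s - (2 * K + Real.log 4) by ring,
      show 2 * (s / 2 + K) + Real.log 4 = s + (2 * K + Real.log 4) by ring] at hfin
    exact hfin
  -- Only the exceptional event has to be measurable; for the event on hitting times, monotonicity
  -- of the outer measure suffices.
  refine le_trans ?_ (measureReal_mono hsub)
  rw [probReal_compl_eq_one_sub (hXm hmE), ← map_measureReal_apply hXm hmE, hmap]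
  have hun : μ.real (E₁ ∪ E₂ ∪ E₃) ≤ μ.real E₁ + μ.real E₂ + μ.real E₃ :=
    (measureReal_union_le _ _).trans (add_le_add (measureReal_union_le _ _) le_rfl)
  have he1 : Real.exp (-(N : ℝ)) ≤ Real.exp (-min 1 (a * t ^ 2) * N) := by
    refine Real.exp_le_exp.mpr ?_
    have := mul_le_mul_of_nonneg_right (min_le_left 1 (a * t ^ 2)) (show (0 : ℝ) ≤ N by positivity)
    linarith
  have he2 : Real.exp (-(a * t ^ 2 * N ^ 2)) ≤ Real.exp (-min 1 (a * t ^ 2) * N) := by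
    refine Real.exp_le_exp.mpr ?_
    have h1 := mul_le_mul_of_nonneg_right (min_le_right 1 (a * t ^ 2))
      (show (0 : ℝ) ≤ N by positivity)
    have h2 : a * t ^ 2 * N * 1 ≤ a * t ^ 2 * N * N :=
      mul_le_mul_of_nonneg_left hN1' (by positivity)
    nlinarith
  have he3 : -((s / 2) ^ 2 / (4 * a * (β : ℝ) ^ 2)) = -(1 / (16 * a * (β : ℝ) ^ 2)) * s ^ 2 := by
    ring
  rw [he3] at hPc hPz
  linarith
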